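/- Let $n=2k+1\ge 3$ be odd and $N=n+1$. Let $C\ell_{N}$ be the complex Clifford algebra generated by $e_0,\dots,e_n$ with $e_ke_l+e_le_k=2\delta_{kl}$, and write points of $\mathbb R^{N}$ as $(\boldsymbol x,s)$ with $\boldsymbol x\in\mathbb R^n$ and $s\in\mathbb R$, where $s$ is the coordinate of index $0$. For $z\in\mathbb C^{N}$ let $\gamma(z)=\sqrt{\sum_i z_i^2}$ with $\operatorname{Re}\gamma\ge 0$. Let $\phi(z)=\frac{\gamma(z)^{2-N}}{\omega_{N}(2-N)}$, where $\omega_{N}=2\pi^{N/2}/\Gamma(N/2)$ is the area of the unit sphere of $\mathbb R^{N}$. For $\varepsilon>0$ let $\phi_\varepsilon(z)=\phi(z)$ if $\operatorname{Re}\gamma(z)>\varepsilon$ and $\phi_\varepsilon(z)=0$ otherwise. For fixed $y\in\mathbb R^{N}$ let $\tilde\delta_\varepsilon(\cdot+iy)$ be the distributional Laplacian of $x\mapsto\phi_\varepsilon(x+iy)$ on $\mathbb R^{N}$, which has compact support, and let $\langle\tilde\delta(\cdot+iy),g\rangle=\lim_{\varepsilon\to0^+}\langle\tilde\delta_\varepsilon(\cdot+iy),g\rangle$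 wherever the limit exists. A function $f:\mathbb R^{N}\to C\ell_{N}$ is extended to $\mathbb C^{N}$ by $$\tilde f(z)=\int_{\mathbb R^{N}}\tilde\delta(x'-z)\,f(x')\,dx',$$ that is, $\tilde f(x+iy)=\langle\tilde\delta(\cdot-iy),\,f(x+\cdot)\rangle$. Let $\mathbf D=\sum_{k=1}^n e_k\partial_{x_k}+e_0\partial_s$ be the elliptic Dirac operator and $\widetilde{\mathbf D}=\sum_{k=1}^n e_k\partial_{x_k}-ie_0\partial_t$ the hyperbolic Dirac operator, which acts on functions of $(\boldsymbol x,t)$. **Theorem.** Let $f:\mathbb R^{N}\to C\ell_{N}$ be of class $C^{k+2}$ and let $j=\mathbf D f$. Then $\tilde f(\boldsymbol x,s+it)$ is defined for all $\boldsymbol x\in\mathbb R^n$ and $s,t\in\mathbb R$, and it is a $C^2$ function of $(\boldsymbol x,s,t)$. Put $\tilde j(\boldsymbol x,s+it)=\widetilde{\mathbf D}\tilde f(\boldsymbol x,s+it)$. Then $\tilde j$ is a $C^1$ function of $(\boldsymbol x,s,t)$ that solves $$\widetilde{\mathbf D}\,\tilde j(\boldsymbol x,s+it)=0\qquad\text{for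 all }\boldsymbol x\in\mathbb R^n,\ s,t\in\mathbb R,$$ and at $t=0$ the functions $\tilde f$ and $\tilde j$ have the initial values $$\tilde f(\boldsymbol x,s)=f(\boldsymbol x,s),\qquad \tilde j(\boldsymbol x,s)=j(\boldsymbol x,s).$$ -/

import Mathlib

namespace HolPot

open scoped ContDiff Topology

/-! ### The complex Clifford algebra -/

/-- The quadratic form `z ↦ ∑ i, z i ^ 2` on `ℂ ^ N`. -/
noncomputable def sumSq (N : ℕ) : QuadraticForm ℂ (Fin N → ℂ) :=
  QuadraticMap.weightedSumSquares ℂ (1 : Fin N → ℂ)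

/-- The complex Clifford algebra on `N` generators that square to `1` and anticommute. -/
def Cl (N : ℕ) : Type := CliffordAlgebra (sumSq N)

noncomputable instance (N : ℕ) : Ring (Cl N) :=
  inferInstanceAs (Ring (CliffordAlgebra (sumSq N)))

noncomputable instance (N : ℕ) : Algebra ℂ (Cl N) :=
  inferInstanceAs (Algebra ℂ (CliffordAlgebra (sumSq N)))

/-- The generators `e i` of the Clifford algebra. -/
noncomputable def e {N : ℕ} (i : Fin N) : Cl N :=
  CliffordAlgebra.ι (sumSq N) (Pi.single i 1)

/-- The complex basis of the Clifford algebra indexed by the subsets `K` of the set of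
generators, obtained from the wedge products of the generators. -/
noncomputable def clBasis (N : ℕ) : Module.Basis (Finset (Fin N)) ℂ (Cl N) :=
  (Pi.basisFun ℂ (Fin N)).ExteriorAlgebra.map
    (CliffordAlgebra.equivExterior (sumSq N)).symm

/-- The linear isomorphism of the Clifford algebra with `ℂ ^ (2 ^ N)` given by the coordinates. -/
noncomputable def clCoord (N : ℕ) : Cl N ≃ₗ[ℂ] (Finset (Fin N) → ℂ) :=
  (clBasis N).equivFun

/-- The Clifford algebra is normed as a finite-dimensional complex vector space, by the maximum of
the moduli of the coordinates.  (All norms on it are equivalent, so that derivatives, smoothness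
and integrals do not depend on this choice.) -/
noncomputable instance (N : ℕ) : NormedAddCommGroup (Cl N) :=
  NormedAddCommGroup.induced (Cl N) (Finset (Fin N) → ℂ) (clCoord N) (clCoord N).injective

noncomputable instance (N : ℕ) : NormedSpace ℂ (Cl N) :=
  NormedSpace.induced ℂ (Cl N) (Finset (Fin N) → ℂ) (clCoord N)

/-! ### Complex distance, holomorphic potential and its source distribution -/

/-- Euclidean space `ℝ ^ N`. -/
abbrev Euc (N : ℕ) : Type := EuclideanSpace ℝ (Fin N)

/-- The complex length `γ(z) = √(∑ i, z i ^ 2)`, with the branch of the root of nonnegative real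
part. -/
noncomputable def complexLength {N : ℕ} (z : Fin N → ℂ) : ℂ :=
  (∑ i, z i ^ 2) ^ (1 / 2 : ℂ)

/-- The area of the unit sphere in `ℝ ^ N`. -/
noncomputable def sphereArea (N : ℕ) : ℝ :=
  2 * Real.pi ^ ((N : ℝ) / 2) / Real.Gamma ((N : ℝ) / 2)

/-- The holomorphic potential `φ(z) = γ(z) ^ (2 - N) / (ω_N (2 - N))`. -/
noncomputable def holPotential {N : ℕ} (z : Fin N → ℂ) : ℂ :=
  complexLength z ^ (2 - (N : ℤ)) / ((sphereArea N : ℂ) * (2 - (N : ℂ)))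

/-- The regularized potential `φ_ε(z) = θ(p - ε) φ(z)`, where `p` is the real part of `γ(z)` and
`θ` is the unit step function. -/
noncomputable def regPotential {N : ℕ} (ε : ℝ) (z : Fin N → ℂ) : ℂ :=
  if ε < (complexLength z).re then holPotential z else 0

/-- The point `x + i y` of `ℂ ^ N`. -/
noncomputable def cpoint {N : ℕ} (x y : Euc N) : Fin N → ℂ :=
  fun i => (x i : ℂ) + (y i : ℂ) * Complex.I

/-- The real part of a point of `ℂ ^ N`. -/
noncomputable def rePart {N : ℕ} (z : Fin N → ℂ) : Euc N := WithLp.toLp 2 fun i => (z i).re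

/-- The imaginary part of a point of `ℂ ^ N`. -/
noncomputable def imPart {N : ℕ} (z : Fin N → ℂ) : Euc N := WithLp.toLp 2 fun i => (z i).im

section

variable {N : ℕ} {F : Type*} [NormedAddCommGroup F] [NormedSpace ℂ F]

/-- The action on a compactly supported test function `g` of the regularized source
`x ↦ δ_ε(x + i y)`, the distributional Laplacian of `x ↦ φ_ε(x + i y)`. -/
noncomputable def regSource (ε : ℝ) (y : Euc N) (g : Euc N → F) : F :=
  ∫ x : Euc N, regPotential ε (cpoint x y) • Laplacian.laplacian g x

/-- `L` is the value at the test function `f` of the source distribution `x ↦ δ(x + i y)`, the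
limit as `ε → 0+` of the regularized sources.  As the sources are supported in arbitrarily small
neighbourhoods of the closed ball of radius `|y|`, they act on a function `f` of arbitrary support
through `χ f`, for any smooth cutoff function `χ` that is `1` near this ball. -/
def IsSourceValue (y : Euc N) (f : Euc N → F) (L : F) : Prop :=
  ∀ χ : Euc N → ℝ, ContDiff ℝ ∞ χ → HasCompactSupport χ →
    (∀ᶠ x in 𝓝ˢ (Metric.closedBall (0 : Euc N) ‖y‖), χ x = 1) →
    Filter.Tendsto (fun ε : ℝ => regSource ε y (fun x => χ x • f x)) (𝓝[>] 0) (𝓝 L)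

/-- `L` is the value `∫ δ(x' - z) f(x') dx'` at `z` of the extension of `f` to `ℂ ^ N`; with
`z = x + i y`, it is the value of the source distribution `x' ↦ δ(x' - i y)` at the translate
`x' ↦ f(x + x')`. -/
def IsExtensionValue (f : Euc N → F) (z : Fin N → ℂ) (L : F) : Prop :=
  IsSourceValue (-imPart z) (fun x' => f (rePart z + x')) L

open Classical in
/-- The extension of `f` from `ℝ ^ N` to `ℂ ^ N` (with value `0` where it is not defined). -/
noncomputable def extension (f : Euc N → F) (z : Fin N → ℂ) : F :=
  if h : ∃ L, IsExtensionValue f z L then h.choose else 0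

end

/-! ### Spacetime and the Dirac operators -/

/-- The point `(x, s)` of `ℝ ^ (n + 1)`; the coordinate of index `0` is `s`. -/
noncomputable def realPoint {n : ℕ} (x : Euc n) (s : ℝ) : Euc (n + 1) :=
  WithLp.toLp 2 (Fin.cons s fun i => x i : Fin (n + 1) → ℝ)

/-- The point `(x, s + i t)` of `ℂ ^ (n + 1)`; the coordinate of index `0` is `s + i t`. -/
noncomputable def spacetimePoint {n : ℕ} (x : Euc n) (s t : ℝ) : Fin (n + 1) → ℂ :=
  Fin.cons ((s : ℂ) + (t : ℂ) * Complex.I) fun i => (x i : ℂ)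

/-- The elliptic Dirac operator `∑ k, e k ∂_k` on `ℝ ^ N`. -/
noncomputable def ellipticDirac {N : ℕ} (f : Euc N → Cl N) (X : Euc N) : Cl N :=
  ∑ k : Fin N, e k * lineDeriv ℝ f X (EuclideanSpace.single k 1)

/-- The hyperbolic Dirac operator `∑ k = 1, …, n, e k ∂_k - i e 0 ∂_t` on functions of `(x, t)`. -/
noncomputable def hyperbolicDirac {n : ℕ} (u : Euc n → ℝ → Cl (n + 1)) (x : Euc n) (t : ℝ) :
    Cl (n + 1) :=
  ∑ k : Fin n, e k.succ * lineDeriv ℝ (fun x' => u x' t) x (EuclideanSpace.single k 1)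
    - Complex.I • (e 0 * deriv (fun t' => u x t') t)

/-- The function `(x, s, t) ↦ f̃(x, s + i t)`, where `f̃` is the extension of `f`. -/
noncomputable def ftilde {n : ℕ} (f : Euc (n + 1) → Cl (n + 1)) (x : Euc n) (s t : ℝ) :
    Cl (n + 1) :=
  extension f (spacetimePoint x s t)

/-- The function `(x, s, t) ↦ j̃(x, s + i t)`: the hyperbolic Dirac operator applied to `f̃`, as a
function of `(x, t)`. -/
noncomputable def jtilde {n : ℕ} (f : Euc (n + 1) → Cl (n + 1)) (x : Euc n) (s t : ℝ) :
    Cl (n + 1) :=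
  hyperbolicDirac (fun x' t' => ftilde f x' s t') x t

end HolPot

/-! The extension of `f` turns out to be an explicit solution of the wave equation in `n = 2K + 3`
space dimensions, with `t` as time, initial value `f` and initial velocity `i ∂_0 f`. Everything
else follows from that formula.

Let `w = wave K f` be `r` times the descended mean of `f` over horizontal spheres of radius `r`.
Spherical means satisfy Darboux's equation (`sphMean_darboux`), which the operators `lower` reduce
step by step to the case where `r` times the function solves the one-dimensional equation
(`IsEPD.lower`). Hence `∂_r² w` is `wave` of the horizontal Laplacian (`deriv_deriv_wave`), and
`holWave = ∂_r w + i ∂_0 w` also solves the wave equation.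

The link with the source distribution is the following. As `N` is even, the potential is a constant
times `(γ²)^(-(K+1))`, cut off inside a spheroid. In cylindrical coordinates `(u, r)`, with the
sphere integrated out, pairing it with the Laplacian of a test function `g` becomes a planar
integral (`regSource_eq`). Integrating by parts in `r` lowers the exponent by one and applies
`lower` to the spherical mean, exactly the step of the descent (`sourceIntegral_succ`). The boundary
terms live on the spheroid and vanish in the limit `ε → 0`, although `γ` degenerates at the rim `u =
0`, `r = |t|` (`tendsto_boundary`). At exponent one, partial fractions and evenness in `r` produce
the Cauchy kernel on the whole plane (`sourceIntegrand_one`). What it is integrated against is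
`(∂_r² + ∂_u²) w = (∂_r + i ∂_u)(∂_r - i ∂_u) w` (`smul_desc_laplacian_eq`), so the Cauchy-Pompeiu
formula (`integral_cauchyKernel_smul`) evaluates the limit as a multiple of `holWave K g 0 t`.

Since `holWave` at radius `t` depends only on `g` near a sphere of radius `|t|`, cutoffs do not
matter, and a Gamma function identity fixes the constant (`isExtensionValue_holWave`). The
hyperbolic Dirac operator squares to the wave operator (`dirac_dirac`), which gives the field
equation. At `t = 0` the velocity `i ∂_0 f` combines with the coefficient `-i e_0` to `e_0 ∂_0 f`,
so the initial value is the elliptic Dirac operator of `f`. -/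

namespace HolPot

open MeasureTheory Filter Set
open scoped ContDiff Topology

/-! ### Directional derivatives and symmetry of mixed derivatives -/

section Directional

variable {V E : Type*} [NormedAddCommGroup V] [NormedSpace ℝ V] [NormedAddCommGroup E]
  [NormedSpace ℝ E]

theorem contDiff_fderiv_apply {f : V → E} {l : ℕ} (hf : ContDiff ℝ ((l + 1 : ℕ) : WithTop ℕ∞) f)
    (v : V) : ContDiff ℝ (l : WithTop ℕ∞) fun x => fderiv ℝ f x v := by
  have h : ContDiff ℝ (l : WithTop ℕ∞) (fderiv ℝ f) := hf.fderiv_right (by push_cast; exact le_rfl)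
  exact h.clm_apply contDiff_const

theorem fderiv_fderiv_apply_comm {f : V → E} (hf : ContDiff ℝ 2 f) (v w x : V) :
    fderiv ℝ (fun y => fderiv ℝ f y v) x w = fderiv ℝ (fun y => fderiv ℝ f y w) x v := by
  have hs : IsSymmSndFDerivAt ℝ f x := hf.contDiffAt.isSymmSndFDerivAt (by simp)
  have hd : DifferentiableAt ℝ (fderiv ℝ f) x :=
    ((hf.fderiv_right (m := 1) (by norm_num)).differentiable (by norm_num)) x
  rw [fderiv_clm_apply hd (differentiableAt_const v), fderiv_clm_apply hd (differentiableAt_const w)]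
  simpa using hs w v

theorem hasDerivAt_of_fderiv_snd {Φ : V → ℝ → E} {p : V} {r : ℝ}
    (h : DifferentiableAt ℝ (fun q : V × ℝ => Φ q.1 q.2) (p, r)) :
    HasDerivAt (Φ p) (fderiv ℝ (fun q : V × ℝ => Φ q.1 q.2) (p, r) (0, 1)) r := by
  have h1 : HasDerivAt (fun s : ℝ => (p, s)) ((0 : V), (1 : ℝ)) r :=
    (hasDerivAt_const r p).prodMk (hasDerivAt_id r)
  exact h.hasFDerivAt.comp_hasDerivAt r h1

end Directional

/-! ### Integrals over a compact space that depend on a parameter -/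

section Parametric

variable {V W E T : Type*} [NormedAddCommGroup E]
  [TopologicalSpace T] [CompactSpace T] [SecondCountableTopology T]
  [MeasurableSpace T] [OpensMeasurableSpace T]

theorem integrable_of_continuous_compactSpace (μ : Measure T) [IsFiniteMeasure μ]
    {F : T → E} (hF : Continuous F) : Integrable F μ := by
  obtain ⟨C, hC⟩ := (isCompact_range hF).isBounded.exists_norm_le
  exact Integrable.of_bound hF.aestronglyMeasurable C (ae_of_all _ fun t => hC _ ⟨t, rfl⟩)

variable [NormedAddCommGroup V] [NormedSpace ℝ V] [FiniteDimensional ℝ V]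
  [NormedAddCommGroup W] [NormedSpace ℝ W] [NormedSpace ℝ E]

/-- On a closed unit ball around `p` times the compact space the derivative of the integrand is
bounded, so a constant dominates. The integration variable enters through a continuous map `ι` into
a normed space, which allows joint smoothness to be stated for `Φ` without a smooth structure on
`T`. -/
theorem hasFDerivAt_integral_compactSpace (μ : Measure T) [IsFiniteMeasure μ]
    {ι : T → W} (hι : Continuous ι) {Φ : V × W → E} (hΦ : ContDiff ℝ 1 Φ) (p : V) :
    HasFDerivAt (fun p => ∫ t, Φ (p, ι t) ∂μ)
      (∫ t, (fderiv ℝ Φ (p, ι t)).comp (ContinuousLinearMap.inl ℝ V W) ∂μ) p := by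
  have hc : Continuous (fderiv ℝ Φ) := hΦ.continuous_fderiv (by norm_num)
  have hc' : Continuous fun q : V × T =>
      (fderiv ℝ Φ (q.1, ι q.2)).comp (ContinuousLinearMap.inl ℝ V W) := by
    have : Continuous fun q : V × T => fderiv ℝ Φ (q.1, ι q.2) := by fun_prop
    exact this.clm_comp continuous_const
  have hK : IsCompact (Metric.closedBall p 1 ×ˢ (univ : Set T)) :=
    (isCompact_closedBall p 1).prod isCompact_univ
  obtain ⟨C, hC⟩ := (hK.image hc').isBounded.exists_norm_le
  refine hasFDerivAt_integral_of_dominated_of_fderiv_le (bound := fun _ => C)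
    (μ := μ) (𝕜 := ℝ) (F := fun p t => Φ (p, ι t)) (F' := fun p t =>
      (fderiv ℝ Φ (p, ι t)).comp (ContinuousLinearMap.inl ℝ V W))
    (Metric.closedBall_mem_nhds p one_pos)
    (Eventually.of_forall fun q => ?_) ?_ ?_ ?_ (integrable_const C) ?_
  · exact (hΦ.continuous.comp (by fun_prop : Continuous fun t => (q, ι t))).aestronglyMeasurable
  · exact integrable_of_continuous_compactSpace μ
      (hΦ.continuous.comp (by fun_prop : Continuous fun t => (p, ι t)))
  · exact (hc'.comp (by fun_prop : Continuous fun t : T => (p, t))).aestronglyMeasurable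
  · exact ae_of_all _ fun t q hq => hC _ ⟨(q, t), ⟨hq, mem_univ _⟩, rfl⟩
  · refine ae_of_all _ fun t q _ => ?_
    exact ((hΦ.differentiable (by norm_num)) (q, ι t)).hasFDerivAt.comp q (hasFDerivAt_prodMk_left q (ι t))

theorem fderiv_integral_compactSpace (μ : Measure T) [IsFiniteMeasure μ]
    {ι : T → W} (hι : Continuous ι) {Φ : V × W → E} (hΦ : ContDiff ℝ 1 Φ) (p v : V) :
    fderiv ℝ (fun p => ∫ t, Φ (p, ι t) ∂μ) p v = ∫ t, fderiv ℝ Φ (p, ι t) (v, 0) ∂μ := by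
  rw [(hasFDerivAt_integral_compactSpace μ hι hΦ p).fderiv, ContinuousLinearMap.integral_apply]
  · rfl
  · have hc : Continuous (fderiv ℝ Φ) := hΦ.continuous_fderiv (by norm_num)
    refine integrable_of_continuous_compactSpace μ ?_
    have : Continuous fun t => fderiv ℝ Φ (p, ι t) := by fun_prop
    exact this.clm_comp continuous_const

/-- Differentiating in the parameter replaces `Φ` by a directional derivative of `Φ`, which is an
integrand of the same kind; hence induction on the order. -/
theorem contDiff_integral_compactSpace (μ : Measure T) [IsFiniteMeasure μ]
    {ι : T → W} (hι : Continuous ι) {l : ℕ} {Φ : V × W → E} (hΦ : ContDiff ℝ (l : WithTop ℕ∞) Φ) :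
    ContDiff ℝ (l : WithTop ℕ∞) fun p => ∫ t, Φ (p, ι t) ∂μ := by
  induction l generalizing Φ with
  | zero =>
    simp only [Nat.cast_zero, contDiff_zero] at hΦ ⊢
    have h : Continuous (Function.uncurry fun (p : V) (t : T) => Φ (p, ι t)) := by
      unfold Function.uncurry; fun_prop
    simpa using continuous_parametric_integral_of_continuous h isCompact_univ (μ := μ)
  | succ l ih =>
    have h1 : ContDiff ℝ 1 Φ := hΦ.of_le (by push_cast; exact le_add_self)
    push_cast
    rw [contDiff_succ_iff_fderiv_apply]
    refine ⟨fun p => (hasFDerivAt_integral_compactSpace μ hι h1 p).differentiableAt, by simp,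
      fun v => ?_⟩
    simp_rw [fderiv_integral_compactSpace μ hι h1]
    exact ih (contDiff_fderiv_apply hΦ (v, 0))

end Parametric

/-! ### Descent in dimension for functions of the radius -/

section Descent

variable {P E : Type*} [NormedAddCommGroup P] [NormedSpace ℝ P] [NormedAddCommGroup E]
  [NormedSpace ℝ E]

/-- The operator `φ ↦ φ + c r φ'`. -/
noncomputable def lower (c : ℝ) (φ : ℝ → E) : ℝ → E := fun r => φ r + (c * r) • deriv φ r

/-- The composition of the operators `lower` that lead from the Euler-Poisson-Darboux equation
with parameter `2 (m + 1)` to the one with parameter `2`. -/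
noncomputable def desc : ℕ → (ℝ → E) → ℝ → E
  | 0, φ => φ
  | m + 1, φ => desc m (lower (1 / (2 * m + 3)) φ)

theorem contDiff_lower {l : ℕ} {Φ : P → ℝ → E} (c : ℝ)
    (h : ContDiff ℝ ((l + 1 : ℕ) : WithTop ℕ∞) fun q : P × ℝ => Φ q.1 q.2) :
    ContDiff ℝ (l : WithTop ℕ∞) fun q : P × ℝ => lower c (Φ q.1) q.2 := by
  have hd : ∀ q : P × ℝ, deriv (Φ q.1) q.2 = fderiv ℝ (fun q : P × ℝ => Φ q.1 q.2) q (0, 1) :=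
    fun q => (hasDerivAt_of_fderiv_snd (h.differentiable (by simp) _)).deriv
  unfold lower
  simp_rw [hd]
  have h0 : ContDiff ℝ (l : WithTop ℕ∞) fun q : P × ℝ => Φ q.1 q.2 :=
    h.of_le (by push_cast; exact le_self_add)
  exact h0.add ((contDiff_const.mul contDiff_snd).smul (contDiff_fderiv_apply h (0, 1)))

theorem contDiff_desc {l : ℕ} (m : ℕ) {Φ : P → ℝ → E}
    (h : ContDiff ℝ ((m + l : ℕ) : WithTop ℕ∞) fun q : P × ℝ => Φ q.1 q.2) :
    ContDiff ℝ (l : WithTop ℕ∞) fun q : P × ℝ => desc m (Φ q.1) q.2 := by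
  induction m generalizing Φ with
  | zero => simpa [desc] using h
  | succ m ih =>
    rw [show m + 1 + l = m + l + 1 by ring] at h
    exact ih (Φ := fun p => lower (1 / (2 * m + 3)) (Φ p)) (contDiff_lower _ h)

theorem contDiff_lower_single {l : ℕ} {φ : ℝ → E} (c : ℝ)
    (h : ContDiff ℝ ((l + 1 : ℕ) : WithTop ℕ∞) φ) : ContDiff ℝ (l : WithTop ℕ∞) (lower c φ) :=
  (contDiff_lower (P := ℝ) (Φ := fun _ => φ) c (h.comp contDiff_snd)).comp
    (contDiff_const (c := (0 : ℝ)).prodMk contDiff_id)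

theorem contDiff_desc_single {l : ℕ} (m : ℕ) {φ : ℝ → E}
    (h : ContDiff ℝ ((m + l : ℕ) : WithTop ℕ∞) φ) : ContDiff ℝ (l : WithTop ℕ∞) (desc m φ) :=
  (contDiff_desc (P := ℝ) (Φ := fun _ => φ) m (h.comp contDiff_snd)).comp
    (contDiff_const (c := (0 : ℝ)).prodMk contDiff_id)

theorem deriv_lower {φ : ℝ → E} (c : ℝ) (h : ContDiff ℝ 2 φ) (r : ℝ) :
    HasDerivAt (lower c φ) ((1 + c) • deriv φ r + (c * r) • deriv (deriv φ) r) r := by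
  have h1 : ContDiff ℝ 1 (deriv φ) := ((contDiff_succ_iff_deriv (n := 1)).1 (by norm_num; exact h)).2.2
  have h2 : HasDerivAt (deriv φ) (deriv (deriv φ) r) r := (h1.differentiable (by norm_num) r).hasDerivAt
  have h3 : HasDerivAt φ (deriv φ r) r := (h.differentiable (by norm_num) r).hasDerivAt
  have h4 : HasDerivAt (fun r : ℝ => c * r) (c * 1) r := (hasDerivAt_id r).const_mul c
  refine (h3.add (h4.smul h2)).congr_deriv ?_
  rw [mul_one]
  module

/-- The Euler-Poisson-Darboux equation `r φ'' + 2 (m + 1) φ' = r ψ`. -/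
def IsEPD (m : ℕ) (φ ψ : ℝ → E) : Prop :=
  ∀ r, r • deriv (deriv φ) r + (2 * (m + 1) : ℝ) • deriv φ r = r • ψ r

/-- With `c = 1 / (2m + 3)` one has `1 + c = c (2m + 4)`, so the equation for `φ` collapses the
derivative of `lower c φ` to `c r ψ`. One more differentiation gives the equation with the smaller
parameter, and its right side is again `lower c` of `ψ`. -/
theorem IsEPD.lower {m : ℕ} {φ ψ : ℝ → E} (hφ : ContDiff ℝ 2 φ) (hψ : ContDiff ℝ 1 ψ)
    (h : IsEPD (m + 1) φ ψ) :
    IsEPD m (lower (1 / (2 * m + 3)) φ) (lower (1 / (2 * m + 3)) ψ) := by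
  have hc : (2 * m + 3 : ℝ) ≠ 0 := by positivity
  set c : ℝ := 1 / (2 * m + 3) with hcdef
  have hcm : c * (2 * m + 3) = 1 := by rw [hcdef]; field_simp
  have hd : deriv (HolPot.lower c φ) = fun r => (c * r) • ψ r := by
    ext r
    rw [(deriv_lower c hφ r).deriv, mul_smul c r (ψ r), ← h r, show (1 + c) = c * (2 * m + 4) by linarith]
    push_cast
    module
  intro r
  have hψ' : HasDerivAt ψ (deriv ψ r) r := (hψ.differentiable (by norm_num) r).hasDerivAt
  have h4 : HasDerivAt (fun r : ℝ => c * r) (c * 1) r := (hasDerivAt_id r).const_mul c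
  have hdd : deriv (deriv (HolPot.lower c φ)) r = c • ψ r + (c * r) • deriv ψ r := by
    rw [hd, ((h4.fun_smul hψ').congr_deriv (by rw [mul_one, add_comm])).deriv]
  rw [hdd, hd]
  unfold HolPot.lower
  have : r • (c • ψ r + (c * r) • deriv ψ r) + (2 * (m + 1) : ℝ) • (c * r) • ψ r
    = (c * (2 * m + 3) * r) • ψ r + r • (c * r) • deriv ψ r := by module
  rw [this, hcm]
  module

theorem IsEPD.desc {m : ℕ} {φ ψ : ℝ → E} (hφ : ContDiff ℝ ((m + 2 : ℕ) : WithTop ℕ∞) φ)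
    (hψ : ContDiff ℝ (m : WithTop ℕ∞) ψ) (h : IsEPD m φ ψ) : IsEPD 0 (desc m φ) (desc m ψ) := by
  induction m generalizing φ ψ with
  | zero => exact h
  | succ m ih =>
    refine ih (contDiff_lower_single _ (by rwa [show m + 1 + 2 = m + 2 + 1 by ring] at hφ))
      (contDiff_lower_single _ hψ) (IsEPD.lower (hφ.of_le ?_) (hψ.of_le ?_) h)
    · norm_cast; omega
    · norm_cast; omega

/-- `desc` is a differential operator in `r`, hence local. This is what later makes the limit
independent of the cutoff. -/
theorem desc_congr {m : ℕ} {φ ψ : ℝ → E} {r : ℝ} (h : φ =ᶠ[𝓝 r] ψ) :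
    desc m φ =ᶠ[𝓝 r] desc m ψ := by
  induction m generalizing φ ψ with
  | zero => exact h
  | succ m ih =>
    refine ih ?_
    filter_upwards [h, h.deriv] with s h1 h2
    simp [lower, h1, h2]

theorem desc_even (m : ℕ) {φ : ℝ → E} (h : ∀ r, φ (-r) = φ r) (r : ℝ) :
    desc m φ (-r) = desc m φ r := by
  induction m generalizing φ with
  | zero => exact h r
  | succ m ih =>
    refine ih fun s => ?_
    have h1 : deriv φ (-s) = - deriv φ s := by
      have : φ = fun r => φ (-r) := by ext r; rw [h]
      conv_rhs => rw [this, deriv_comp_neg]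
      simp
    simp [lower, h, h1]

theorem desc_zero (m : ℕ) (φ : ℝ → E) : desc m φ 0 = φ 0 := by
  induction m generalizing φ with
  | zero => rfl
  | succ m ih => rw [desc, ih]; simp [lower]

theorem desc_zero_fun (m : ℕ) : desc m (0 : ℝ → E) = 0 := by
  induction m with
  | zero => rfl
  | succ m ih =>
    have : lower (1 / (2 * m + 3)) (0 : ℝ → E) = 0 := by ext; simp [lower]
    rw [desc, this, ih]

theorem desc_add {m : ℕ} {φ ψ : ℝ → E} (hφ : ContDiff ℝ (m : WithTop ℕ∞) φ)
    (hψ : ContDiff ℝ (m : WithTop ℕ∞) ψ) : desc m (φ + ψ) = desc m φ + desc m ψ := by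
  induction m generalizing φ ψ with
  | zero => rfl
  | succ m ih =>
    have : lower (1 / (2 * m + 3)) (φ + ψ)
        = lower (1 / (2 * m + 3)) φ + lower (1 / (2 * m + 3)) ψ := by
      ext r
      simp only [lower, Pi.add_apply]
      rw [deriv_add (hφ.differentiable (by simp) r) (hψ.differentiable (by simp) r)]
      module
    rw [desc, this, ih (contDiff_lower_single _ hφ) (contDiff_lower_single _ hψ)]
    rfl

/-- Each `lower` differentiates only in `r` and has coefficients free of the parameter, so it
commutes with parameter derivatives by the symmetry of second derivatives. -/
theorem fderiv_desc {m : ℕ} {Φ : P → ℝ → E}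
    (h : ContDiff ℝ ((m + 1 : ℕ) : WithTop ℕ∞) fun q : P × ℝ => Φ q.1 q.2) (p v : P) (r : ℝ) :
    fderiv ℝ (fun q : P × ℝ => desc m (Φ q.1) q.2) (p, r) (v, 0)
      = desc m (fun r => fderiv ℝ (fun q : P × ℝ => Φ q.1 q.2) (p, r) (v, 0)) r := by
  induction m generalizing Φ with
  | zero => rfl
  | succ m ih =>
    have h2 : ContDiff ℝ 2 fun q : P × ℝ => Φ q.1 q.2 := h.of_le (by norm_cast; omega)
    have h1 : Differentiable ℝ fun q : P × ℝ => Φ q.1 q.2 := h.differentiable (by simp)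
    have hd : ∀ q : P × ℝ, deriv (Φ q.1) q.2 = fderiv ℝ (fun q : P × ℝ => Φ q.1 q.2) q (0, 1) :=
      fun q => (hasDerivAt_of_fderiv_snd (h1 _)).deriv
    simp only [desc]
    rw [ih (Φ := fun p => lower (1 / (2 * m + 3)) (Φ p)) (contDiff_lower _ h)]
    congr 1
    ext s
    unfold lower
    simp_rw [hd]
    have hA : DifferentiableAt ℝ
        (fun q : P × ℝ => fderiv ℝ (fun q : P × ℝ => Φ q.1 q.2) q (0, 1)) (p, s) :=
      (contDiff_fderiv_apply (l := 1) (by exact_mod_cast h2) (0, 1)).differentiable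
        (by norm_num) _
    have hB : DifferentiableAt ℝ (fun q : P × ℝ => 1 / (2 * (m : ℝ) + 3) * q.2) (p, s) := by fun_prop
    rw [fderiv_fun_add (h1 _) (hB.fun_smul hA), fderiv_fun_smul hB hA]
    have hC : fderiv ℝ (fun q : P × ℝ => 1 / (2 * (m : ℝ) + 3) * q.2) (p, s) (v, 0) = 0 := by
      rw [fderiv_const_mul differentiableAt_snd, fderiv_snd]
      simp
    simp only [add_apply, smul_apply,
      ContinuousLinearMap.smulRight_apply, hC, zero_smul, add_zero]
    rw [fderiv_fderiv_apply_comm h2]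
    congr 2
    have hE : DifferentiableAt ℝ (fun q : P × ℝ =>
        (fun (p : P) (r : ℝ) => fderiv ℝ (fun q : P × ℝ => Φ q.1 q.2) (p, r) (v, 0)) q.1 q.2)
        (p, s) :=
      (contDiff_fderiv_apply (l := 1) (by exact_mod_cast h2) (v, 0)).differentiable
        (by norm_num) _
    exact (hasDerivAt_of_fderiv_snd
      (Φ := fun p r => fderiv ℝ (fun q : P × ℝ => Φ q.1 q.2) (p, r) (v, 0)) hE).deriv.symm

end Descent

end HolPot

namespace HolPot

open MeasureTheory Filter Set
open scoped ContDiff Topology Pointwise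

theorem fderiv_apply_eq_of_hasDerivAt {V E : Type*} [NormedAddCommGroup V] [NormedSpace ℝ V]
    [NormedAddCommGroup E] [NormedSpace ℝ E] {f : V → E} {q v : V} {d : E}
    (hf : DifferentiableAt ℝ f q) (h : HasDerivAt (fun s : ℝ => f (q + s • v)) d 0) :
    fderiv ℝ f q v = d := by
  rw [← hf.lineDeriv_eq_fderiv]
  exact HasLineDerivAt.lineDeriv h

/-! ### Rotation invariance of the surface measure -/

section SphereMeasure

/-- The surface measure of the unit sphere of `ℝ ^ n`. -/
noncomputable def sphereMeasure (n : ℕ) : Measure (Metric.sphere (0 : Euc n) 1) :=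
  (volume : Measure (Euc n)).toSphere

instance (n : ℕ) : IsFiniteMeasure (sphereMeasure n) := by
  unfold sphereMeasure; infer_instance

/-- The action of a linear isometry on the unit sphere. -/
noncomputable def sphereMap {n : ℕ} (A : Euc n ≃ₗᵢ[ℝ] Euc n) (θ : Metric.sphere (0 : Euc n) 1) :
    Metric.sphere (0 : Euc n) 1 :=
  ⟨A θ, by simp⟩

/-- The surface measure of a set is, up to the dimension, the volume of the cone over it, and a
linear isometry maps cones to cones and preserves volume. -/
theorem measurePreserving_sphereMap {n : ℕ} (A : Euc n ≃ₗᵢ[ℝ] Euc n) :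
    MeasurePreserving (sphereMap A) (sphereMeasure n) (sphereMeasure n) := by
  have hc : Continuous (sphereMap A) := by unfold sphereMap; fun_prop
  refine ⟨hc.measurable, ?_⟩
  ext s hs
  rw [Measure.map_apply hc.measurable hs, sphereMeasure,
    Measure.toSphere_apply' _ hs, Measure.toSphere_apply' _ (hc.measurable hs)]
  congr 1
  have : Ioo (0 : ℝ) 1 • (Subtype.val '' (sphereMap A ⁻¹' s))
      = A ⁻¹' (Ioo (0 : ℝ) 1 • (Subtype.val '' s)) := by
    ext x
    simp only [Set.mem_smul, mem_image, mem_preimage]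
    constructor
    · rintro ⟨c, hc, _, ⟨θ, hθ, rfl⟩, rfl⟩
      exact ⟨c, hc, _, ⟨_, hθ, rfl⟩, by simp [sphereMap]⟩
    · rintro ⟨c, hc, _, ⟨θ, hθ, rfl⟩, h⟩
      refine ⟨c, hc, _, ⟨sphereMap A.symm θ, ?_, rfl⟩, ?_⟩
      · have : sphereMap A (sphereMap A.symm θ) = θ := by ext1; simp [sphereMap]
        rwa [this]
      · rw [← A.symm_apply_apply x, ← h]; simp [sphereMap]
  rw [this]
  exact A.measurePreserving.measure_preimage_equiv (f := A.toMeasurableEquiv) _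

theorem integral_comp_isometry_sphere {n : ℕ} {E : Type*} [NormedAddCommGroup E] [NormedSpace ℝ E]
    (A : Euc n ≃ₗᵢ[ℝ] Euc n) {F : Euc n → E} (hF : Continuous F) :
    ∫ θ : Metric.sphere (0 : Euc n) 1, F (A θ) ∂sphereMeasure n
      = ∫ θ : Metric.sphere (0 : Euc n) 1, F θ ∂sphereMeasure n := by
  have h := measurePreserving_sphereMap A
  conv_rhs => rw [← h.map_eq]
  rw [integral_map h.measurable.aemeasurable]
  · rfl
  · exact (hF.comp continuous_subtype_val).aestronglyMeasurable

/-- The rotation by the angle `α` in the plane of the coordinates `i` and `j`, as a linear map. -/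
noncomputable def rotMap {n : ℕ} (i j : Fin n) (α : ℝ) : Euc n →ₗ[ℝ] Euc n where
  toFun x := x + ((Real.cos α - 1) * x i - Real.sin α * x j) • EuclideanSpace.single i (1 : ℝ)
    + (Real.sin α * x i + (Real.cos α - 1) * x j) • EuclideanSpace.single j (1 : ℝ)
  map_add' x y := by simp only [PiLp.add_apply]; module
  map_smul' c x := by simp only [PiLp.smul_apply, smul_eq_mul, RingHom.id_apply]; module

theorem norm_rotMap {n : ℕ} {i j : Fin n} (hij : i ≠ j) (α : ℝ) (x : Euc n) :
    ‖rotMap i j α x‖ = ‖x‖ := by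
  rw [← sq_eq_sq₀ (norm_nonneg _) (norm_nonneg _)]
  simp only [rotMap, LinearMap.coe_mk, AddHom.coe_mk]
  rw [norm_add_sq_real, norm_add_sq_real]
  simp only [inner_add_left, inner_smul_right, inner_smul_left, norm_smul, mul_pow,
    EuclideanSpace.inner_single_right, PiLp.norm_single]
  simp [hij.symm]
  linear_combination (x i ^ 2 + x j ^ 2) * Real.sin_sq_add_cos_sq α

/-- The rotation by the angle `α` in the plane of the coordinates `i` and `j`. -/
noncomputable def rot {n : ℕ} {i j : Fin n} (hij : i ≠ j) (α : ℝ) : Euc n ≃ₗᵢ[ℝ] Euc n :=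
  LinearIsometry.toLinearIsometryEquiv ⟨rotMap i j α, norm_rotMap hij α⟩ rfl

/-- The integral of `h` over the rotated sphere does not depend on the angle. Its derivative at
angle `0` is the integral of `h` differentiated along the rotation field, which therefore vanishes.
This replaces the divergence theorem on the sphere. -/
theorem integral_sphere_rotField {n : ℕ} {E : Type*} [NormedAddCommGroup E] [NormedSpace ℝ E]
    [CompleteSpace E] (i j : Fin n) {h : Euc n → E} (hh : ContDiff ℝ 1 h) :
    ∫ θ : Metric.sphere (0 : Euc n) 1, fderiv ℝ h θ
      (θ.1 i • EuclideanSpace.single j (1 : ℝ) - θ.1 j • EuclideanSpace.single i (1 : ℝ))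
      ∂sphereMeasure n = 0 := by
  by_cases hij : i = j
  · subst hij; simp
  let γ : ℝ × Euc n → Euc n := fun q => q.2
    + ((Real.cos q.1 - 1) * q.2 i - Real.sin q.1 * q.2 j) • EuclideanSpace.single i (1 : ℝ)
    + (Real.sin q.1 * q.2 i + (Real.cos q.1 - 1) * q.2 j) • EuclideanSpace.single j (1 : ℝ)
  have hγ : ContDiff ℝ 1 γ := by
    have hcoord : ∀ l : Fin n, ContDiff ℝ 1 fun q : ℝ × Euc n => q.2 l := fun l =>
      (EuclideanSpace.proj (𝕜 := ℝ) l).contDiff.comp contDiff_snd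
    have hsin : ContDiff ℝ 1 fun q : ℝ × Euc n => Real.sin q.1 :=
      Real.contDiff_sin.comp contDiff_fst
    have hcos : ContDiff ℝ 1 fun q : ℝ × Euc n => Real.cos q.1 :=
      Real.contDiff_cos.comp contDiff_fst
    have h1 := ((hcos.sub (contDiff_const (c := (1 : ℝ)))).mul (hcoord i)).sub (hsin.mul (hcoord j))
    have h2 := (hsin.mul (hcoord i)).add ((hcos.sub (contDiff_const (c := (1 : ℝ)))).mul (hcoord j))
    exact (contDiff_snd.add (h1.smul contDiff_const)).add (h2.smul contDiff_const)
  let Φ : ℝ × Euc n → E := fun q => h (γ q)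
  have hΦ : ContDiff ℝ 1 Φ := hh.comp hγ
  have hconst : ∀ α : ℝ, ∫ θ : Metric.sphere (0 : Euc n) 1, Φ (α, θ.1) ∂sphereMeasure n
      = ∫ θ : Metric.sphere (0 : Euc n) 1, h θ ∂sphereMeasure n := fun α =>
    integral_comp_isometry_sphere (rot hij α) hh.continuous
  have h0 := fderiv_integral_compactSpace (sphereMeasure n) (V := ℝ) continuous_subtype_val hΦ 0 1
  simp_rw [hconst] at h0
  simp only [fderiv_fun_const, Pi.zero_apply, zero_apply] at h0
  rw [h0]
  congr 1
  ext θ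
  have h00 : γ (0, θ.1) = θ.1 := by simp [γ]
  have hcos' : HasDerivAt (fun α => Real.cos α - 1) 0 0 := by
    simpa using (Real.hasDerivAt_cos 0).sub_const 1
  have hsin' : HasDerivAt Real.sin 1 0 := by simpa using Real.hasDerivAt_sin 0
  have hin : HasDerivAt (fun α : ℝ => γ (α, θ.1))
      (θ.1 i • EuclideanSpace.single j (1 : ℝ) - θ.1 j • EuclideanSpace.single i (1 : ℝ)) 0 := by
    have a := ((hcos'.mul_const (θ.1 i)).fun_sub (hsin'.mul_const (θ.1 j))).smul_const
      (EuclideanSpace.single i (1 : ℝ))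
    have b := ((hsin'.mul_const (θ.1 i)).fun_add (hcos'.mul_const (θ.1 j))).smul_const
      (EuclideanSpace.single j (1 : ℝ))
    refine ((a.const_add θ.1).fun_add b).congr_deriv ?_
    module
  have hcomp : HasDerivAt (fun α : ℝ => Φ (α, θ.1)) _ 0 :=
    ((hh.differentiable (by norm_num)) _).hasFDerivAt.comp_hasDerivAt 0 hin
  rw [h00] at hcomp
  exact (fderiv_apply_eq_of_hasDerivAt (hΦ.differentiable (by norm_num) _)
    (by simpa using hcomp)).symm

end SphereMeasure

theorem integrable_sphere {n : ℕ} {E : Type*} [NormedAddCommGroup E] {F : Euc n → E} (hF : Continuous F) :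
    Integrable (fun θ : Metric.sphere (0 : Euc n) 1 => F θ) (sphereMeasure n) :=
  integrable_of_continuous_compactSpace _ (hF.comp continuous_subtype_val)

/-! ### Spherical means in horizontal hyperplanes and Darboux's equation -/

section SphericalMean

variable {E : Type*} [NormedAddCommGroup E] [NormedSpace ℝ E]

/-- The inclusion of `ℝ ^ n` into `ℝ ^ (n + 1)` as the hyperplane where the coordinate of index `0`
vanishes. -/
noncomputable def emb (n : ℕ) : Euc n →L[ℝ] Euc (n + 1) :=
  LinearMap.toContinuousLinearMap
    { toFun := fun x => realPoint x 0
      map_add' := fun x y => by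
        ext i; refine Fin.cases ?_ (fun i => ?_) i <;> simp [realPoint]
      map_smul' := fun c x => by
        ext i; refine Fin.cases ?_ (fun i => ?_) i <;> simp [realPoint] }

theorem emb_single {n : ℕ} (i : Fin n) :
    emb n (EuclideanSpace.single i 1) = EuclideanSpace.single i.succ 1 := by
  ext l
  refine Fin.cases ?_ (fun l => ?_) l
  · simp [emb, realPoint, Ne.symm (Fin.succ_ne_zero i)]
  · simp [emb, realPoint]

theorem realPoint_eq {n : ℕ} (x : Euc n) (s : ℝ) :
    realPoint x s = emb n x + s • EuclideanSpace.single 0 1 := by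
  ext l
  refine Fin.cases ?_ (fun l => ?_) l
  · simp [emb, realPoint]
  · simp [emb, realPoint, Fin.succ_ne_zero]

/-- The integral of `f` over the sphere of centre `X` and radius `r` in the hyperplane through `X`
on which the coordinate of index `0` is constant, with respect to the measure of the unit sphere. -/
noncomputable def sphMean {n : ℕ} (f : Euc (n + 1) → E) (X : Euc (n + 1)) (r : ℝ) : E :=
  ∫ θ : Metric.sphere (0 : Euc n) 1, f (X + r • emb n θ) ∂sphereMeasure n

/-- The Laplacian with respect to the coordinates of index different from `0`. -/
noncomputable def spaceLaplacian {n : ℕ} (f : Euc (n + 1) → E) (X : Euc (n + 1)) : E :=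
  ∑ i : Fin n, fderiv ℝ (fun Y => fderiv ℝ f Y (EuclideanSpace.single i.succ 1)) X
    (EuclideanSpace.single i.succ 1)

variable {n : ℕ} {f : Euc (n + 1) → E}

theorem contDiff_sphMean_integrand {l : ℕ} (hf : ContDiff ℝ (l : WithTop ℕ∞) f) :
    ContDiff ℝ (l : WithTop ℕ∞)
      fun q : (Euc (n + 1) × ℝ) × Euc n => f (q.1.1 + q.1.2 • emb n q.2) := by
  have h1 : ContDiff ℝ (l : WithTop ℕ∞) fun q : (Euc (n + 1) × ℝ) × Euc n => emb n q.2 :=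
    (emb n).contDiff.comp contDiff_snd
  exact hf.comp (contDiff_fst.fst.add (contDiff_fst.snd.smul h1))

theorem contDiff_sphMean {l : ℕ} (hf : ContDiff ℝ (l : WithTop ℕ∞) f) :
    ContDiff ℝ (l : WithTop ℕ∞) fun q : Euc (n + 1) × ℝ => sphMean f q.1 q.2 :=
  contDiff_integral_compactSpace (sphereMeasure n) (W := Euc n)
    continuous_subtype_val (contDiff_sphMean_integrand hf)

theorem contDiff_sphMean_radius {l : ℕ} (hf : ContDiff ℝ (l : WithTop ℕ∞) f) (X : Euc (n + 1)) :
    ContDiff ℝ (l : WithTop ℕ∞) (sphMean f X) :=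
  (contDiff_sphMean hf).comp (contDiff_const.prodMk contDiff_id)

theorem sphMean_add {g : Euc (n + 1) → E} (hf : Continuous f) (hg : Continuous g)
    (X : Euc (n + 1)) : sphMean (f + g) X = sphMean f X + sphMean g X := by
  ext r
  exact integral_add (integrable_sphere (F := fun w => f (X + r • emb n w)) (by fun_prop))
    (integrable_sphere (F := fun w => g (X + r • emb n w)) (by fun_prop))

theorem sphMean_neg_radius (hf : Continuous f) (X : Euc (n + 1)) (r : ℝ) :
    sphMean f X (-r) = sphMean f X r := by
  have := integral_comp_isometry_sphere (LinearIsometryEquiv.neg ℝ)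
    (F := fun w => f (X + r • emb n w)) (by fun_prop)
  simpa [sphMean] using this

theorem sphMean_zero_radius [CompleteSpace E] (X : Euc (n + 1)) :
    sphMean f X 0 = (sphereMeasure n).real univ • f X := by
  simp [sphMean]

theorem fderiv_sphMean (hf : ContDiff ℝ 1 f) (X v : Euc (n + 1)) (r : ℝ) :
    fderiv ℝ (fun q : Euc (n + 1) × ℝ => sphMean f q.1 q.2) (X, r) (v, 0)
      = sphMean (fun Y => fderiv ℝ f Y v) X r := by
  have h1 := contDiff_sphMean_integrand (l := 1) (n := n) (f := f) (by simpa using hf)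
  refine (fderiv_integral_compactSpace (sphereMeasure n) (W := Euc n)
    continuous_subtype_val (by simpa using h1) (X, r) (v, 0)).trans ?_
  unfold sphMean
  congr 1
  ext θ
  have hin : HasDerivAt (fun s : ℝ => (X + s • v) + r • emb n θ.1) v 0 := by
    simpa using (((hasDerivAt_id (0 : ℝ)).smul_const v).const_add X).add_const (r • emb n θ.1)
  have h2 : HasFDerivAt f (fderiv ℝ f (X + r • emb n θ)) (X + (0 : ℝ) • v + r • emb n θ.1) := by
    simpa using ((hf.differentiable (by norm_num)) (X + r • emb n θ.1)).hasFDerivAt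
  exact fderiv_apply_eq_of_hasDerivAt (h1.differentiable (by norm_num) _)
    (by simpa [Function.comp_def] using h2.comp_hasDerivAt 0 hin)

theorem hasDerivAt_integral_sphere {Ψ : ℝ × Euc n → E} (hΨ : ContDiff ℝ 1 Ψ) {d : Euc n → E}
    {r : ℝ} (h : ∀ w, HasDerivAt (fun s => Ψ (s, w)) (d w) r) :
    HasDerivAt (fun s => ∫ θ : Metric.sphere (0 : Euc n) 1, Ψ (s, θ.1) ∂sphereMeasure n)
      (∫ θ : Metric.sphere (0 : Euc n) 1, d θ ∂sphereMeasure n) r := by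
  have h3 := (hasFDerivAt_integral_compactSpace (sphereMeasure n)
    continuous_subtype_val hΨ r).differentiableAt.hasDerivAt
  refine h3.congr_deriv ?_
  rw [← fderiv_apply_one_eq_deriv, fderiv_integral_compactSpace _ continuous_subtype_val hΨ]
  congr 1
  ext θ
  have h1 : HasDerivAt (fun s : ℝ => (s, θ.1)) ((1 : ℝ), (0 : Euc n)) r :=
    (hasDerivAt_id _).prodMk (hasDerivAt_const _ _)
  exact (((hΨ.differentiable (by norm_num)) (r, θ.1)).hasFDerivAt.comp_hasDerivAt r h1).unique
    (h θ.1)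

theorem hasDerivAt_radius {F : Type*} [NormedAddCommGroup F] [NormedSpace ℝ F]
    {g : Euc (n + 1) → F} (hg : ContDiff ℝ 1 g) (X : Euc (n + 1)) (w : Euc n) (r : ℝ) :
    HasDerivAt (fun s : ℝ => g (X + s • emb n w)) (fderiv ℝ g (X + r • emb n w) (emb n w)) r := by
  have hA : HasDerivAt (fun s : ℝ => X + s • emb n w) (emb n w) r := by
    simpa using ((hasDerivAt_id r).smul_const (emb n w)).const_add X
  exact ((hg.differentiable (by norm_num)) (X + r • emb n w)).hasFDerivAt.comp_hasDerivAt r hA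

theorem hasDerivAt_sphMean (hf : ContDiff ℝ 1 f) (X : Euc (n + 1)) (r : ℝ) :
    HasDerivAt (sphMean f X) (∫ θ : Metric.sphere (0 : Euc n) 1,
      fderiv ℝ f (X + r • emb n θ) (emb n θ) ∂sphereMeasure n) r := by
  have hin : ContDiff ℝ 1 fun q : ℝ × Euc n => X + q.1 • emb n q.2 := by fun_prop
  exact hasDerivAt_integral_sphere (hf.comp hin) (fun w => hasDerivAt_radius hf X w r)

theorem hasDerivAt_deriv_sphMean (hf : ContDiff ℝ 2 f) (X : Euc (n + 1)) (r : ℝ) :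
    HasDerivAt (deriv (sphMean f X)) (∫ θ : Metric.sphere (0 : Euc n) 1,
      fderiv ℝ (fderiv ℝ f) (X + r • emb n θ) (emb n θ) (emb n θ) ∂sphereMeasure n) r := by
  have h0 : deriv (sphMean f X) = fun r => ∫ θ : Metric.sphere (0 : Euc n) 1,
      fderiv ℝ f (X + r • emb n θ) (emb n θ) ∂sphereMeasure n :=
    funext fun r => (hasDerivAt_sphMean (hf.of_le (by norm_num)) X r).deriv
  rw [h0]
  have hf' : ContDiff ℝ 1 (fderiv ℝ f) := hf.fderiv_right (by norm_num)
  have hin : ContDiff ℝ 1 fun q : ℝ × Euc n => X + q.1 • emb n q.2 := by fun_prop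
  have h20 : ContDiff ℝ 1 fun q : ℝ × Euc n => fderiv ℝ f (X + q.1 • emb n q.2) := hf'.comp hin
  have h21 : ContDiff ℝ 1 fun q : ℝ × Euc n => emb n q.2 := by fun_prop
  refine hasDerivAt_integral_sphere (Ψ := fun q => fderiv ℝ f (X + q.1 • emb n q.2) (emb n q.2))
    (h20.clm_apply h21)
    (d := fun w => fderiv ℝ (fderiv ℝ f) (X + r • emb n w) (emb n w) (emb n w)) fun w => ?_
  exact ((hasDerivAt_radius hf' X w r).clm_apply (hasDerivAt_const r (emb n w))).congr_deriv
    (by simp)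

/-- The pointwise algebra behind Darboux's equation: `D1` and `D2` stand for the first and second
derivatives of `f`, and `∑ θ_i² = 1` turns the double sum over `θ_i² D2 (b j) (b j)` into a trace.
-/
theorem sum_rotField_eq {V : Type*} [NormedAddCommGroup V] [NormedSpace ℝ V] (D1 : V →L[ℝ] E)
    (D2 : V →L[ℝ] V →L[ℝ] E) (b : Fin n → V) (θ : Fin n → ℝ) (hθ : ∑ i, θ i * θ i = 1) (r : ℝ) :
    ∑ i, ∑ j, ((θ i * (if i = j then 1 else 0) - θ j) • D1 (b j)
        + (θ i * r) • D2 (θ i • b j - θ j • b i) (b j))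
      = r • ∑ i, D2 (b i) (b i) - r • D2 (∑ i, θ i • b i) (∑ i, θ i • b i)
        - ((n : ℝ) - 1) • D1 (∑ i, θ i • b i) := by
  have e1 : D1 (∑ i, θ i • b i) = ∑ j, θ j • D1 (b j) := by simp
  have e2 : D2 (∑ i, θ i • b i) (∑ i, θ i • b i) = ∑ i, ∑ j, (θ i * θ j) • D2 (b i) (b j) := by
    simp only [map_sum, map_smul, sum_apply, smul_apply, Finset.smul_sum, smul_smul]
    rw [Finset.sum_comm]
    simp only [mul_comm]
  have e3 : ∑ i, D2 (b i) (b i) = ∑ i, ∑ j, (θ i * θ i) • D2 (b j) (b j) := by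
    rw [Finset.sum_comm]
    simp_rw [← Finset.sum_smul, hθ, one_smul]
  have e4 : ((n : ℝ) - 1) • D1 (∑ i, θ i • b i) = ∑ i : Fin n, ∑ j, θ j • D1 (b j)
      - ∑ i, ∑ j, (θ i * (if i = j then 1 else 0)) • D1 (b j) := by
    rw [e1]; simp [sub_smul, Nat.cast_smul_eq_nsmul]
  rw [e2, e3, e4]
  simp only [Finset.smul_sum, ← Finset.sum_sub_distrib]
  refine Finset.sum_congr rfl fun i _ => Finset.sum_congr rfl fun j _ => ?_
  rw [map_sub, map_smul, map_smul, sub_apply, smul_apply, smul_apply]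
  module

theorem fderiv_coord_smul_fderiv (hf : ContDiff ℝ 2 f) (X b : Euc (n + 1)) (r : ℝ) (i : Fin n)
    (w v : Euc n) :
    fderiv ℝ (fun w : Euc n => w i • fderiv ℝ f (X + r • emb n w) b) w v
      = v i • fderiv ℝ f (X + r • emb n w) b
      + (w i * r) • fderiv ℝ (fderiv ℝ f) (X + r • emb n w) (emb n v) b := by
  have hf' : ContDiff ℝ 1 (fderiv ℝ f) := hf.fderiv_right (by norm_num)
  have h1 : HasFDerivAt (fun w : Euc n => w i) (EuclideanSpace.proj (𝕜 := ℝ) i) w :=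
    (EuclideanSpace.proj (𝕜 := ℝ) i).hasFDerivAt
  have h2 : HasFDerivAt (fun w : Euc n => X + r • emb n w) (r • emb n) w :=
    ((emb n).hasFDerivAt.const_smul r).const_add X
  have h20 : HasFDerivAt (fun w : Euc n => fderiv ℝ f (X + r • emb n w)) _ w :=
    ((hf'.differentiable (by norm_num)) (X + r • emb n w)).hasFDerivAt.comp w h2
  have h3 := h20.clm_apply (hasFDerivAt_const b w)
  rw [(h1.fun_smul h3).fderiv]
  simp [mul_smul, add_comm]

theorem spaceLaplacian_eq (hf : ContDiff ℝ 2 f) (Y : Euc (n + 1)) :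
    spaceLaplacian f Y = ∑ i : Fin n, fderiv ℝ (fderiv ℝ f) Y (EuclideanSpace.single i.succ 1)
      (EuclideanSpace.single i.succ 1) := by
  have hf' : ContDiff ℝ 1 (fderiv ℝ f) := hf.fderiv_right (by norm_num)
  refine Finset.sum_congr rfl fun i _ => ?_
  rw [fderiv_clm_apply ((hf'.differentiable (by norm_num)) Y) (differentiableAt_const _)]
  simp

/-- The first and second radial derivatives of the mean are integrals of `Df(θ)` and `D²f(θ, θ)`.
Rotation fields applied to the functions `w_i ∂_j f` integrate to zero, and their sum is `r` times
the Laplacian minus precisely these two terms, with weights `n - 1` and `r`. -/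
theorem sphMean_darboux [CompleteSpace E] (hf : ContDiff ℝ 2 f) (X : Euc (n + 1)) (r : ℝ) :
    r • deriv (deriv (sphMean f X)) r + ((n : ℝ) - 1) • deriv (sphMean f X) r
      = r • sphMean (spaceLaplacian f) X r := by
  have hf1 : ContDiff ℝ 1 f := hf.of_le (by norm_num)
  have hf' : ContDiff ℝ 1 (fderiv ℝ f) := hf.fderiv_right (by norm_num)
  have hf'' : Continuous (fderiv ℝ (fderiv ℝ f)) := hf'.continuous_fderiv (by norm_num)
  rw [(hasDerivAt_deriv_sphMean hf X r).deriv, (hasDerivAt_sphMean hf1 X r).deriv]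
  let b : Fin n → Euc (n + 1) := fun i => EuclideanSpace.single i.succ 1
  -- The factor `w i` is chosen so that differentiating along `θ_i ∂_j - θ_j ∂_i` and summing over
  -- `i` and `j` leaves the full trace of the Hessian.
  let k : Fin n → Fin n → Euc n → E := fun i j w => w i • fderiv ℝ f (X + r • emb n w) (b j)
  have hcoord : ∀ i : Fin n, ContDiff ℝ 1 fun w : Euc n => w i := fun i =>
    (EuclideanSpace.proj (𝕜 := ℝ) i).contDiff
  have hin : ContDiff ℝ 1 fun w : Euc n => X + r • emb n w := by fun_prop
  have hk : ∀ i j, ContDiff ℝ 1 (k i j) := fun i j =>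
    (hcoord i).smul ((hf'.comp hin).clm_apply contDiff_const)
  have hdk : ∀ i j (w v : Euc n), fderiv ℝ (k i j) w v = v i • fderiv ℝ f (X + r • emb n w) (b j)
      + (w i * r) • fderiv ℝ (fderiv ℝ f) (X + r • emb n w) (emb n v) (b j) := fun i j w v =>
    fderiv_coord_smul_fderiv hf X (b j) r i w v
  have hsum : ∑ i, ∑ j, ∫ θ : Metric.sphere (0 : Euc n) 1, fderiv ℝ (k i j) θ
      (θ.1 i • EuclideanSpace.single j (1 : ℝ) - θ.1 j • EuclideanSpace.single i (1 : ℝ))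
      ∂sphereMeasure n = 0 :=
    Finset.sum_eq_zero fun i _ => Finset.sum_eq_zero fun j _ => integral_sphere_rotField i j (hk i j)
  have hcont : ∀ i j, Continuous fun θ : Metric.sphere (0 : Euc n) 1 => fderiv ℝ (k i j) θ
      (θ.1 i • EuclideanSpace.single j (1 : ℝ) - θ.1 j • EuclideanSpace.single i (1 : ℝ)) := by
    intro i j
    have h1 := ((hk i j).continuous_fderiv (by norm_num)).comp
      (continuous_subtype_val (p := fun x => x ∈ Metric.sphere (0 : Euc n) 1))
    refine h1.clm_apply ?_
    fun_prop
  have hint : ∀ {F : Metric.sphere (0 : Euc n) 1 → E}, Continuous F →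
      Integrable F (sphereMeasure n) := fun hF => integrable_of_continuous_compactSpace _ hF
  simp_rw [← integral_finsetSum Finset.univ fun j _ => hint (hcont _ j)] at hsum
  rw [← integral_finsetSum] at hsum
  swap
  · exact fun i _ => hint (continuous_finsetSum _ fun j _ => hcont i j)
  have hpt : ∀ θ : Metric.sphere (0 : Euc n) 1, ∑ i, ∑ j, fderiv ℝ (k i j) θ
      (θ.1 i • EuclideanSpace.single j (1 : ℝ) - θ.1 j • EuclideanSpace.single i (1 : ℝ))
      = r • spaceLaplacian f (X + r • emb n θ)
        - r • fderiv ℝ (fderiv ℝ f) (X + r • emb n θ) (emb n θ) (emb n θ)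
        - ((n : ℝ) - 1) • fderiv ℝ f (X + r • emb n θ) (emb n θ) := by
    intro θ
    have hθ : emb n θ.1 = ∑ i, θ.1 i • b i := by
      conv_lhs => rw [← (EuclideanSpace.basisFun (Fin n) ℝ).sum_repr θ.1]
      simp [b, emb_single]
    have hnorm : ∑ i, θ.1 i * θ.1 i = 1 := by
      have h1 : ‖θ.1‖ = 1 := by simp
      have h2 := EuclideanSpace.real_norm_sq_eq θ.1
      rw [h1] at h2
      simp_rw [← sq, ← h2]; norm_num
    rw [spaceLaplacian_eq hf, hθ, ← sum_rotField_eq _ _ b θ.1 hnorm]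
    refine Finset.sum_congr rfl fun i _ => Finset.sum_congr rfl fun j _ => ?_
    rw [hdk, ← hθ, map_sub, map_smul, map_smul, emb_single, emb_single]
    simp only [PiLp.sub_apply, PiLp.smul_apply, PiLp.single_apply, smul_eq_mul, if_true, mul_one, b]
  simp_rw [hpt] at hsum
  have hc1 : Continuous fun θ : Metric.sphere (0 : Euc n) 1 =>
      r • spaceLaplacian f (X + r • emb n θ) := by
    simp_rw [spaceLaplacian_eq hf]; fun_prop
  have hc2 : Continuous fun θ : Metric.sphere (0 : Euc n) 1 =>
      r • fderiv ℝ (fderiv ℝ f) (X + r • emb n θ) (emb n θ) (emb n θ) := by fun_prop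
  have hc0 : Continuous (fderiv ℝ f) := hf'.continuous
  have hc3 : Continuous fun θ : Metric.sphere (0 : Euc n) 1 =>
      ((n : ℝ) - 1) • fderiv ℝ f (X + r • emb n θ) (emb n θ) := by fun_prop
  rw [integral_sub (hint (hc1.fun_sub hc2)) (hint hc3),
    integral_sub (hint hc1) (hint hc2),
    integral_smul, integral_smul, integral_smul, sub_sub, sub_eq_zero] at hsum
  exact hsum.symm

end SphericalMean

end HolPot

namespace HolPot

open MeasureTheory Filter Set
open scoped ContDiff Topology

/-! ### The wave equation in odd space dimension by descent -/

section Kirchhoff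

variable {n : ℕ} {E : Type*} [NormedAddCommGroup E] [NormedSpace ℝ E]

/-- Up to a constant factor, the solution at time `r` of the wave equation in `n = 2 K + 3`
dimensions with initial value `0` and initial velocity `f`. -/
noncomputable def wave (K : ℕ) (f : Euc (n + 1) → E) (X : Euc (n + 1)) (r : ℝ) : E :=
  r • desc K (sphMean f X) r

variable {K : ℕ} {f : Euc (n + 1) → E}

theorem contDiff_wave {l : ℕ} (hf : ContDiff ℝ ((K + l : ℕ) : WithTop ℕ∞) f) :
    ContDiff ℝ (l : WithTop ℕ∞) fun q : Euc (n + 1) × ℝ => wave K f q.1 q.2 :=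
  contDiff_snd.smul (contDiff_desc K (contDiff_sphMean hf))

theorem contDiff_wave_radius {l : ℕ} (hf : ContDiff ℝ ((K + l : ℕ) : WithTop ℕ∞) f)
    (X : Euc (n + 1)) : ContDiff ℝ (l : WithTop ℕ∞) (wave K f X) :=
  (contDiff_wave hf).comp (contDiff_const.prodMk contDiff_id)

theorem fderiv_wave (hf : ContDiff ℝ ((K + 1 : ℕ) : WithTop ℕ∞) f) (X v : Euc (n + 1)) (r : ℝ) :
    fderiv ℝ (fun q : Euc (n + 1) × ℝ => wave K f q.1 q.2) (X, r) (v, 0)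
      = wave K (fun Y => fderiv ℝ f Y v) X r := by
  have h1 : Differentiable ℝ fun q : Euc (n + 1) × ℝ => desc K (sphMean f q.1) q.2 :=
    (contDiff_desc K (l := 1) (contDiff_sphMean hf)).differentiable (by simp)
  have h2 : HasFDerivAt (fun q : Euc (n + 1) × ℝ => wave K f q.1 q.2) _ (X, r) :=
    hasFDerivAt_snd.fun_smul (h1 (X, r)).hasFDerivAt
  rw [h2.fderiv]
  have h3 : (fun r => fderiv ℝ (fun q : Euc (n + 1) × ℝ => sphMean f q.1 q.2) (X, r) (v, 0))
      = sphMean (fun Y => fderiv ℝ f Y v) X :=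
    funext fun r => fderiv_sphMean (hf.of_le (by norm_cast; omega)) X v r
  have h4 := fderiv_desc (contDiff_sphMean hf) X v r
  rw [h3] at h4
  simp [h4, wave]

theorem hasDerivAt_smul_self {φ : ℝ → E} {r : ℝ} (h : DifferentiableAt ℝ φ r) :
    HasDerivAt (fun r => r • φ r) (φ r + r • deriv φ r) r := by
  refine ((hasDerivAt_id r).fun_smul h.hasDerivAt).congr_deriv ?_
  simp [add_comm]

/-- The hypothesis on `n` makes Darboux's factor `n - 1` equal to `2 (K + 1)`, where the descent
starts. At its end `r ψ'' + 2 ψ'` is `(r ψ)''`, the second derivative of `wave` itself. -/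
theorem deriv_deriv_wave [CompleteSpace E] (hn : n = 2 * K + 3)
    (hf : ContDiff ℝ ((K + 2 : ℕ) : WithTop ℕ∞) f)
    (X : Euc (n + 1)) (r : ℝ) :
    deriv (deriv (wave K f X)) r = wave K (spaceLaplacian f) X r := by
  have hlap : ContDiff ℝ (K : WithTop ℕ∞) (spaceLaplacian f) :=
    ContDiff.sum fun i _ => contDiff_fderiv_apply (contDiff_fderiv_apply hf _) _
  have hE : IsEPD K (sphMean f X) (sphMean (spaceLaplacian f) X) := by
    intro s
    have := sphMean_darboux (hf.of_le (by norm_cast; omega)) X s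
    rw [show ((n : ℝ) - 1) = 2 * (K + 1) by rw [hn]; push_cast; ring] at this
    exact this
  have hD := IsEPD.desc (contDiff_sphMean_radius hf X) (contDiff_sphMean_radius hlap X) hE r
  set ψ := desc K (sphMean f X) with hψ
  have hψ2 : ContDiff ℝ 2 ψ := contDiff_desc_single (l := 2) K (contDiff_sphMean_radius hf X)
  have hψ1 : ContDiff ℝ 1 (deriv ψ) :=
    ((contDiff_succ_iff_deriv (n := 1)).1 (by norm_num; exact hψ2)).2.2
  have h1 : deriv (wave K f X) = fun r => ψ r + r • deriv ψ r := funext fun s =>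
    (hasDerivAt_smul_self (hψ2.differentiable (by norm_num) s)).deriv
  rw [h1, ((hψ2.differentiable (by norm_num) r).hasDerivAt.fun_add
    (hasDerivAt_smul_self (hψ1.differentiable (by norm_num) r))).deriv]
  rw [wave, ← hD]
  simp only [CharP.cast_eq_zero, zero_add, mul_one]
  module

theorem wave_add {g : Euc (n + 1) → E} (hf : ContDiff ℝ (K : WithTop ℕ∞) f)
    (hg : ContDiff ℝ (K : WithTop ℕ∞) g) (X : Euc (n + 1)) :
    wave K (f + g) X = wave K f X + wave K g X := by
  ext r
  simp only [wave, sphMean_add hf.continuous hg.continuous, Pi.add_apply,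
    desc_add (contDiff_sphMean_radius hf X) (contDiff_sphMean_radius hg X), smul_add]

theorem wave_zero (X : Euc (n + 1)) : wave K (0 : Euc (n + 1) → E) X = 0 := by
  ext r
  have : sphMean (0 : Euc (n + 1) → E) X = 0 := by ext; simp [sphMean]
  simp [wave, this, desc_zero_fun]

theorem wave_sum {ι : Type*} (s : Finset ι) {g : ι → Euc (n + 1) → E}
    (hg : ∀ i ∈ s, ContDiff ℝ (K : WithTop ℕ∞) (g i)) (X : Euc (n + 1)) :
    wave K (∑ i ∈ s, g i) X = ∑ i ∈ s, wave K (g i) X := by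
  classical
  induction s using Finset.induction_on with
  | empty => simp [wave_zero]
  | insert i s hi ih =>
    have h1 : ContDiff ℝ (K : WithTop ℕ∞) (∑ i ∈ s, g i) := by
      have := ContDiff.sum fun j (hj : j ∈ s) => hg j (Finset.mem_insert_of_mem hj)
      convert this using 1
      ext; simp
    rw [Finset.sum_insert hi, Finset.sum_insert hi,
      wave_add (hg i (Finset.mem_insert_self _ _)) h1,
      ih fun j hj => hg j (Finset.mem_insert_of_mem hj)]

/-- Spherical means are even in the radius, since the sphere is symmetric, and `desc` keeps
evenness; the factor `r` makes the result odd. -/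
theorem wave_neg_radius (hf : Continuous f) (X : Euc (n + 1)) (r : ℝ) :
    wave K f X (-r) = - wave K f X r := by
  simp [wave, desc_even K (sphMean_neg_radius hf X) r]

theorem wave_zero_radius (X : Euc (n + 1)) : wave K f X 0 = 0 := by simp [wave]

theorem deriv_wave_zero_radius [CompleteSpace E] (hf : ContDiff ℝ ((K + 1 : ℕ) : WithTop ℕ∞) f)
    (X : Euc (n + 1)) : deriv (wave K f X) 0 = (sphereMeasure n).real univ • f X := by
  have h1 : ContDiff ℝ 1 (desc K (sphMean f X)) :=
    contDiff_desc_single (l := 1) K (contDiff_sphMean_radius hf X)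
  have : HasDerivAt (wave K f X) _ 0 :=
    hasDerivAt_smul_self (h1.differentiable (by norm_num) 0)
  rw [this.deriv, zero_smul, add_zero, desc_zero, sphMean_zero_radius]

theorem wave_congr {g : Euc (n + 1) → E} {X Y : Euc (n + 1)} {r : ℝ}
    (h : sphMean f X =ᶠ[𝓝 r] sphMean g Y) : wave K f X =ᶠ[𝓝 r] wave K g Y := by
  filter_upwards [desc_congr (m := K) h] with s hs
  simp [wave, hs]

theorem hasDerivAt_wave {l : ℕ} (hf : ContDiff ℝ ((K + (l + 1) : ℕ) : WithTop ℕ∞) f)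
    (X : Euc (n + 1)) (r : ℝ) : HasDerivAt (wave K f X)
      (fderiv ℝ (fun q : Euc (n + 1) × ℝ => wave K f q.1 q.2) (X, r) (0, 1)) r :=
  hasDerivAt_of_fderiv_snd ((contDiff_wave hf).differentiable (by simp) _)

theorem contDiff_deriv_wave {l : ℕ} (hf : ContDiff ℝ ((K + (l + 1) : ℕ) : WithTop ℕ∞) f) :
    ContDiff ℝ (l : WithTop ℕ∞) fun q : Euc (n + 1) × ℝ => deriv (wave K f q.1) q.2 := by
  have : (fun q : Euc (n + 1) × ℝ => deriv (wave K f q.1) q.2) = fun q =>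
      fderiv ℝ (fun q : Euc (n + 1) × ℝ => wave K f q.1 q.2) q (0, 1) :=
    funext fun q => (hasDerivAt_wave hf q.1 q.2).deriv
  rw [this]
  exact contDiff_fderiv_apply (contDiff_wave hf) _

theorem fderiv_deriv_wave (hf : ContDiff ℝ ((K + 2 : ℕ) : WithTop ℕ∞) f) (X v : Euc (n + 1))
    (r : ℝ) : fderiv ℝ (fun q : Euc (n + 1) × ℝ => deriv (wave K f q.1) q.2) (X, r) (v, 0)
      = deriv (wave K (fun Y => fderiv ℝ f Y v) X) r := by
  have : (fun q : Euc (n + 1) × ℝ => deriv (wave K f q.1) q.2) = fun q =>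
      fderiv ℝ (fun q : Euc (n + 1) × ℝ => wave K f q.1 q.2) q (0, 1) :=
    funext fun q => (hasDerivAt_wave (l := 1) hf q.1 q.2).deriv
  have hf' : ContDiff ℝ ((K + 1 : ℕ) : WithTop ℕ∞) fun Y => fderiv ℝ f Y v :=
    contDiff_fderiv_apply hf v
  rw [this, fderiv_fderiv_apply_comm (contDiff_wave (l := 2) hf),
    (hasDerivAt_wave (l := 0) hf' X r).deriv]
  have h2 : (fun q : Euc (n + 1) × ℝ =>
      fderiv ℝ (fun q : Euc (n + 1) × ℝ => wave K f q.1 q.2) q (v, 0))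
      = fun q => wave K (fun Y => fderiv ℝ f Y v) q.1 q.2 :=
    funext fun q => fderiv_wave (hf.of_le (by norm_cast; omega)) q.1 v q.2
  rw [h2]

end Kirchhoff

/-! ### The wave with initial velocity `i ∂_0 f` -/

section Holomorphic

variable {n : ℕ} {E : Type*} [NormedAddCommGroup E] [NormedSpace ℂ E]

/-- Up to a constant factor, the solution at time `r` of the wave equation in `n = 2 K + 3`
dimensions with initial value `f` and initial velocity `i ∂_0 f`. -/
noncomputable def holWave (K : ℕ) (f : Euc (n + 1) → E) (X : Euc (n + 1)) (r : ℝ) : E :=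
  deriv (wave K f X) r
    + Complex.I • wave K (fun Y => fderiv ℝ f Y (EuclideanSpace.single 0 1)) X r

variable {K : ℕ} {f : Euc (n + 1) → E}

theorem contDiff_holWave {l : ℕ} (hf : ContDiff ℝ ((K + (l + 1) : ℕ) : WithTop ℕ∞) f) :
    ContDiff ℝ (l : WithTop ℕ∞) fun q : Euc (n + 1) × ℝ => holWave K f q.1 q.2 :=
  (contDiff_deriv_wave hf).add ((contDiff_wave (contDiff_fderiv_apply hf _)).const_smul _)

theorem fderiv_holWave (hf : ContDiff ℝ ((K + 2 : ℕ) : WithTop ℕ∞) f) (X v : Euc (n + 1))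
    (r : ℝ) : fderiv ℝ (fun q : Euc (n + 1) × ℝ => holWave K f q.1 q.2) (X, r) (v, 0)
      = holWave K (fun Y => fderiv ℝ f Y v) X r := by
  have hf0 : ContDiff ℝ ((K + 1 : ℕ) : WithTop ℕ∞)
      fun Y => fderiv ℝ f Y (EuclideanSpace.single 0 1) := contDiff_fderiv_apply hf _
  have h1 := ((contDiff_deriv_wave (l := 1) hf).differentiable (by simp)) (X, r)
  have h2 := ((contDiff_wave (l := 1) hf0).differentiable (by simp)) (X, r)
  unfold holWave
  rw [fderiv_fun_add h1 (h2.fun_const_smul _), fderiv_fun_const_smul h2, add_apply, smul_apply,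
    fderiv_deriv_wave hf, fderiv_wave hf0]
  congr 3
  exact funext fun Y => fderiv_fderiv_apply_comm (hf.of_le (by norm_cast; omega)) _ _ _

theorem hasDerivAt_holWave [CompleteSpace E] (hn : n = 2 * K + 3)
    (hf : ContDiff ℝ ((K + 2 : ℕ) : WithTop ℕ∞) f) (X : Euc (n + 1)) (r : ℝ) :
    HasDerivAt (holWave K f X) (wave K (spaceLaplacian f) X r + Complex.I •
      deriv (wave K (fun Y => fderiv ℝ f Y (EuclideanSpace.single 0 1)) X) r) r := by
  have hf0 : ContDiff ℝ ((K + 1 : ℕ) : WithTop ℕ∞)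
      fun Y => fderiv ℝ f Y (EuclideanSpace.single 0 1) := contDiff_fderiv_apply hf _
  have h1 : ContDiff ℝ 1 (deriv (wave K f X)) := ((contDiff_succ_iff_deriv (n := 1)).1
    (by norm_num; exact contDiff_wave_radius (l := 2) hf X)).2.2
  have h2 := ((contDiff_wave_radius (l := 1) hf0 X).differentiable (by simp)) r
  rw [← deriv_deriv_wave hn hf]
  exact ((h1.differentiable (by norm_num)) r).hasDerivAt.fun_add (h2.hasDerivAt.fun_const_smul _)

theorem spaceLaplacian_eq_sum (f : Euc (n + 1) → E) : spaceLaplacian f = ∑ i : Fin n, fun Y =>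
      fderiv ℝ (fun Z => fderiv ℝ f Z (EuclideanSpace.single i.succ 1)) Y
        (EuclideanSpace.single i.succ 1) := by
  ext Y; simp [spaceLaplacian]

/-- The two time derivatives are taken one at a time: after the first one, `wave` of the Laplacian
has already absorbed two of them, so no third derivative of `wave K f` has to be formed and `K + 3`
derivatives of `f` suffice. -/
theorem deriv_deriv_holWave [CompleteSpace E] (hn : n = 2 * K + 3)
    (hf : ContDiff ℝ ((K + 3 : ℕ) : WithTop ℕ∞) f) (X : Euc (n + 1)) (r : ℝ) :
    deriv (deriv (holWave K f X)) r = ∑ i : Fin n, holWave K (fun Y =>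
      fderiv ℝ (fun Z => fderiv ℝ f Z (EuclideanSpace.single i.succ 1)) Y
        (EuclideanSpace.single i.succ 1)) X r := by
  have hf0 : ContDiff ℝ ((K + 2 : ℕ) : WithTop ℕ∞)
      fun Y => fderiv ℝ f Y (EuclideanSpace.single 0 1) := contDiff_fderiv_apply hf _
  let g : Fin n → Euc (n + 1) → E := fun i Y =>
    fderiv ℝ (fun Z => fderiv ℝ f Z (EuclideanSpace.single i.succ 1)) Y
      (EuclideanSpace.single i.succ 1)
  have hg : ∀ i, ContDiff ℝ ((K + 1 : ℕ) : WithTop ℕ∞) (g i) := fun i =>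
    contDiff_fderiv_apply (contDiff_fderiv_apply hf _) _
  have hg0 : ∀ i, ContDiff ℝ (K : WithTop ℕ∞)
      fun Y => fderiv ℝ (g i) Y (EuclideanSpace.single 0 1) := fun i =>
    contDiff_fderiv_apply (hg i) _
  have hlap : spaceLaplacian f = ∑ i, g i := spaceLaplacian_eq_sum f
  have hlap0 : spaceLaplacian (fun Y => fderiv ℝ f Y (EuclideanSpace.single 0 1))
      = ∑ i, fun Y => fderiv ℝ (g i) Y (EuclideanSpace.single 0 1) := by
    rw [spaceLaplacian_eq_sum]
    refine Finset.sum_congr rfl fun i _ => funext fun Y => ?_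
    have h1 : (fun Z => fderiv ℝ (fun Y => fderiv ℝ f Y (EuclideanSpace.single 0 1)) Z
        (EuclideanSpace.single i.succ 1))
        = fun Z => fderiv ℝ (fun Y => fderiv ℝ f Y (EuclideanSpace.single i.succ 1)) Z
        (EuclideanSpace.single 0 1) :=
      funext fun Z => fderiv_fderiv_apply_comm (hf.of_le (by norm_cast; omega)) _ _ _
    rw [h1]
    have h2 : ContDiff ℝ ((K + 2 : ℕ) : WithTop ℕ∞)
        fun Y => fderiv ℝ f Y (EuclideanSpace.single i.succ 1) := contDiff_fderiv_apply hf _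
    exact fderiv_fderiv_apply_comm (h2.of_le (by norm_cast; omega)) _ _ _
  have h1 : deriv (holWave K f X) = fun s => wave K (spaceLaplacian f) X s + Complex.I •
      deriv (wave K (fun Y => fderiv ℝ f Y (EuclideanSpace.single 0 1)) X) s :=
    funext fun s => (hasDerivAt_holWave hn (hf.of_le (by norm_cast; omega)) X s).deriv
  have hd : ∀ i, DifferentiableAt ℝ (wave K (g i) X) r := fun i =>
    ((contDiff_wave_radius (l := 1) (hg i) X).differentiable (by simp)) r
  have h2 : DifferentiableAt ℝ (wave K (spaceLaplacian f) X) r := by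
    rw [hlap, wave_sum _ fun i _ => (hg i).of_le (by norm_cast; omega)]
    exact DifferentiableAt.sum fun i _ => hd i
  have h3 : ContDiff ℝ 1 (deriv (wave K (fun Y => fderiv ℝ f Y (EuclideanSpace.single 0 1)) X)) :=
    ((contDiff_succ_iff_deriv (n := 1)).1
      (by norm_num; exact contDiff_wave_radius (l := 2) hf0 X)).2.2
  rw [h1, deriv_fun_add h2 ((h3.differentiable (by norm_num) r).fun_const_smul _),
    deriv_fun_const_smul _ (h3.differentiable (by norm_num) r), deriv_deriv_wave hn hf0, hlap0, hlap,
    wave_sum _ fun i _ => (hg i).of_le (by norm_cast; omega), wave_sum _ fun i _ => hg0 i,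
    deriv_sum fun i _ => hd i, Finset.sum_apply, Finset.smul_sum, ← Finset.sum_add_distrib]
  rfl

theorem holWave_zero_radius [CompleteSpace E] (hf : ContDiff ℝ ((K + 1 : ℕ) : WithTop ℕ∞) f)
    (X : Euc (n + 1)) : holWave K f X 0 = (sphereMeasure n).real univ • f X := by
  simp [holWave, wave_zero_radius, deriv_wave_zero_radius hf]

theorem deriv_holWave_zero_radius [CompleteSpace E] (hn : n = 2 * K + 3)
    (hf : ContDiff ℝ ((K + 2 : ℕ) : WithTop ℕ∞) f) (X : Euc (n + 1)) :
    deriv (holWave K f X) 0 = (sphereMeasure n).real univ •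
      Complex.I • fderiv ℝ f X (EuclideanSpace.single 0 1) := by
  rw [(hasDerivAt_holWave hn hf X 0).deriv, wave_zero_radius, zero_add,
    deriv_wave_zero_radius (contDiff_fderiv_apply hf _), smul_comm]

/-- Only the germs at `r` of the spherical means enter, so functions that agree near the sphere give
the same value. -/
theorem holWave_congr {g : Euc (n + 1) → E} {X Y : Euc (n + 1)} {r : ℝ}
    (h : sphMean f X =ᶠ[𝓝 r] sphMean g Y)
    (h' : sphMean (fun Z => fderiv ℝ f Z (EuclideanSpace.single 0 1)) X
      =ᶠ[𝓝 r] sphMean (fun Z => fderiv ℝ g Z (EuclideanSpace.single 0 1)) Y) :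
    holWave K f X r = holWave K g Y r := by
  rw [holWave, holWave, (wave_congr h).deriv_eq, (wave_congr h').eq_of_nhds]

end Holomorphic

end HolPot

namespace HolPot

open MeasureTheory Filter Set
open scoped ContDiff Topology Interval

/-! ### Decay of boundary integrals near the rim of the spheroid -/

section EdgeIntegral

variable {E : Type*} [NormedAddCommGroup E] [NormedSpace ℂ E]

/-- In the coordinate `v = u / ε`, the pair `(r ^ 2, u)` on the level surface of radius `ε`. -/
noncomputable def edgePoint (t ε v : ℝ) : ℝ × ℝ := ((ε ^ 2 + t ^ 2) * (1 - v ^ 2), ε * v)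

/-- The complex length on the level surface of radius `ε`. -/
noncomputable def edgeLength (t ε v : ℝ) : ℂ := ε - t * v * Complex.I

/-- The integral of `γ ^ (-a) Φ` over the part of the level surface of radius `ε` that is close to
its edge. -/
noncomputable def edgeIntegral (t ε : ℝ) (a : ℕ) (Φ : ℝ × ℝ → E) : E :=
  ∫ v in (-(1 / 2) : ℝ)..(1 / 2), (edgeLength t ε v ^ a)⁻¹ • Φ (edgePoint t ε v)

theorem le_norm_edgeLength {t ε v : ℝ} (hε : 0 ≤ ε) : ε ≤ ‖edgeLength t ε v‖ := by
  have h := Complex.abs_re_le_norm (edgeLength t ε v)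
  have h2 : (edgeLength t ε v).re = ε := by simp [edgeLength]
  rwa [h2, abs_of_nonneg hε] at h

theorem edgeLength_ne_zero {t ε v : ℝ} (hε : 0 < ε) : edgeLength t ε v ≠ 0 :=
  norm_pos_iff.1 (hε.trans_le (le_norm_edgeLength hε.le))

theorem edgeLength_ne_zero' {t ε v : ℝ} (ht : t ≠ 0) (hv : v ≠ 0) : edgeLength t ε v ≠ 0 := by
  intro h
  have h2 : (edgeLength t ε v).im = -(t * v) := by simp [edgeLength]
  rw [h] at h2
  simp [ht, hv] at h2

theorem continuous_edgePoint (t : ℝ) : Continuous fun p : ℝ × ℝ => edgePoint t p.1 p.2 := by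
  unfold edgePoint; fun_prop

theorem continuous_edgeLength (t : ℝ) : Continuous fun p : ℝ × ℝ => edgeLength t p.1 p.2 := by
  unfold edgeLength; fun_prop

theorem edgePoint_pos {t ε v : ℝ} (ht : t ≠ 0) (hv : v ∈ Icc (-(1 / 2) : ℝ) (1 / 2)) :
    0 < (edgePoint t ε v).1 := by
  have h1 : v ^ 2 ≤ 1 / 4 := by nlinarith [hv.1, hv.2]
  have h2 : 0 < t ^ 2 := by positivity
  unfold edgePoint
  exact mul_pos (by positivity) (by linarith)

theorem continuousOn_edge {E : Type*} [NormedAddCommGroup E] {t : ℝ} (ht : t ≠ 0) {Φ : ℝ × ℝ → E}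
    (hΦ : ContinuousOn Φ {p | 0 < p.1}) (ε : ℝ) :
    ContinuousOn (fun v => Φ (edgePoint t ε v)) (Icc (-(1 / 2)) (1 / 2)) :=
  hΦ.comp ((continuous_edgePoint t).comp (by fun_prop : Continuous fun v : ℝ => (ε, v))).continuousOn
    fun _ hv => edgePoint_pos ht hv

theorem continuousOn_edge_integrand {t ε : ℝ} (ht : t ≠ 0) (hε : 0 < ε) (a : ℕ) {Φ : ℝ × ℝ → E}
    (hΦ : ContinuousOn Φ {p | 0 < p.1}) :
    ContinuousOn (fun v => (edgeLength t ε v ^ a)⁻¹ • Φ (edgePoint t ε v))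
      (Icc (-(1 / 2)) (1 / 2)) := by
  have h1 : Continuous fun v => edgeLength t ε v :=
    (continuous_edgeLength t).comp (by fun_prop : Continuous fun v : ℝ => (ε, v))
  exact ((h1.pow a).inv₀ fun v => pow_ne_zero _ (edgeLength_ne_zero hε)).continuousOn.smul
    (continuousOn_edge ht hΦ ε)

theorem intervalIntegrable_edge {t ε : ℝ} (ht : t ≠ 0) (hε : 0 < ε) (a : ℕ) {Φ : ℝ × ℝ → E}
    (hΦ : ContinuousOn Φ {p | 0 < p.1}) :
    IntervalIntegrable (fun v => (edgeLength t ε v ^ a)⁻¹ • Φ (edgePoint t ε v)) volume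
      (-(1 / 2)) (1 / 2) := by
  refine ContinuousOn.intervalIntegrable ?_
  rw [uIcc_of_le (by norm_num)]
  exact continuousOn_edge_integrand ht hε a hΦ

theorem tendsto_edge_pointwise {t : ℝ} (ht : t ≠ 0) {v : ℝ} (hv : v ∈ Icc (-(1 / 2) : ℝ) (1 / 2))
    (hv0 : v ≠ 0) (a b : ℕ) {Φ : ℝ × ℝ → E} (hΦ : ContinuousOn Φ {p | 0 < p.1}) :
    Tendsto (fun ε : ℝ => (ε ^ (1 + b) : ℝ) • (edgeLength t ε v ^ a)⁻¹ • Φ (edgePoint t ε v))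
      (𝓝[>] 0) (𝓝 0) := by
  have hε : Continuous fun ε : ℝ => (ε, v) := by fun_prop
  have h1 : ContinuousAt (fun ε => (edgeLength t ε v ^ a)⁻¹) 0 :=
    ((((continuous_edgeLength t).comp hε).pow a).continuousAt).inv₀
      (pow_ne_zero _ (edgeLength_ne_zero' ht hv0))
  have h2 : ContinuousAt (fun ε => Φ (edgePoint t ε v)) 0 := by
    have h3 : ContinuousAt Φ (edgePoint t 0 v) := hΦ.continuousAt
      ((isOpen_lt continuous_const continuous_fst).mem_nhds (edgePoint_pos ht hv))
    exact ContinuousAt.comp (f := fun ε => edgePoint t ε v) h3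
      ((continuous_edgePoint t).comp hε).continuousAt
  have h3 : ContinuousAt (fun ε : ℝ => (ε ^ (1 + b) : ℝ)) 0 := by fun_prop
  have h4 := (h3.smul (h1.smul h2)).tendsto
  simp only [ne_eq, Nat.add_eq_zero_iff, one_ne_zero, false_and, not_false_eq_true, zero_pow,
    zero_smul, Pi.smul_apply'] at h4
  exact h4.mono_left nhdsWithin_le_nhds

/-- Since `|γ| ≥ ε`, the factor `ε ^ (1 + b)` compensates `|γ| ^ (-a)` and the integrand is bounded.
For `v ≠ 0` the length `γ` stays away from `0` and the integrand tends to `0`, so dominated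
convergence applies. -/
theorem tendsto_edgeIntegral_of_le {t : ℝ} (ht : t ≠ 0) {a b : ℕ} (hab : a ≤ b + 1)
    {Φ : ℝ × ℝ → E} (hΦ : ContinuousOn Φ {p | 0 < p.1}) :
    Tendsto (fun ε : ℝ => (ε ^ (1 + b) : ℝ) • edgeIntegral t ε a Φ) (𝓝[>] 0) (𝓝 0) := by
  have hK : IsCompact (Icc (0 : ℝ) 1 ×ˢ Icc (-(1 / 2) : ℝ) (1 / 2)) := isCompact_Icc.prod isCompact_Icc
  have hc : ContinuousOn (fun p : ℝ × ℝ => Φ (edgePoint t p.1 p.2))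
      (Icc (0 : ℝ) 1 ×ˢ Icc (-(1 / 2) : ℝ) (1 / 2)) :=
    hΦ.comp (continuous_edgePoint t).continuousOn fun p hp => edgePoint_pos ht hp.2
  obtain ⟨C, hC⟩ := hK.exists_bound_of_continuousOn hc
  have hε1 : ∀ᶠ ε : ℝ in 𝓝[>] 0, ε ∈ Ioo (0 : ℝ) 1 := Ioo_mem_nhdsGT one_pos
  have huI : Ι (-(1 / 2) : ℝ) (1 / 2) ⊆ Icc (-(1 / 2) : ℝ) (1 / 2) := by
    rw [uIoc_of_le (by norm_num)]; exact Ioc_subset_Icc_self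
  have := intervalIntegral.tendsto_integral_filter_of_dominated_convergence
    (μ := volume) (a := -(1 / 2)) (b := 1 / 2) (l := 𝓝[>] (0 : ℝ)) (f := fun _ => (0 : E))
    (F := fun ε v => (ε ^ (1 + b) : ℝ) • (edgeLength t ε v ^ a)⁻¹ • Φ (edgePoint t ε v))
    (fun _ => C) ?_ ?_ (by simp) ?_
  · simpa [edgeIntegral, intervalIntegral.integral_smul] using this
  · filter_upwards [hε1] with ε hε
    exact (((continuousOn_edge_integrand ht hε.1 a hΦ).const_smul _).mono huI).aestronglyMeasurable
      measurableSet_uIoc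
  · filter_upwards [hε1] with ε hε
    refine ae_of_all _ fun v hv => ?_
    have h1 := hC (ε, v) ⟨⟨hε.1.le, hε.2.le⟩, huI hv⟩
    have h2 : ε ^ (b + 1) ≤ ‖edgeLength t ε v‖ ^ a :=
      (pow_le_pow_of_le_one hε.1.le hε.2.le hab).trans
        (pow_le_pow_left₀ hε.1.le (le_norm_edgeLength hε.1.le) a)
    have h3 : 0 < ‖edgeLength t ε v‖ ^ a := pow_pos (norm_pos_iff.2 (edgeLength_ne_zero hε.1)) a
    rw [norm_smul, norm_smul, norm_inv, norm_pow, norm_pow, Real.norm_of_nonneg hε.1.le,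
      ← mul_assoc, ← div_eq_mul_inv, add_comm 1 b]
    calc _ ≤ 1 * ‖Φ (edgePoint t ε v)‖ := by
          gcongr; exact (div_le_one h3).2 h2
      _ ≤ C := by rw [one_mul]; exact h1
  · have h0 : ∀ᵐ v : ℝ, v ≠ 0 := by simp [ae_iff, measure_singleton]
    filter_upwards [h0] with v hv0 hv
    exact tendsto_edge_pointwise ht (huI hv) hv0 a b hΦ

theorem hasDerivAt_inv_pow_edgeLength {t ε : ℝ} (hε : 0 < ε) (a : ℕ) (v : ℝ) :
    HasDerivAt (fun v : ℝ => (edgeLength t ε v ^ (a + 1))⁻¹)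
      ((a + 1) * (t * Complex.I) * (edgeLength t ε v ^ (a + 2))⁻¹) v := by
  have h1 : HasDerivAt (fun v : ℝ => edgeLength t ε v) (-(t * Complex.I)) v := by
    unfold edgeLength
    have := (((Complex.ofRealCLM.hasDerivAt (x := v)).const_mul (t : ℂ)).mul_const
      Complex.I).const_sub (ε : ℂ)
    simpa using this
  have h0 := edgeLength_ne_zero (t := t) (v := v) hε
  refine ((h1.fun_pow (a + 1)).fun_inv (pow_ne_zero _ h0)).congr_deriv ?_
  simp only [Nat.add_sub_cancel, Nat.cast_add, Nat.cast_one]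
  field_simp
  ring

theorem hasDerivAt_comp_edgePoint {t ε v : ℝ} {Φ : ℝ × ℝ → E}
    (hΦ : DifferentiableAt ℝ Φ (edgePoint t ε v)) :
    HasDerivAt (fun v => Φ (edgePoint t ε v))
      ((-2 * (ε ^ 2 + t ^ 2) * v) • fderiv ℝ Φ (edgePoint t ε v) (1, 0)
        + ε • fderiv ℝ Φ (edgePoint t ε v) (0, 1)) v := by
  have h1 : HasDerivAt (fun v => edgePoint t ε v) (-2 * (ε ^ 2 + t ^ 2) * v, ε) v := by
    have h2 : HasDerivAt (fun v : ℝ => (ε ^ 2 + t ^ 2) * (1 - v ^ 2)) (-2 * (ε ^ 2 + t ^ 2) * v) v := by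
      refine ((((hasDerivAt_id v).fun_pow 2).const_sub 1).const_mul (ε ^ 2 + t ^ 2)).congr_deriv ?_
      simp; ring
    have h3 : HasDerivAt (fun v : ℝ => ε * v) ε v := by
      simpa using (hasDerivAt_id v).const_mul ε
    exact h2.prodMk h3
  refine (hΦ.hasFDerivAt.comp_hasDerivAt v h1).congr_deriv ?_
  rw [← map_smul, ← map_smul, ← map_add]
  simp

theorem intervalIntegral_combination {A B C D : ℝ → E} {x y : ℝ} {c κ : ℂ} {ε : ℝ}
    (hA : IntervalIntegrable A volume x y) (hB : IntervalIntegrable B volume x y)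
    (hC : IntervalIntegrable C volume x y) (hD : IntervalIntegrable D volume x y) :
    ∫ v in x..y, (c • A v + (κ • (ε • B v - C v) + ε • D v)) = c • (∫ v in x..y, A v)
      + (κ • (ε • (∫ v in x..y, B v) - ∫ v in x..y, C v) + ε • ∫ v in x..y, D v) := by
  have h1 : IntervalIntegrable (fun v => c • A v) volume x y := hA.smul c
  have h2 : IntervalIntegrable (fun v => ε • B v) volume x y := hB.smul ε
  have h3 : IntervalIntegrable (fun v => ε • B v - C v) volume x y := h2.sub hC
  have h4 : IntervalIntegrable (fun v => κ • (ε • B v - C v)) volume x y := h3.smul κ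
  have h5 : IntervalIntegrable (fun v => ε • D v) volume x y := hD.smul ε
  rw [intervalIntegral.integral_add h1 (h4.add h5), intervalIntegral.integral_add h4 h5]
  simp only [intervalIntegral.integral_smul]
  rw [intervalIntegral.integral_sub h2 hC, intervalIntegral.integral_smul]

/-- Integration by parts, as `γ ^ (-(a + 2))` is a multiple of the `v`-derivative of `γ ^ (-(a +
1))`. The derivative of `r²` along the surface is proportional to `v = (ε - γ) / (i t)`, hence
brings a factor `ε` or `γ`; the derivative of `u` brings `ε`. -/
theorem edgeIntegral_succ_succ [CompleteSpace E] {t ε : ℝ} (ht : t ≠ 0) (hε : 0 < ε) (a : ℕ) {Φ : ℝ × ℝ → E}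
    (hΦ : ContDiffOn ℝ 1 Φ {p | 0 < p.1}) :
    edgeIntegral t ε (a + 2) Φ = ((a + 1) * (t * Complex.I) : ℂ)⁻¹ •
      ((edgeLength t ε (1 / 2) ^ (a + 1))⁻¹ • Φ (edgePoint t ε (1 / 2))
        - (edgeLength t ε (-(1 / 2)) ^ (a + 1))⁻¹ • Φ (edgePoint t ε (-(1 / 2)))
        - ((-2 * (ε ^ 2 + t ^ 2) / (t * Complex.I) : ℂ) •
            (ε • edgeIntegral t ε (a + 1) (fun p => fderiv ℝ Φ p (1, 0))
              - edgeIntegral t ε a (fun p => fderiv ℝ Φ p (1, 0)))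
          + ε • edgeIntegral t ε (a + 1) (fun p => fderiv ℝ Φ p (0, 1)))) := by
  have hU : IsOpen {p : ℝ × ℝ | 0 < p.1} := isOpen_lt continuous_const continuous_fst
  have hc : ContinuousOn (fderiv ℝ Φ) {p | 0 < p.1} := hΦ.continuousOn_fderiv_of_isOpen hU (by norm_num)
  have hc1 : ContinuousOn (fun p => fderiv ℝ Φ p (1, 0)) {p | 0 < p.1} := hc.clm_apply continuousOn_const
  have hc2 : ContinuousOn (fun p => fderiv ℝ Φ p (0, 1)) {p | 0 < p.1} := hc.clm_apply continuousOn_const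
  have huI : uIcc (-(1 / 2) : ℝ) (1 / 2) = Icc (-(1 / 2)) (1 / 2) := uIcc_of_le (by norm_num)
  have hcne : ((a + 1) * (t * Complex.I) : ℂ) ≠ 0 :=
    mul_ne_zero (by exact_mod_cast Nat.succ_ne_zero a) (by simp [ht])
  have htI : (t * Complex.I : ℂ) ≠ 0 := by simp [ht]
  have i0 := intervalIntegrable_edge ht hε (a + 2) hΦ.continuousOn
  have i1 := intervalIntegrable_edge ht hε (a + 1) hc1
  have i2 := intervalIntegrable_edge ht hε a hc1
  have i3 := intervalIntegrable_edge ht hε (a + 1) hc2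
  set κ : ℂ := -2 * (ε ^ 2 + t ^ 2) / (t * Complex.I) with hκ
  set c : ℂ := (a + 1) * (t * Complex.I) with hcdef
  have hFTC := intervalIntegral.integral_eq_sub_of_hasDerivAt
    (a := -(1 / 2)) (b := 1 / 2)
    (f := fun v => (edgeLength t ε v ^ (a + 1))⁻¹ • Φ (edgePoint t ε v))
    (f' := fun v => c • (edgeLength t ε v ^ (a + 2))⁻¹ • Φ (edgePoint t ε v)
      + (κ • (ε • (edgeLength t ε v ^ (a + 1))⁻¹ • fderiv ℝ Φ (edgePoint t ε v) (1, 0)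
          - (edgeLength t ε v ^ a)⁻¹ • fderiv ℝ Φ (edgePoint t ε v) (1, 0))
        + ε • (edgeLength t ε v ^ (a + 1))⁻¹ • fderiv ℝ Φ (edgePoint t ε v) (0, 1))) ?_ ?_
  · rw [intervalIntegral_combination i0 i1 i2 i3] at hFTC
    rw [← hFTC]
    simp only [edgeIntegral, add_sub_cancel_right]
    rw [smul_smul, inv_mul_cancel₀ hcne, one_smul]
  · intro v hv
    have h1 := (hasDerivAt_inv_pow_edgeLength (t := t) hε a v).fun_smul
      (hasDerivAt_comp_edgePoint ((hΦ.differentiableOn (by norm_num)).differentiableAt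
        (hU.mem_nhds (edgePoint_pos (ε := ε) ht (huI ▸ hv)))))
    refine h1.congr_deriv ?_
    have hγ := edgeLength_ne_zero (t := t) (v := v) hε
    -- From `ε - γ = i t v`: the chain rule factor `-2 (ε² + t²) v` is rewritten so that it cancels
    -- one power of `γ` or leaves one power of `ε`.
    have hv : κ * (ε - edgeLength t ε v) = ((-2 * (ε ^ 2 + t ^ 2) * v : ℝ) : ℂ) := by
      rw [hκ]; unfold edgeLength; push_cast; rw [div_mul_eq_mul_div, div_eq_iff htI]; ring
    have hpow : (edgeLength t ε v ^ a)⁻¹ = edgeLength t ε v * (edgeLength t ε v ^ (a + 1))⁻¹ := by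
      field_simp; ring
    rw [hpow]
    simp only [← Complex.coe_smul, ← hv]
    module
  · exact (i0.smul c).add ((((i1.smul ε).sub i2).smul κ).add (i3.smul ε))

/-- The excess of `a` over `b + 1` measures the singularity. Each integration by parts costs one
derivative of `Φ` and lowers the excess by two, so `l` derivatives bring it down to the bounded
case. -/
theorem tendsto_edgeIntegral [CompleteSpace E] {t : ℝ} (ht : t ≠ 0) {l a b : ℕ} (hab : a ≤ b + 1 + 2 * l)
    {Φ : ℝ × ℝ → E} (hΦ : ContDiffOn ℝ (l : WithTop ℕ∞) Φ {p | 0 < p.1}) :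
    Tendsto (fun ε : ℝ => (ε ^ (1 + b) : ℝ) • edgeIntegral t ε a Φ) (𝓝[>] 0) (𝓝 0) := by
  induction l generalizing a b Φ with
  | zero => exact tendsto_edgeIntegral_of_le ht (by simpa using hab) hΦ.continuousOn
  | succ l ih =>
    by_cases h : a ≤ b + 1
    · exact tendsto_edgeIntegral_of_le ht h hΦ.continuousOn
    obtain ⟨a, rfl⟩ : ∃ a', a = a' + 2 := ⟨a - 2, by omega⟩
    have hU : IsOpen {p : ℝ × ℝ | 0 < p.1} := isOpen_lt continuous_const continuous_fst
    have hd : ContDiffOn ℝ (l : WithTop ℕ∞) (fderiv ℝ Φ) {p | 0 < p.1} :=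
      hΦ.fderiv_of_isOpen hU (by push_cast; exact le_rfl)
    have h1 : ContDiffOn ℝ (l : WithTop ℕ∞) (fun p => fderiv ℝ Φ p (1, 0)) {p | 0 < p.1} :=
      hd.clm_apply contDiffOn_const
    have h2 : ContDiffOn ℝ (l : WithTop ℕ∞) (fun p => fderiv ℝ Φ p (0, 1)) {p | 0 < p.1} :=
      hd.clm_apply contDiffOn_const
    -- In the terms `A` and `C` the extra factor `ε` is absorbed into `b`; in `B` it is the exponent
    -- `a + 2` that has dropped by two.
    have A := ih (a := a + 1) (b := b + 1) (by omega) h1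
    have B := ih (a := a) (b := b) (by omega) h1
    have C := ih (a := a + 1) (b := b + 1) (by omega) h2
    have P := tendsto_edge_pointwise ht (v := 1 / 2) (by norm_num) (by norm_num) (a + 1) b
      hΦ.continuousOn
    have Q := tendsto_edge_pointwise ht (v := -(1 / 2)) (by norm_num) (by norm_num) (a + 1) b
      hΦ.continuousOn
    have hκ : Tendsto (fun ε : ℝ => (-2 * (ε ^ 2 + t ^ 2) / (t * Complex.I) : ℂ)) (𝓝[>] 0)
        (𝓝 (-2 * ((0 : ℝ) ^ 2 + t ^ 2) / (t * Complex.I) : ℂ)) := by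
      have : Continuous fun ε : ℝ => (-2 * (ε ^ 2 + t ^ 2) / (t * Complex.I) : ℂ) := by fun_prop
      exact (this.tendsto 0).mono_left nhdsWithin_le_nhds
    have H := ((P.sub Q).sub ((hκ.smul (A.sub B)).add C)).const_smul
      ((a + 1) * (t * Complex.I) : ℂ)⁻¹
    simp only [sub_zero, smul_zero, add_zero] at H
    refine H.congr' ?_
    filter_upwards [self_mem_nhdsWithin] with ε hε
    rw [edgeIntegral_succ_succ ht hε a (hΦ.of_le (by norm_cast; omega))]
    rw [smul_comm (ε ^ (1 + b) : ℝ) (((a + 1) * (t * Complex.I) : ℂ)⁻¹)]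
    congr 1
    have hp : (ε ^ (1 + (b + 1)) : ℝ) = ε ^ (1 + b) * ε := by ring
    simp only [smul_sub, smul_add, hp, mul_smul, smul_comm (ε ^ (1 + b) : ℝ)
      (-2 * (ε ^ 2 + t ^ 2) / (t * Complex.I) : ℂ)]

end EdgeIntegral

/-! ### Lowering the exponent of the potential by integration by parts -/

section SourceIntegral

/-- The square `r ^ 2 + (u - i t) ^ 2` of the complex length. -/
noncomputable def sqLength (t u r : ℝ) : ℂ := (r : ℂ) ^ 2 + ((u : ℂ) - t * Complex.I) ^ 2

/-- The distance from the axis at height `u` of the spheroid on which the complex length has real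
part `ε`, and `0` for heights that the spheroid does not reach. -/
noncomputable def spheroidRadius (t ε u : ℝ) : ℝ := √((ε ^ 2 + t ^ 2) * (1 - (u / ε) ^ 2))

theorem continuous_sqLength (t : ℝ) : Continuous fun q : ℝ × ℝ => sqLength t q.1 q.2 := by
  unfold sqLength; fun_prop

theorem continuous_spheroidRadius (t ε : ℝ) : Continuous (spheroidRadius t ε) := by
  unfold spheroidRadius; fun_prop

theorem spheroidRadius_nonneg (t ε u : ℝ) : 0 ≤ spheroidRadius t ε u := Real.sqrt_nonneg _

theorem spheroidRadius_zero (t ε : ℝ) : spheroidRadius t ε 0 = √(ε ^ 2 + t ^ 2) := by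
  simp [spheroidRadius]

theorem sqLength_re (t u r : ℝ) : (sqLength t u r).re = r ^ 2 + u ^ 2 - t ^ 2 := by
  simp [sqLength, sq]; ring

theorem sqLength_im (t u r : ℝ) : (sqLength t u r).im = -(2 * t * u) := by
  simp [sqLength, sq]; ring

/-- For `r ≥ 0` the square of the length vanishes only where `u = 0` and `r = |t|`, and this point
lies strictly inside the spheroid because `√(ε² + t²) > |t|`. -/
theorem sqLength_ne_zero {t ε u r : ℝ} (hε : 0 < ε) (h : spheroidRadius t ε u ≤ r) :
    sqLength t u r ≠ 0 := by
  intro h0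
  have h1 := sqLength_re t u r
  have h2 := sqLength_im t u r
  rw [h0] at h1 h2
  simp only [Complex.zero_re, Complex.zero_im] at h1 h2
  have hr : 0 ≤ r := (spheroidRadius_nonneg t ε u).trans h
  have hu : u = 0 := by
    by_contra hu
    have ht : t = 0 := by
      by_contra ht
      exact (mul_ne_zero (mul_ne_zero two_ne_zero ht) hu) (by linarith)
    subst ht
    have : 0 < u ^ 2 := by positivity
    nlinarith [sq_nonneg r]
  subst hu
  rw [spheroidRadius_zero] at h
  have h3 := Real.sq_sqrt (by positivity : 0 ≤ ε ^ 2 + t ^ 2)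
  have h4 := pow_le_pow_left₀ (Real.sqrt_nonneg _) h 2
  nlinarith [sq_pos_of_pos hε]

theorem spheroidRadius_eq_zero {t ε u : ℝ} (hε : 0 < ε) (h : ε ≤ |u|) :
    spheroidRadius t ε u = 0 := by
  refine Real.sqrt_eq_zero_of_nonpos ?_
  have : 1 ≤ (u / ε) ^ 2 := by
    rw [one_le_sq_iff_one_le_abs, abs_div, abs_of_pos hε]
    exact (one_le_div hε).2 h
  have h2 : 0 ≤ ε ^ 2 + t ^ 2 := by positivity
  nlinarith

theorem spheroidRadius_mul {t ε : ℝ} (hε : 0 < ε) (v : ℝ) :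
    spheroidRadius t ε (ε * v) = √((ε ^ 2 + t ^ 2) * (1 - v ^ 2)) := by
  rw [spheroidRadius, mul_div_cancel_left₀ _ hε.ne']

/-- On the spheroid the complex length is `ε - i t v`: its real part is the constant `ε`, and `v = u
/ ε` parametrizes its imaginary part. -/
theorem sqLength_spheroidRadius {t ε v : ℝ} (hε : 0 < ε) (hv : |v| ≤ 1) :
    sqLength t (ε * v) (spheroidRadius t ε (ε * v)) = edgeLength t ε v ^ 2 := by
  have h1 : v ^ 2 ≤ 1 := (sq_le_one_iff_abs_le_one v).2 hv
  have h : (spheroidRadius t ε (ε * v)) ^ 2 = (ε ^ 2 + t ^ 2) * (1 - v ^ 2) := by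
    rw [spheroidRadius_mul hε, Real.sq_sqrt (mul_nonneg (by positivity) (by linarith))]
  rw [sqLength, ← Complex.ofReal_pow, h, edgeLength]
  push_cast
  linear_combination (t ^ 2 - t ^ 2 * v ^ 2 : ℂ) * Complex.I_sq

variable {E : Type*} [NormedAddCommGroup E] [NormedSpace ℂ E]

/-- The integrand in cylindrical coordinates `(u, r)` of the action of `(γ ^ 2) ^ (-m)` on `F`. -/
noncomputable def sourceIntegrand (t : ℝ) (m : ℕ) (F : ℝ → ℝ → E) (q : ℝ × ℝ) : E :=
  (sqLength t q.1 q.2 ^ m)⁻¹ • (q.2 ^ (2 * m)) • F q.1 q.2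

/-- The exterior of the spheroid on which the complex length has real part `ε`. -/
def exterior (t ε : ℝ) : Set (ℝ × ℝ) := {q | spheroidRadius t ε q.1 < q.2}

/-- The integral of `sourceIntegrand` over the exterior of a spheroid. -/
noncomputable def sourceIntegral (t ε : ℝ) (m : ℕ) (F : ℝ → ℝ → E) : E :=
  ∫ q in exterior t ε, sourceIntegrand t m F q

theorem measurableSet_exterior (t ε : ℝ) : MeasurableSet (exterior t ε) :=
  measurableSet_lt ((continuous_spheroidRadius t ε).measurable.comp measurable_fst) measurable_snd

theorem exists_norm_le_of_support {E : Type*} [NormedAddCommGroup E] {F : ℝ → ℝ → E}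
    (hF : Continuous fun q : ℝ × ℝ => F q.1 q.2)
    {B : ℝ} (hB : ∀ u r, B < |u| ∨ B < |r| → F u r = 0) : ∃ C, 0 ≤ C ∧ ∀ u r, ‖F u r‖ ≤ C := by
  have hK : IsCompact (Icc (-B) B ×ˢ Icc (-B) B) := isCompact_Icc.prod isCompact_Icc
  obtain ⟨C, hC⟩ := hK.exists_bound_of_continuousOn hF.continuousOn
  refine ⟨max C 0, le_max_right _ _, fun u r => ?_⟩
  by_cases h : B < |u| ∨ B < |r|
  · rw [hB u r h, norm_zero]; exact le_max_right _ _
  · push Not at h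
    exact (hC (u, r) ⟨abs_le.1 h.1, abs_le.1 h.2⟩).trans (le_max_left _ _)

theorem continuousOn_sourceIntegrand {t ε : ℝ} (hε : 0 < ε) (m : ℕ) {F : ℝ → ℝ → E}
    (hF : Continuous fun q : ℝ × ℝ => F q.1 q.2) :
    ContinuousOn (sourceIntegrand t m F) {q | spheroidRadius t ε q.1 ≤ q.2} := by
  refine ContinuousOn.smul ?_ (by fun_prop)
  exact (((continuous_sqLength t).pow m).continuousOn).inv₀ fun q hq =>
    pow_ne_zero _ (sqLength_ne_zero hε hq)

theorem integrableOn_sourceIntegrand {t ε : ℝ} (hε : 0 < ε) (m : ℕ) {F : ℝ → ℝ → E}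
    (hF : Continuous fun q : ℝ × ℝ => F q.1 q.2)
    {B : ℝ} (hB : ∀ u r, B < |u| ∨ B < |r| → F u r = 0) :
    IntegrableOn (sourceIntegrand t m F) (exterior t ε) := by
  have hcl : IsClosed {q : ℝ × ℝ | spheroidRadius t ε q.1 ≤ q.2} :=
    isClosed_le ((continuous_spheroidRadius t ε).comp continuous_fst) continuous_snd
  have hK : IsCompact ((Icc (-B) B ×ˢ Icc (-B) B) ∩ {q : ℝ × ℝ | spheroidRadius t ε q.1 ≤ q.2}) :=
    (isCompact_Icc.prod isCompact_Icc).inter_right hcl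
  have h1 := ((continuousOn_sourceIntegrand hε m hF).mono inter_subset_right).integrableOn_compact hK
    (μ := volume)
  refine h1.of_forall_sdiff_eq_zero (measurableSet_exterior t ε) ?_
  rintro ⟨u, r⟩ ⟨hq, hq'⟩
  have : F u r = 0 := by
    refine hB u r ?_
    by_contra h
    push Not at h
    exact hq' ⟨⟨abs_le.1 h.1, abs_le.1 h.2⟩, le_of_lt (show spheroidRadius t ε u < r from hq)⟩
  simp [sourceIntegrand, this]

theorem integral_indicator_exterior (t ε : ℝ) (g : ℝ × ℝ → E) (u : ℝ) :
    ∫ r, (exterior t ε).indicator g (u, r) = ∫ r in Ioi (spheroidRadius t ε u), g (u, r) := by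
  rw [← integral_indicator measurableSet_Ioi]
  rfl

theorem integrable_radial_integral {t ε : ℝ} (hε : 0 < ε) (m : ℕ) {F : ℝ → ℝ → E}
    (hF : Continuous fun q : ℝ × ℝ => F q.1 q.2)
    {B : ℝ} (hB : ∀ u r, B < |u| ∨ B < |r| → F u r = 0) :
    Integrable fun u => ∫ r in Ioi (spheroidRadius t ε u), sourceIntegrand t m F (u, r) := by
  have h := (integrable_indicator_iff (measurableSet_exterior t ε)).2
    (integrableOn_sourceIntegrand (t := t) hε m hF hB)
  rw [Measure.volume_eq_prod] at h
  simpa only [integral_indicator_exterior] using h.integral_prod_left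

theorem sourceIntegral_eq {t ε : ℝ} (hε : 0 < ε) (m : ℕ) {F : ℝ → ℝ → E}
    (hF : Continuous fun q : ℝ × ℝ => F q.1 q.2)
    {B : ℝ} (hB : ∀ u r, B < |u| ∨ B < |r| → F u r = 0) :
    sourceIntegral t ε m F
      = ∫ u, ∫ r in Ioi (spheroidRadius t ε u), sourceIntegrand t m F (u, r) := by
  have h := (integrable_indicator_iff (measurableSet_exterior t ε)).2
    (integrableOn_sourceIntegrand (t := t) hε m hF hB)
  rw [sourceIntegral, ← integral_indicator (measurableSet_exterior t ε)]
  rw [Measure.volume_eq_prod] at h ⊢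
  rw [integral_prod _ h]
  simp only [integral_indicator_exterior]

theorem lower_support {E : Type*} [NormedAddCommGroup E] [NormedSpace ℝ E] {F : ℝ → ℝ → E} {B : ℝ}
    (hB : ∀ u r, B < |u| ∨ B < |r| → F u r = 0) (c u r : ℝ) (h : B < |u| ∨ B < |r|) :
    lower c (F u) r = 0 := by
  have h1 : F u =ᶠ[𝓝 r] fun _ => 0 := by
    rcases h with h | h
    · exact Eventually.of_forall fun s => hB u s (Or.inl h)
    · filter_upwards [(isOpen_lt continuous_const continuous_abs).mem_nhds h] with s hs
      exact hB u s (Or.inr hs)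
  simp [lower, hB u r h, h1.deriv_eq]

/-- The integrand of the boundary term that is left when the exponent is lowered. -/
noncomputable def boundaryIntegrand (t ε : ℝ) (m : ℕ) (F : ℝ → ℝ → E) (u : ℝ) : E :=
  (sqLength t u (spheroidRadius t ε u) ^ (m + 1))⁻¹ •
    (spheroidRadius t ε u ^ (2 * m + 3)) • F u (spheroidRadius t ε u)

/-- Integrate the derivative of `σ ^ (-(m + 1)) r ^ (2m + 3) F`, where `σ` is the square of the
length. The derivative of `σ` is `2 r`, which produces the integrand of exponent `m + 2`; the other
two terms combine to exponent `m + 1` with `lower (1 / (2m + 3)) F`. The only boundary is the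
spheroid, by compact support. -/
theorem radial_integral_succ [CompleteSpace E] {t ε : ℝ} (hε : 0 < ε) (m : ℕ) {F : ℝ → ℝ → E}
    (hF : ContDiff ℝ 1 fun q : ℝ × ℝ => F q.1 q.2)
    {B : ℝ} (hB : ∀ u r, B < |u| ∨ B < |r| → F u r = 0) (u : ℝ) :
    ∫ r in Ioi (spheroidRadius t ε u), sourceIntegrand t (m + 2) F (u, r)
      = ((2 * m + 3) / (2 * m + 2) : ℝ) • (∫ r in Ioi (spheroidRadius t ε u),
          sourceIntegrand t (m + 1) (fun u => lower (1 / (2 * m + 3)) (F u)) (u, r))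
        + (1 / (2 * m + 2) : ℝ) • boundaryIntegrand t ε m F u := by
  set R := spheroidRadius t ε u with hR
  set L : ℝ → ℝ → E := fun u => lower (1 / (2 * m + 3)) (F u) with hL
  have hLc : Continuous fun q : ℝ × ℝ => L q.1 q.2 := (contDiff_lower (l := 0) (Φ := F) _ hF).continuous
  have hslice : Continuous fun r : ℝ => (u, r) := by fun_prop
  have hint : ∀ (p : ℕ) {H : ℝ → ℝ → E}, (Continuous fun q : ℝ × ℝ => H q.1 q.2) →
      (∀ u r, B < |u| ∨ B < |r| → H u r = 0) →
      IntegrableOn (fun r => sourceIntegrand t p H (u, r)) (Ioi R) := by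
    intro p H hH hHB
    have h1 : ContinuousOn (fun r => sourceIntegrand t p H (u, r)) (Icc R B) :=
      (continuousOn_sourceIntegrand hε p hH).comp hslice.continuousOn fun r hr => hr.1
    refine (h1.integrableOn_Icc (μ := volume)).of_forall_sdiff_eq_zero measurableSet_Ioi ?_
    rintro r ⟨hr, hr'⟩
    have hr0 : R < r := hr
    have : B < r := by
      by_contra h
      exact hr' ⟨hr0.le, not_lt.1 h⟩
    simp [sourceIntegrand, hHB u r (Or.inr (this.trans_le (le_abs_self r)))]
  have i1 := hint (m + 2) hF.continuous hB
  have i2 := hint (m + 1) hLc (fun u r h => lower_support hB _ u r h)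
  let G : ℝ → E := fun r => (sqLength t u r ^ (m + 1))⁻¹ • (r ^ (2 * m + 3)) • F u r
  have hFd : ∀ r, HasDerivAt (F u) (deriv (F u) r) r := fun r =>
    (hasDerivAt_of_fderiv_snd (hF.differentiable (by norm_num) (u, r))).differentiableAt.hasDerivAt
  have hG : ∀ r ∈ Ici R, HasDerivAt G ((2 * m + 3 : ℝ) • sourceIntegrand t (m + 1) L (u, r)
      - (2 * m + 2 : ℝ) • sourceIntegrand t (m + 2) F (u, r)) r := by
    intro r hr
    have hσ : sqLength t u r ≠ 0 := sqLength_ne_zero hε hr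
    have h1 : HasDerivAt (fun r : ℝ => sqLength t u r) (2 * r) r := by
      have := ((Complex.ofRealCLM.hasDerivAt (x := r)).fun_pow 2).add_const
        (((u : ℂ) - t * Complex.I) ^ 2)
      simpa [sqLength] using this
    have h2 : HasDerivAt (fun r : ℝ => (sqLength t u r ^ (m + 1))⁻¹)
        (-(2 * m + 2) * r * (sqLength t u r ^ (m + 2))⁻¹) r := by
      refine ((h1.fun_pow (m + 1)).fun_inv (pow_ne_zero _ hσ)).congr_deriv ?_
      simp only [Nat.add_sub_cancel, Nat.cast_add, Nat.cast_one]
      field_simp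
      ring
    have h3 : HasDerivAt (fun r : ℝ => r ^ (2 * m + 3)) ((2 * m + 3) * r ^ (2 * m + 2)) r := by
      refine (hasDerivAt_pow (2 * m + 3) r).congr_deriv ?_
      simp
    refine (h2.fun_smul (h3.fun_smul (hFd r))).congr_deriv ?_
    simp only [sourceIntegrand, hL, lower]
    set A := (sqLength t u r ^ (m + 1))⁻¹
    set A' := (sqLength t u r ^ (m + 2))⁻¹
    have hm : (2 * m + 3 : ℝ) ≠ 0 := by positivity
    have e1 : (2 * m + 3 : ℝ) • A • (r ^ (2 * (m + 1))) •
        (F u r + (1 / (2 * m + 3) * r) • deriv (F u) r)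
        = A • (((2 * m + 3) * r ^ (2 * m + 2)) • F u r + (r ^ (2 * m + 3)) • deriv (F u) r) := by
      rw [smul_comm, smul_add, smul_add, smul_smul, smul_smul, smul_smul]
      congr 3
      · field_simp; ring
    rw [e1, sub_eq_add_neg, add_comm ((r ^ (2 * m + 3)) • deriv (F u) r)]
    congr 1
    simp only [← Complex.coe_smul, smul_smul, ← neg_smul]
    congr 1
    push_cast
    ring
  have hlim : Tendsto G atTop (𝓝 0) := by
    refine tendsto_const_nhds.congr' ?_
    filter_upwards [eventually_gt_atTop B] with r hr
    simp [G, hB u r (Or.inr (hr.trans_le (le_abs_self r)))]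
  have hI := integral_Ioi_of_hasDerivAt_of_tendsto' hG
    ((i2.smul (2 * m + 3 : ℝ)).sub (i1.smul (2 * m + 2 : ℝ))) hlim
  have j2 : IntegrableOn (fun r => (2 * m + 3 : ℝ) • sourceIntegrand t (m + 1) L (u, r)) (Ioi R) :=
    i2.smul (2 * m + 3 : ℝ)
  have j1 : IntegrableOn (fun r => (2 * m + 2 : ℝ) • sourceIntegrand t (m + 2) F (u, r)) (Ioi R) :=
    i1.smul (2 * m + 2 : ℝ)
  rw [integral_sub j2 j1, integral_smul, integral_smul] at hI
  have hbd : boundaryIntegrand t ε m F u = G R := rfl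
  rw [hbd]
  have hm : (2 * m + 2 : ℝ) ≠ 0 := by positivity
  set a := ∫ r in Ioi R, sourceIntegrand t (m + 2) F (u, r)
  set b := ∫ r in Ioi R, sourceIntegrand t (m + 1) L (u, r)
  have hGR : G R = (2 * m + 2 : ℝ) • a - (2 * m + 3 : ℝ) • b := by
    rw [← neg_inj, ← zero_sub (G R), ← hI]; abel
  rw [hGR, smul_sub, smul_smul, smul_smul, one_div_mul_cancel hm, one_smul, one_div_mul_eq_div]
  abel

theorem continuous_boundaryIntegrand {t ε : ℝ} (hε : 0 < ε) (m : ℕ) {F : ℝ → ℝ → E}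
    (hF : Continuous fun q : ℝ × ℝ => F q.1 q.2) : Continuous (boundaryIntegrand t ε m F) := by
  have hR := continuous_spheroidRadius t ε
  have h1 : Continuous fun u => sqLength t u (spheroidRadius t ε u) :=
    (continuous_sqLength t).comp (continuous_id.prodMk hR)
  have h2 : Continuous fun u => F u (spheroidRadius t ε u) := hF.comp (continuous_id.prodMk hR)
  exact ((h1.pow (m + 1)).inv₀ fun u => pow_ne_zero _ (sqLength_ne_zero hε le_rfl)).smul
    ((hR.pow _).smul h2)

theorem boundaryIntegrand_eq_zero {t ε : ℝ} (hε : 0 < ε) (m : ℕ) (F : ℝ → ℝ → E) {u : ℝ}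
    (hu : ε ≤ |u|) : boundaryIntegrand t ε m F u = 0 := by
  simp [boundaryIntegrand, spheroidRadius_eq_zero hε hu]

/-- For `|u| ≥ ε` the spheroid radius is `0` by the convention for the root of a negative number, so
the integrand vanishes there; then `u = ε v`. -/
theorem integral_boundaryIntegrand {t ε : ℝ} (hε : 0 < ε) (m : ℕ) (F : ℝ → ℝ → E) :
    ∫ u, boundaryIntegrand t ε m F u
      = ε • ∫ v in (-1 : ℝ)..1, boundaryIntegrand t ε m F (ε * v) := by
  rw [intervalIntegral.smul_integral_comp_mul_left, mul_neg_one, mul_one,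
    intervalIntegral.integral_of_le (by linarith), ← integral_indicator measurableSet_Ioc]
  congr 1
  ext u
  by_cases hu : u ∈ Ioc (-ε) ε
  · rw [indicator_of_mem hu]
  · rw [indicator_of_notMem hu]
    refine boundaryIntegrand_eq_zero hε m F ?_
    by_contra h
    have := abs_lt.1 (not_le.1 h)
    exact hu ⟨this.1, this.2.le⟩

theorem sourceIntegral_succ [CompleteSpace E] {t ε : ℝ} (hε : 0 < ε) (m : ℕ) {F : ℝ → ℝ → E}
    (hF : ContDiff ℝ 1 fun q : ℝ × ℝ => F q.1 q.2)
    {B : ℝ} (hB : ∀ u r, B < |u| ∨ B < |r| → F u r = 0) :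
    sourceIntegral t ε (m + 2) F = ((2 * m + 3) / (2 * m + 2) : ℝ) •
        sourceIntegral t ε (m + 1) (fun u => lower (1 / (2 * m + 3)) (F u))
      + (1 / (2 * m + 2) : ℝ) • ε • ∫ v in (-1 : ℝ)..1, boundaryIntegrand t ε m F (ε * v) := by
  have hLc : Continuous fun q : ℝ × ℝ => lower (1 / (2 * m + 3)) (F q.1) q.2 :=
    (contDiff_lower (l := 0) (Φ := F) _ hF).continuous
  have hLB := fun u r h => lower_support hB (1 / (2 * m + 3)) u r h
  have hbi : Integrable (boundaryIntegrand t ε m F) := by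
    refine (continuous_boundaryIntegrand hε m hF.continuous).integrable_of_hasCompactSupport ?_
    refine HasCompactSupport.intro (isCompact_Icc (a := -ε) (b := ε)) fun u hu => ?_
    refine boundaryIntegrand_eq_zero hε m F ?_
    by_contra h
    have := abs_lt.1 (not_le.1 h)
    exact hu ⟨this.1.le, this.2.le⟩
  rw [sourceIntegral_eq hε _ hF.continuous hB,
    sourceIntegral_eq (F := fun u => lower (1 / (2 * m + 3)) (F u)) hε _ hLc hLB,
    ← integral_boundaryIntegrand hε]
  simp_rw [radial_integral_succ hε m hF hB]
  have j1 : Integrable fun u => ((2 * m + 3) / (2 * m + 2) : ℝ) •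
      ∫ r in Ioi (spheroidRadius t ε u),
        sourceIntegrand t (m + 1) (fun u => lower (1 / (2 * m + 3)) (F u)) (u, r) :=
    (integrable_radial_integral (F := fun u => lower (1 / (2 * m + 3)) (F u)) hε _ hLc hLB).smul _
  have j2 : Integrable fun u => (1 / (2 * m + 2) : ℝ) • boundaryIntegrand t ε m F u := hbi.smul _
  rw [integral_add j1 j2, integral_smul, integral_smul]

end SourceIntegral

/-! ### The boundary terms vanish in the limit -/

section BoundaryTerm

variable {E : Type*} [NormedAddCommGroup E] [NormedSpace ℂ E]

theorem boundaryIntegrand_mul {t ε : ℝ} (hε : 0 < ε) (m : ℕ) (F : ℝ → ℝ → E) {v : ℝ}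
    (hv : |v| ≤ 1) : boundaryIntegrand t ε m F (ε * v)
      = (edgeLength t ε v ^ (2 * (m + 1)))⁻¹ • (√(edgePoint t ε v).1 ^ (2 * m + 3)) •
        F (edgePoint t ε v).2 √(edgePoint t ε v).1 := by
  rw [boundaryIntegrand, sqLength_spheroidRadius hε hv, spheroidRadius_mul hε, ← pow_mul]
  rfl

theorem norm_boundaryIntegrand_mul_le {t ε : ℝ} (hε : 0 < ε) (m : ℕ) {F : ℝ → ℝ → E} {C : ℝ}
    (hC : ∀ u r, ‖F u r‖ ≤ C) {v : ℝ} (hv : |v| ≤ 1) : ‖boundaryIntegrand t ε m F (ε * v)‖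
      ≤ (‖edgeLength t ε v‖ ^ (2 * (m + 1)))⁻¹ * (√(ε ^ 2 + t ^ 2) ^ (2 * m + 3) * C) := by
  rw [boundaryIntegrand_mul hε m F hv, norm_smul, norm_smul, norm_inv, norm_pow, norm_pow,
    Real.norm_of_nonneg (Real.sqrt_nonneg _)]
  have h : (edgePoint t ε v).1 ≤ ε ^ 2 + t ^ 2 := by
    unfold edgePoint
    nlinarith [sq_nonneg v, mul_nonneg (add_nonneg (sq_nonneg ε) (sq_nonneg t)) (sq_nonneg v)]
  gcongr
  exact hC _ _

/-- For `t = 0` the spheroid is a sphere of radius `ε`, and the powers `ε ^ (2m + 3)` and `ε ^ (-(2m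
+ 2))` nearly cancel and leave a factor `ε`. -/
theorem tendsto_boundary_zero (m : ℕ) {F : ℝ → ℝ → E} {C : ℝ} (hC : ∀ u r, ‖F u r‖ ≤ C) :
    Tendsto (fun ε : ℝ => ε • ∫ v in (-1 : ℝ)..1, boundaryIntegrand 0 ε m F (ε * v))
      (𝓝[>] 0) (𝓝 0) := by
  have hlim : Tendsto (fun ε : ℝ => ε * (ε * C * |1 - (-1)|)) (𝓝[>] 0) (𝓝 0) := by
    have : Continuous fun ε : ℝ => ε * (ε * C * |1 - (-1)|) := by fun_prop
    simpa using (this.tendsto 0).mono_left (nhdsWithin_le_nhds (s := Ioi 0))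
  refine squeeze_zero_norm' ?_ hlim
  filter_upwards [self_mem_nhdsWithin] with ε hε
  replace hε : 0 < ε := hε
  rw [norm_smul, Real.norm_of_nonneg hε.le]
  gcongr
  refine intervalIntegral.norm_integral_le_of_norm_le_const fun v hv => ?_
  rw [uIoc_of_le (by norm_num)] at hv
  have hv1 : |v| ≤ 1 := abs_le.2 ⟨hv.1.le, hv.2⟩
  refine (norm_boundaryIntegrand_mul_le hε m hC hv1).trans (le_of_eq ?_)
  have h1 : edgeLength 0 ε v = ε := by simp [edgeLength]
  have h2 : √(ε ^ 2 + 0 ^ 2) = ε := by simp [Real.sqrt_sq hε.le]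
  rw [h1, h2, Complex.norm_of_nonneg hε.le]
  field_simp
  ring

/-- The edge integral uses the variable `r²`, so `r = √(r²)` is smooth only away from the axis.
Hence the middle part of the surface is treated apart from its poles. -/
theorem contDiffOn_edge_profile {l : ℕ} (p : ℕ) {F : ℝ → ℝ → E}
    (hF : ContDiff ℝ (l : WithTop ℕ∞) fun q : ℝ × ℝ => F q.1 q.2) :
    ContDiffOn ℝ (l : WithTop ℕ∞) (fun q : ℝ × ℝ => (√q.1 ^ p) • F q.2 √q.1) {q | 0 < q.1} := by
  have h1 : ContDiffOn ℝ (l : WithTop ℕ∞) (fun q : ℝ × ℝ => √q.1) {q | 0 < q.1} :=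
    contDiffOn_fst.sqrt fun q hq => (ne_of_gt hq)
  exact (h1.pow p).smul (hF.comp_contDiffOn (contDiffOn_snd.prodMk h1))

/-- For `t ≠ 0` and `|v| ≥ 1/2` one has `|γ| ≥ |t| / 2`; the integrand is bounded there and the
factor `ε` suffices. For `|v| ≤ 1/2` the surface stays off the axis, where `tendsto_edgeIntegral`
applies. -/
theorem tendsto_boundary [CompleteSpace E] (t : ℝ) (m : ℕ) {F : ℝ → ℝ → E}
    (hF : ContDiff ℝ ((m + 1 : ℕ) : WithTop ℕ∞) fun q : ℝ × ℝ => F q.1 q.2)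
    {B : ℝ} (hB : ∀ u r, B < |u| ∨ B < |r| → F u r = 0) :
    Tendsto (fun ε : ℝ => ε • ∫ v in (-1 : ℝ)..1, boundaryIntegrand t ε m F (ε * v))
      (𝓝[>] 0) (𝓝 0) := by
  obtain ⟨C, hC0, hC⟩ := exists_norm_le_of_support hF.continuous hB
  by_cases ht : t = 0
  · subst ht; exact tendsto_boundary_zero m hC
  have ht' : 0 < |t| / 2 := by positivity
  set D : ℝ := ((|t| / 2) ^ (2 * (m + 1)))⁻¹ * (√(1 ^ 2 + t ^ 2) ^ (2 * m + 3) * C) with hD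
  have hε1 : ∀ᶠ ε : ℝ in 𝓝[>] 0, ε ∈ Ioo (0 : ℝ) 1 := Ioo_mem_nhdsGT one_pos
  have htail : ∀ ε ∈ Ioo (0 : ℝ) 1, ∀ v : ℝ, 1 / 2 ≤ |v| → |v| ≤ 1 →
      ‖boundaryIntegrand t ε m F (ε * v)‖ ≤ D := by
    intro ε hε v hv hv1
    refine (norm_boundaryIntegrand_mul_le hε.1 m hC hv1).trans ?_
    have h1 : |t| / 2 ≤ ‖edgeLength t ε v‖ := by
      have h := Complex.abs_im_le_norm (edgeLength t ε v)
      have h2 : (edgeLength t ε v).im = -(t * v) := by simp [edgeLength]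
      rw [h2, abs_neg, abs_mul] at h
      nlinarith [abs_nonneg t]
    have h2 : ε ≤ 1 := hε.2.le
    have h3 := hε.1.le
    rw [hD]
    gcongr
  have hlim : Tendsto (fun ε : ℝ => ε * (D * |(-(1 / 2)) - (-1)|)) (𝓝[>] 0) (𝓝 0) := by
    have : Continuous fun ε : ℝ => ε * (D * |(-(1 / 2)) - (-1)|) := by fun_prop
    simpa using (this.tendsto 0).mono_left (nhdsWithin_le_nhds (s := Ioi 0))
  have hlim' : Tendsto (fun ε : ℝ => ε * (D * |1 - 1 / 2|)) (𝓝[>] 0) (𝓝 0) := by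
    have : Continuous fun ε : ℝ => ε * (D * |1 - 1 / 2|) := by fun_prop
    simpa using (this.tendsto 0).mono_left (nhdsWithin_le_nhds (s := Ioi 0))
  have hleft : Tendsto (fun ε : ℝ => ε • ∫ v in (-1 : ℝ)..(-(1 / 2)),
      boundaryIntegrand t ε m F (ε * v)) (𝓝[>] 0) (𝓝 0) := by
    refine squeeze_zero_norm' ?_ hlim
    filter_upwards [hε1] with ε hε
    rw [norm_smul, Real.norm_of_nonneg hε.1.le]
    refine mul_le_mul_of_nonneg_left ?_ hε.1.le
    refine intervalIntegral.norm_integral_le_of_norm_le_const fun v hv => ?_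
    rw [uIoc_of_le (by norm_num)] at hv
    exact htail ε hε v (by rw [le_abs]; right; linarith [hv.2])
      (abs_le.2 ⟨hv.1.le, by linarith [hv.2]⟩)
  have hright : Tendsto (fun ε : ℝ => ε • ∫ v in (1 / 2 : ℝ)..1,
      boundaryIntegrand t ε m F (ε * v)) (𝓝[>] 0) (𝓝 0) := by
    refine squeeze_zero_norm' ?_ hlim'
    filter_upwards [hε1] with ε hε
    rw [norm_smul, Real.norm_of_nonneg hε.1.le]
    refine mul_le_mul_of_nonneg_left ?_ hε.1.le
    refine intervalIntegral.norm_integral_le_of_norm_le_const fun v hv => ?_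
    rw [uIoc_of_le (by norm_num)] at hv
    exact htail ε hε v (by rw [le_abs]; left; linarith [hv.1])
      (abs_le.2 ⟨by linarith [hv.1], hv.2⟩)
  -- The exponent `2 (m + 1)` is within reach of `m + 1` derivatives already with the single factor
  -- `ε`, that is `b = 0`.
  have hmid := tendsto_edgeIntegral (b := 0) ht (a := 2 * (m + 1)) (l := m + 1) (by omega)
    (contDiffOn_edge_profile (2 * m + 3) hF)
  have hsum := (hleft.add hmid).add hright
  simp only [add_zero] at hsum
  refine hsum.congr' ?_
  filter_upwards [hε1] with ε hε
  have hc : Continuous fun v => boundaryIntegrand t ε m F (ε * v) :=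
    (continuous_boundaryIntegrand hε.1 m hF.continuous).comp (by fun_prop)
  rw [← intervalIntegral.integral_add_adjacent_intervals (hc.intervalIntegrable (-1) (1 / 2))
    (hc.intervalIntegrable (1 / 2) 1), ← intervalIntegral.integral_add_adjacent_intervals
    (hc.intervalIntegrable (-1) (-(1 / 2))) (hc.intervalIntegrable (-(1 / 2)) (1 / 2)),
    smul_add, smul_add, pow_one]
  congr 3
  refine intervalIntegral.integral_congr fun v hv => ?_
  rw [uIcc_of_le (by norm_num)] at hv
  exact (boundaryIntegrand_mul hε.1 m F (abs_le.2 ⟨by linarith [hv.1], by linarith [hv.2]⟩)).symm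

/-- The factor that the source integral picks up in the course of the descent. -/
noncomputable def descConst : ℕ → ℝ
  | 0 => 1
  | m + 1 => (2 * m + 3) / (2 * m + 2) * descConst m

/-- Iterating `sourceIntegral_succ` applies the same operators in the same order as `desc`, and each
step leaves a boundary term that tends to `0`. -/
theorem tendsto_sourceIntegral_sub [CompleteSpace E] (t : ℝ) (m : ℕ) {F : ℝ → ℝ → E}
    (hF : ContDiff ℝ (m : WithTop ℕ∞) fun q : ℝ × ℝ => F q.1 q.2)
    {B : ℝ} (hB : ∀ u r, B < |u| ∨ B < |r| → F u r = 0) :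
    Tendsto (fun ε : ℝ => sourceIntegral t ε (m + 1) F
      - descConst m • sourceIntegral t ε 1 (fun u => desc m (F u))) (𝓝[>] 0) (𝓝 0) := by
  induction m generalizing F with
  | zero => simp [descConst, desc]
  | succ m ih =>
    have hL : ContDiff ℝ (m : WithTop ℕ∞)
        fun q : ℝ × ℝ => (fun u => lower (1 / (2 * m + 3)) (F u)) q.1 q.2 :=
      contDiff_lower (Φ := F) _ hF
    have h1 := (ih hL (fun u r h => lower_support hB _ u r h)).const_smul
      ((2 * m + 3) / (2 * m + 2) : ℝ)
    have h2 := (tendsto_boundary t m hF hB).const_smul (1 / (2 * m + 2) : ℝ)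
    have h3 := h1.add h2
    simp only [smul_zero, add_zero] at h3
    refine h3.congr' ?_
    filter_upwards [self_mem_nhdsWithin] with ε hε
    rw [sourceIntegral_succ hε m (hF.of_le (by norm_cast; omega)) hB, descConst, smul_sub, smul_smul]
    simp only [desc]
    abel

end BoundaryTerm

/-! ### The Cauchy-Pompeiu formula in the plane -/

section CauchyPompeiu

variable {E : Type*} [NormedAddCommGroup E] [NormedSpace ℂ E]

/-- The Cauchy kernel in the coordinates `(u, r)`. -/
noncomputable def cauchyKernel (q : ℝ × ℝ) : ℂ := ((q.2 : ℂ) + q.1 * Complex.I)⁻¹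

theorem measurable_cauchyKernel : Measurable cauchyKernel := by
  unfold cauchyKernel
  have : Continuous fun q : ℝ × ℝ => ((q.2 : ℂ) + q.1 * Complex.I) := by fun_prop
  exact this.measurable.inv

theorem cauchyKernel_polar {p : ℝ × ℝ} (hp : 0 < p.1) :
    (p.1 : ℂ) * cauchyKernel (polarCoord.symm p)
      = -Complex.I * (Real.cos p.2 + Real.sin p.2 * Complex.I) := by
  have h1 : (p.1 : ℂ) ≠ 0 := by exact_mod_cast hp.ne'
  have h2 : ((Real.cos p.2 : ℝ) : ℂ) ^ 2 + ((Real.sin p.2 : ℝ) : ℂ) ^ 2 = 1 := by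
    exact_mod_cast Real.cos_sq_add_sin_sq p.2
  have h3 : (((p.1 * Real.sin p.2 : ℝ) : ℂ) + ((p.1 * Real.cos p.2 : ℝ) : ℂ) * Complex.I)
      * (-Complex.I * (Real.cos p.2 + Real.sin p.2 * Complex.I)) = p.1 := by
    push_cast at h2 ⊢
    linear_combination (p.1 : ℂ) * h2 + (-(p.1 : ℂ) * Complex.cos p.2 ^ 2
      - p.1 * Complex.sin p.2 ^ 2 - p.1 * Complex.sin p.2 * Complex.cos p.2 * Complex.I) * Complex.I_sq
  have h4 : (((p.1 * Real.sin p.2 : ℝ) : ℂ) + ((p.1 * Real.cos p.2 : ℝ) : ℂ) * Complex.I) ≠ 0 := by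
    intro h
    rw [h, zero_mul] at h3
    exact h1 h3.symm
  rw [cauchyKernel, polarCoord_symm_apply]
  rw [← div_eq_mul_inv, div_eq_iff h4, mul_comm, h3]

theorem norm_cauchyKernel_polar {p : ℝ × ℝ} (hp : 0 < p.1) :
    p.1 * ‖cauchyKernel (polarCoord.symm p)‖ = 1 := by
  have h := congrArg norm (cauchyKernel_polar hp)
  rw [norm_mul, Complex.norm_of_nonneg hp.le] at h
  rw [h, norm_mul, norm_neg, Complex.norm_I, one_mul, Complex.ofReal_cos, Complex.ofReal_sin,
    ← Complex.exp_mul_I, Complex.norm_exp_ofReal_mul_I]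

theorem polarCoord_symm_sq (p : ℝ × ℝ) :
    (polarCoord.symm p).1 ^ 2 + (polarCoord.symm p).2 ^ 2 = p.1 ^ 2 := by
  simp only [polarCoord_symm_apply]
  linear_combination p.1 ^ 2 * Real.cos_sq_add_sin_sq p.2

theorem integrableOn_polar_target {E : Type*} [NormedAddCommGroup E] {G : ℝ × ℝ → E}
    (hG : Continuous G) {B : ℝ} (hB : ∀ p : ℝ × ℝ, B < p.1 ^ 2 → G p = 0) :
    IntegrableOn G (Ioi (0 : ℝ) ×ˢ Ioo (-Real.pi) Real.pi) := by
  have h1 : IntegrableOn G (Icc 0 (|B| + 1) ×ˢ Icc (-Real.pi) Real.pi) :=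
    hG.continuousOn.integrableOn_compact (isCompact_Icc.prod isCompact_Icc)
  refine h1.of_forall_sdiff_eq_zero (measurableSet_Ioi.prod measurableSet_Ioo) ?_
  rintro ⟨ρ, θ⟩ ⟨⟨h2, h3⟩, h4⟩
  refine hB _ ?_
  have h2' : 0 < ρ := h2
  -- `B` bounds the square of the radius and may have either sign; beyond `|B| + 1` the square
  -- certainly exceeds `B`.
  have : |B| + 1 < ρ := by
    by_contra h
    exact h4 ⟨⟨h2'.le, not_lt.1 h⟩, ⟨h3.1.le, h3.2.le⟩⟩
  have hb := le_abs_self B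
  have hb' := abs_nonneg B
  simp only
  nlinarith

/-- The Jacobian `ρ` of polar coordinates cancels the modulus of the kernel exactly. -/
theorem integrable_cauchyKernel_smul {G : ℝ × ℝ → E}
    (hG : Continuous G) {B : ℝ} (hB : ∀ q : ℝ × ℝ, B < q.1 ^ 2 + q.2 ^ 2 → G q = 0) :
    Integrable fun q => cauchyKernel q • G q := by
  refine ⟨measurable_cauchyKernel.aestronglyMeasurable.smul hG.aestronglyMeasurable, ?_⟩
  have hpc : Continuous fun p : ℝ × ℝ => G (polarCoord.symm p) := hG.comp continuous_polarCoord_symm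
  have h := integrableOn_polar_target (B := B) hpc
    (fun p hp => hB _ (by rwa [polarCoord_symm_sq]))
  rw [HasFiniteIntegral, ← lintegral_comp_polarCoord_symm]
  refine lt_of_le_of_lt (le_of_eq ?_) h.2
  refine setLIntegral_congr_fun polarCoord.open_target.measurableSet fun p hp => ?_
  have hp0 : 0 < p.1 := hp.1
  simp only [enorm_smul, smul_eq_mul]
  rw [← mul_assoc, ← ofReal_norm (cauchyKernel _), ← ENNReal.ofReal_mul hp0.le,
    norm_cauchyKernel_polar hp0, ENNReal.ofReal_one, one_mul]

theorem hasDerivAt_polar_radius {ψ : ℝ × ℝ → E} (hψ : ContDiff ℝ 1 ψ) (ρ θ : ℝ) :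
    HasDerivAt (fun ρ => ψ (polarCoord.symm (ρ, θ)))
      (Real.cos θ • fderiv ℝ ψ (polarCoord.symm (ρ, θ)) (1, 0)
        + Real.sin θ • fderiv ℝ ψ (polarCoord.symm (ρ, θ)) (0, 1)) ρ := by
  have h1 : HasDerivAt (fun ρ : ℝ => polarCoord.symm (ρ, θ)) (Real.cos θ, Real.sin θ) ρ := by
    simp only [polarCoord_symm_apply]
    have a := (hasDerivAt_id ρ).mul_const (Real.cos θ)
    have b := (hasDerivAt_id ρ).mul_const (Real.sin θ)
    simp only [one_mul, id] at a b
    exact a.prodMk b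
  refine ((hψ.differentiable (by norm_num) _).hasFDerivAt.comp_hasDerivAt ρ h1).congr_deriv ?_
  rw [← map_smul, ← map_smul, ← map_add]
  simp

theorem hasDerivAt_polar_angle {ψ : ℝ × ℝ → E} (hψ : ContDiff ℝ 1 ψ) (ρ θ : ℝ) :
    HasDerivAt (fun θ => ψ (polarCoord.symm (ρ, θ)))
      (-ρ • (Real.sin θ • fderiv ℝ ψ (polarCoord.symm (ρ, θ)) (1, 0)
        - Real.cos θ • fderiv ℝ ψ (polarCoord.symm (ρ, θ)) (0, 1))) θ := by
  have h1 : HasDerivAt (fun θ : ℝ => polarCoord.symm (ρ, θ)) (ρ * -Real.sin θ, ρ * Real.cos θ) θ := by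
    simp only [polarCoord_symm_apply]
    exact ((Real.hasDerivAt_cos θ).const_mul ρ).prodMk ((Real.hasDerivAt_sin θ).const_mul ρ)
  refine ((hψ.differentiable (by norm_num) _).hasFDerivAt.comp_hasDerivAt θ h1).congr_deriv ?_
  rw [← map_smul, ← map_smul, ← map_sub, ← map_smul]
  simp

theorem fderiv_sq_support {ψ : ℝ × ℝ → E} {B : ℝ}
    (hB : ∀ q : ℝ × ℝ, B < q.1 ^ 2 + q.2 ^ 2 → ψ q = 0) (q : ℝ × ℝ)
    (hq : B < q.1 ^ 2 + q.2 ^ 2) : fderiv ℝ ψ q = 0 := by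
  have h1 : ψ =ᶠ[𝓝 q] fun _ => 0 := by
    filter_upwards [(isOpen_lt (continuous_const (y := B))
      (by fun_prop : Continuous fun q : ℝ × ℝ => q.1 ^ 2 + q.2 ^ 2)).mem_nhds hq] with s hs
    exact hB s hs
  rw [h1.fderiv_eq]
  simp

/-- In polar coordinates the Jacobian times the kernel is `-i e^{iθ}`, and the integrand becomes `P
+ i Q`, where `P` is the radial derivative of `ψ` and `-ρ Q` the angular one. The angular part
integrates to zero by periodicity, and the radial part gives `-ψ 0` on each of the rays. -/
theorem integral_cauchyKernel_smul [CompleteSpace E] {ψ : ℝ × ℝ → E} (hψ : ContDiff ℝ 1 ψ) {B : ℝ}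
    (hB : ∀ q : ℝ × ℝ, B < q.1 ^ 2 + q.2 ^ 2 → ψ q = 0) :
    ∫ q, cauchyKernel q • (fderiv ℝ ψ q (0, 1) + Complex.I • fderiv ℝ ψ q (1, 0))
      = -(2 * Real.pi) • ψ 0 := by
  have hc : Continuous (fderiv ℝ ψ) := hψ.continuous_fderiv (by norm_num)
  have hcp : Continuous fun p : ℝ × ℝ => fderiv ℝ ψ (polarCoord.symm p) :=
    hc.comp continuous_polarCoord_symm
  have hsupp : ∀ p : ℝ × ℝ, B < p.1 ^ 2 → fderiv ℝ ψ (polarCoord.symm p) = 0 := fun p hp =>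
    fderiv_sq_support hB _ (by rwa [polarCoord_symm_sq])
  let P : ℝ × ℝ → E := fun p => Real.cos p.2 • fderiv ℝ ψ (polarCoord.symm p) (1, 0)
    + Real.sin p.2 • fderiv ℝ ψ (polarCoord.symm p) (0, 1)
  let Q : ℝ × ℝ → E := fun p => Real.sin p.2 • fderiv ℝ ψ (polarCoord.symm p) (1, 0)
    - Real.cos p.2 • fderiv ℝ ψ (polarCoord.symm p) (0, 1)
  have hP : Continuous P := by fun_prop
  have hQ : Continuous Q := by fun_prop
  have iP := integrableOn_polar_target hP (B := B) fun p hp => by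
    simp only [P, hsupp p hp, zero_apply, smul_zero, add_zero]
  have iQ := integrableOn_polar_target hQ (B := B) fun p hp => by
    simp only [Q, hsupp p hp, zero_apply, smul_zero, sub_zero]
  have iQ' : IntegrableOn (fun p => Complex.I • Q p) (Ioi (0 : ℝ) ×ˢ Ioo (-Real.pi) Real.pi) :=
    iQ.smul Complex.I
  rw [← integral_comp_polarCoord_symm, polarCoord_target]
  have hEq : ∀ p ∈ Ioi (0 : ℝ) ×ˢ Ioo (-Real.pi) Real.pi,
      p.1 • cauchyKernel (polarCoord.symm p) • (fderiv ℝ ψ (polarCoord.symm p) (0, 1)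
        + Complex.I • fderiv ℝ ψ (polarCoord.symm p) (1, 0)) = P p + Complex.I • Q p := by
    intro p hp
    have hp0 : 0 < p.1 := hp.1
    rw [← Complex.coe_smul, smul_smul, cauchyKernel_polar hp0]
    simp only [P, Q, ← Complex.coe_smul]
    have hI := Complex.I_sq
    match_scalars
    · linear_combination (-(Complex.sin p.2)) * hI
    · linear_combination (-(Complex.cos p.2) - Complex.sin p.2 * Complex.I) * hI
  rw [setIntegral_congr_fun (measurableSet_Ioi.prod measurableSet_Ioo) hEq, integral_add iP iQ',
    integral_smul]
  rw [Measure.volume_eq_prod] at iP iQ ⊢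
  have hQ0 : ∫ p in Ioi (0 : ℝ) ×ˢ Ioo (-Real.pi) Real.pi, Q p ∂(volume.prod volume) = 0 := by
    rw [setIntegral_prod _ iQ]
    refine setIntegral_eq_zero_of_forall_eq_zero fun ρ hρ => ?_
    have hρ0 : 0 < ρ := hρ
    rw [← integral_Ioc_eq_integral_Ioo, ← intervalIntegral.integral_of_le
      (by linarith [Real.pi_pos])]
    have h1 := intervalIntegral.integral_eq_sub_of_hasDerivAt (a := -Real.pi) (b := Real.pi)
      (fun θ _ => hasDerivAt_polar_angle hψ ρ θ)
      (Continuous.intervalIntegrable (by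
        have h := (hQ.comp (by fun_prop : Continuous fun θ : ℝ => (ρ, θ))).const_smul (-ρ)
        exact h) _ _)
    rw [intervalIntegral.integral_smul] at h1
    have h2 : ψ (polarCoord.symm (ρ, Real.pi)) - ψ (polarCoord.symm (ρ, -Real.pi)) = 0 := by
      simp [polarCoord_symm_apply]
    rw [h2] at h1
    exact (smul_eq_zero.1 h1).resolve_left (neg_ne_zero.2 hρ0.ne')
  have hP0 : ∫ p in Ioi (0 : ℝ) ×ˢ Ioo (-Real.pi) Real.pi, P p ∂(volume.prod volume)
      = -(2 * Real.pi) • ψ 0 := by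
    rw [← setIntegral_prod_swap, setIntegral_prod]
    · have h1 : ∀ θ, ∫ ρ in Ioi (0 : ℝ), P (Prod.swap (θ, ρ)) = - ψ 0 := by
        intro θ
        have hlim : Tendsto (fun ρ => ψ (polarCoord.symm (ρ, θ))) atTop (𝓝 0) := by
          refine tendsto_const_nhds.congr' ?_
          filter_upwards [eventually_gt_atTop (|B| + 1)] with ρ hρ
          refine (hB _ ?_).symm
          rw [polarCoord_symm_sq]
          have hb := le_abs_self B
          have hb' := abs_nonneg B
          simp only
          nlinarith
        have := integral_Ioi_of_hasDerivAt_of_tendsto' (a := 0)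
          (fun ρ _ => hasDerivAt_polar_radius hψ ρ θ) ?_ hlim
        · rw [show - ψ 0 = 0 - ψ (polarCoord.symm (0, θ)) by
            simp [polarCoord_symm_apply, Prod.mk_zero_zero], ← this]
          rfl
        · have h1 : IntegrableOn (fun ρ => P (ρ, θ)) (Icc 0 (|B| + 1)) :=
            (hP.comp (by fun_prop : Continuous fun ρ : ℝ => (ρ, θ))).continuousOn.integrableOn_Icc
          refine h1.of_forall_sdiff_eq_zero measurableSet_Ioi ?_
          rintro ρ ⟨h2, h4⟩
          have h2' : 0 < ρ := h2
          have h5 : |B| + 1 < ρ := by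
            by_contra h
            exact h4 ⟨h2'.le, not_lt.1 h⟩
          have hb := le_abs_self B
          have hb' := abs_nonneg B
          simp only [P, hsupp (ρ, θ) (by simp only; nlinarith), zero_apply, smul_zero, add_zero]
      simp_rw [h1]
      simp only [integral_const, MeasurableSet.univ, measureReal_restrict_apply, univ_inter,
        Real.volume_real_Ioo_of_le (by linarith [Real.pi_pos] : -Real.pi ≤ Real.pi), smul_neg]
      rw [← neg_smul]
      congr 1
      ring
    · exact iP.swap
  rw [hQ0, hP0, smul_zero, add_zero]

end CauchyPompeiu

/-! ### The limit of the source integrals -/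

section SourceLimit

variable {E : Type*} [NormedAddCommGroup E] [NormedSpace ℂ E]

theorem ae_fst_ne_zero : ∀ᵐ q : ℝ × ℝ, q.1 ≠ 0 := by
  have h0 : ∀ᵐ u : ℝ, u ≠ 0 := by simp [ae_iff, measure_singleton]
  rw [Measure.volume_eq_prod]
  exact Measure.quasiMeasurePreserving_fst.ae h0

theorem sqLength_ne_zero_of_ne {t u r : ℝ} (hu : u ≠ 0) : sqLength t u r ≠ 0 := by
  -- The spheroid with `ε = |u|` just reaches the height `u`, with radius `0` there, so no condition
  -- on `r` remains.
  have h1 : spheroidRadius t |u| u ≤ |r| := by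
    rw [spheroidRadius_eq_zero (abs_pos.2 hu) le_rfl]; exact abs_nonneg r
  have h2 := sqLength_ne_zero (abs_pos.2 hu) h1
  have h3 : ((|r| : ℝ) : ℂ) ^ 2 = (r : ℂ) ^ 2 := by exact_mod_cast sq_abs r
  rwa [sqLength, h3] at h2

/-- The integrand of the limit of the source integrals. -/
noncomputable def limitIntegrand (t : ℝ) (F : ℝ → ℝ → E) (q : ℝ × ℝ) : E :=
  cauchyKernel (q.1, q.2 + t) • q.2 • F q.1 q.2

/-- The square of the length is `r² - (t + i u)²`, and partial fractions split `r² / (r² - a²)` into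
`(r / 2) (1 / (r + a) + 1 / (r - a))`. Since `F` is even, the second term is the first one reflected
in `r`. -/
theorem sourceIntegrand_one {t : ℝ} {F : ℝ → ℝ → E} (hev : ∀ u r, F u (-r) = F u r) {q : ℝ × ℝ}
    (hq : q.1 ≠ 0) : sourceIntegrand t 1 F q
      = (1 / 2 : ℝ) • (limitIntegrand t F q + limitIntegrand t F (q.1, -q.2)) := by
  have hσ : sqLength t q.1 q.2
      = (((q.2 + t : ℝ) : ℂ) + q.1 * Complex.I) * ((q.2 : ℂ) - t - q.1 * Complex.I) := by
    rw [sqLength]; push_cast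
    linear_combination (q.1 ^ 2 + t ^ 2 : ℂ) * Complex.I_sq
  have h0 := sqLength_ne_zero_of_ne (t := t) (r := q.2) hq
  rw [hσ] at h0
  have h1 := left_ne_zero_of_mul h0
  have h2 := right_ne_zero_of_mul h0
  have h3 : (((-q.2 + t : ℝ) : ℂ) + q.1 * Complex.I) = -((q.2 : ℂ) - t - q.1 * Complex.I) := by
    push_cast; ring
  simp only [sourceIntegrand, limitIntegrand, cauchyKernel, hσ, hev, h3]
  simp only [← Complex.coe_smul, smul_smul, ← add_smul]
  congr 1
  rw [pow_one, mul_one]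
  set a := (((q.2 + t : ℝ) : ℂ) + q.1 * Complex.I) with ha
  set b := ((q.2 : ℂ) - t - q.1 * Complex.I) with hb
  have hab : (q.2 : ℂ) = (a + b) / 2 := by rw [ha, hb]; push_cast; ring
  push_cast
  rw [hab]
  field_simp
  ring

theorem integrable_limitIntegrand {t : ℝ} {F : ℝ → ℝ → E}
    (hF : Continuous fun q : ℝ × ℝ => F q.1 q.2)
    {B : ℝ} (hB : ∀ u r, B < |u| ∨ B < |r| → F u r = 0) : Integrable (limitIntegrand t F) := by
  have hG : Continuous fun q : ℝ × ℝ => (q.2 - t) • F q.1 (q.2 - t) :=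
    (by fun_prop : Continuous fun q : ℝ × ℝ => q.2 - t).smul
      (hF.comp (by fun_prop : Continuous fun q : ℝ × ℝ => (q.1, q.2 - t)))
  have h := integrable_cauchyKernel_smul hG (B := (|B| + |t|) ^ 2 + (|B| + |t|) ^ 2) (by
    intro q hq
    rw [hB q.1 (q.2 - t), smul_zero]
    by_contra h
    push Not at h
    have hb := le_abs_self B
    have h1 : |q.1| ≤ |B| + |t| := (h.1.trans hb).trans (by linarith [abs_nonneg t])
    have h2 : |q.2| ≤ |B| + |t| := by
      have := abs_sub_abs_le_abs_sub q.2 t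
      linarith [h.2]
    have h3 := pow_le_pow_left₀ (abs_nonneg _) h1 2
    have h4 := pow_le_pow_left₀ (abs_nonneg _) h2 2
    rw [sq_abs q.1] at h3
    rw [sq_abs q.2] at h4
    linarith)
  have h2 := h.comp_add_right ((0 : ℝ), t)
  refine h2.congr (ae_of_all _ fun q => ?_)
  have hq : q + ((0 : ℝ), t) = (q.1, q.2 + t) := Prod.ext (by simp) (by simp)
  simp [limitIntegrand, hq]

/-- The reflection `(u, r) ↦ (u, -r)`. -/
def reflect : ℝ × ℝ ≃ᵐ ℝ × ℝ := (MeasurableEquiv.refl ℝ).prodCongr (MeasurableEquiv.neg ℝ)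

theorem measurePreserving_reflect : MeasurePreserving reflect := by
  have := (MeasurePreserving.id (volume : Measure ℝ)).prod
    (Measure.measurePreserving_neg (volume : Measure ℝ))
  exact this

theorem reflect_apply (q : ℝ × ℝ) : reflect q = (q.1, -q.2) := rfl

theorem setIntegral_reflect_add {A : ℝ × ℝ → E} (hA : Integrable A) :
    ∫ q in {q : ℝ × ℝ | 0 < q.2}, (A q + A (reflect q)) = ∫ q, A q := by
  have hA' : Integrable fun q => A (reflect q) :=
    measurePreserving_reflect.integrable_comp_emb reflect.measurableEmbedding |>.2 hA
  rw [integral_add hA.integrableOn hA'.integrableOn]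
  have h1 := measurePreserving_reflect.setIntegral_preimage_emb reflect.measurableEmbedding A
    {q : ℝ × ℝ | q.2 < 0}
  have h2 : reflect ⁻¹' {q : ℝ × ℝ | q.2 < 0} = {q : ℝ × ℝ | 0 < q.2} := by
    ext q; simp [reflect_apply]
  have h3 : {q : ℝ × ℝ | q.2 < 0} =ᵐ[volume] {q : ℝ × ℝ | 0 < q.2}ᶜ := by
    have h0 : ∀ᵐ u : ℝ, u ≠ 0 := by simp [ae_iff, measure_singleton]
    have h4 : ∀ᵐ q : ℝ × ℝ, q.2 ≠ 0 := by
      rw [Measure.volume_eq_prod]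
      exact Measure.quasiMeasurePreserving_snd.ae h0
    filter_upwards [h4] with q hq
    refine propext ⟨fun h => not_lt.2 (le_of_lt h), fun h => lt_of_le_of_ne (not_lt.1 h) hq⟩
  rw [h2] at h1
  rw [h1, setIntegral_congr_set h3]
  exact integral_add_compl (measurableSet_lt measurable_const measurable_snd) hA

/-- For `u ≠ 0` the spheroid no longer reaches height `u` once `ε < |u|`, so the indicators are
eventually constant. The dominating function is integrable because the Cauchy kernel is, and
reflection unfolds the half-plane `r > 0` to the plane. -/
theorem tendsto_sourceIntegral_one {t : ℝ} {F : ℝ → ℝ → E}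
    (hF : Continuous fun q : ℝ × ℝ => F q.1 q.2) (hev : ∀ u r, F u (-r) = F u r)
    {B : ℝ} (hB : ∀ u r, B < |u| ∨ B < |r| → F u r = 0) :
    Tendsto (fun ε : ℝ => sourceIntegral t ε 1 F) (𝓝[>] 0)
      (𝓝 ((1 / 2 : ℝ) • ∫ q, limitIntegrand t F q)) := by
  have hA := integrable_limitIntegrand (t := t) hF hB
  have hA' : Integrable fun q => limitIntegrand t F (reflect q) :=
    measurePreserving_reflect.integrable_comp_emb reflect.measurableEmbedding |>.2 hA
  set S : ℝ × ℝ → E := fun q => (1 / 2 : ℝ) • (limitIntegrand t F q + limitIntegrand t F (reflect q))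
    with hS
  have hSint : Integrable S := (hA.add hA').smul (1 / 2 : ℝ)
  have hsrc : ∀ q : ℝ × ℝ, q.1 ≠ 0 → sourceIntegrand t 1 F q = S q := fun q hq =>
    sourceIntegrand_one hev hq
  have hpos : MeasurableSet {q : ℝ × ℝ | 0 < q.2} := measurableSet_lt measurable_const measurable_snd
  have hval : (1 / 2 : ℝ) • ∫ q, limitIntegrand t F q
      = ∫ q, {q : ℝ × ℝ | 0 < q.2}.indicator S q := by
    rw [integral_indicator hpos, ← setIntegral_reflect_add hA, ← integral_smul]
  rw [hval]
  have hform : ∀ ε, sourceIntegral t ε 1 F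
      = ∫ q, (exterior t ε).indicator (sourceIntegrand t 1 F) q := fun ε =>
    (integral_indicator (measurableSet_exterior t ε)).symm
  simp_rw [hform]
  refine tendsto_integral_filter_of_dominated_convergence (fun q => ‖S q‖) ?_ ?_ hSint.norm ?_
  · filter_upwards [self_mem_nhdsWithin] with ε hε
    exact ((integrable_indicator_iff (measurableSet_exterior t ε)).2
      (integrableOn_sourceIntegrand hε 1 hF hB)).aestronglyMeasurable
  · refine Eventually.of_forall fun ε => ?_
    filter_upwards [ae_fst_ne_zero] with q hq
    rw [← hsrc q hq]
    exact norm_indicator_le_norm_self _ _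
  · filter_upwards [ae_fst_ne_zero] with q hq
    refine tendsto_const_nhds.congr' ?_
    have h1 : ∀ᶠ ε : ℝ in 𝓝[>] 0, ε ∈ Ioo 0 |q.1| := Ioo_mem_nhdsGT (abs_pos.2 hq)
    filter_upwards [h1] with ε hε
    have h2 : q ∈ exterior t ε ↔ 0 < q.2 := by
      rw [exterior, mem_ofPred_eq, spheroidRadius_eq_zero hε.1 hε.2.le]
    by_cases h : 0 < q.2
    · rw [indicator_of_mem (h2.2 h), indicator_of_mem (show q ∈ {q : ℝ × ℝ | 0 < q.2} from h),
        hsrc q hq]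
    · rw [indicator_of_notMem (fun h' => h (h2.1 h')),
        indicator_of_notMem (show q ∉ {q : ℝ × ℝ | 0 < q.2} from h)]

/-- The pole of the kernel sits at `(0, -t)`; translating it to the origin reduces this to
`integral_cauchyKernel_smul`. -/
theorem integral_limitIntegrand [CompleteSpace E] {t : ℝ} {F : ℝ → ℝ → E} {ψ : ℝ × ℝ → E}
    (hψ : ContDiff ℝ 1 ψ) {B : ℝ} (hB : ∀ q : ℝ × ℝ, B < |q.1| ∨ B < |q.2| → ψ q = 0)
    (hFψ : ∀ u r, r • F u r = fderiv ℝ ψ (u, r) (0, 1) + Complex.I • fderiv ℝ ψ (u, r) (1, 0)) :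
    ∫ q, limitIntegrand t F q = -(2 * Real.pi) • ψ (0, -t) := by
  have htr : ContDiff ℝ 1 fun q : ℝ × ℝ => ψ (q + (0, -t)) := hψ.comp (by fun_prop)
  have hsupp : ∀ q : ℝ × ℝ, (|B| + |t|) ^ 2 + (|B| + |t|) ^ 2 < q.1 ^ 2 + q.2 ^ 2 →
      ψ (q + (0, -t)) = 0 := by
    intro q hq
    refine hB _ ?_
    simp only [Prod.fst_add, Prod.snd_add, add_zero]
    by_contra h
    push Not at h
    have hb := le_abs_self B
    have h1 : |q.1| ≤ |B| + |t| := (h.1.trans hb).trans (by linarith [abs_nonneg t])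
    have h2 : |q.2| ≤ |B| + |t| := by
      have := abs_sub_abs_le_abs_sub q.2 t
      have h5 := h.2
      rw [← sub_eq_add_neg] at h5
      linarith
    have h3 := pow_le_pow_left₀ (abs_nonneg _) h1 2
    have h4 := pow_le_pow_left₀ (abs_nonneg _) h2 2
    rw [sq_abs q.1] at h3
    rw [sq_abs q.2] at h4
    linarith
  have h := integral_cauchyKernel_smul htr hsupp
  simp only [fderiv_comp_add_right, zero_add] at h
  rw [← h, ← integral_add_right_eq_self _ ((0 : ℝ), -t)]
  congr 1
  ext q
  have hq : ((q + ((0 : ℝ), -t)).1, (q + ((0 : ℝ), -t)).2 + t) = q :=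
    Prod.ext (by simp) (by simp)
  rw [limitIntegrand, hFψ, hq]

theorem tendsto_sourceIntegral [CompleteSpace E] {t : ℝ} {m : ℕ} {F : ℝ → ℝ → E}
    (hF : ContDiff ℝ (m : WithTop ℕ∞) fun q : ℝ × ℝ => F q.1 q.2)
    (hev : ∀ u r, F u (-r) = F u r) {B : ℝ} (hB : ∀ u r, B < |u| ∨ B < |r| → F u r = 0)
    {ψ : ℝ × ℝ → E} (hψ : ContDiff ℝ 1 ψ) (hBψ : ∀ q : ℝ × ℝ, B < |q.1| ∨ B < |q.2| → ψ q = 0)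
    (hFψ : ∀ u r, r • desc m (F u) r
      = fderiv ℝ ψ (u, r) (0, 1) + Complex.I • fderiv ℝ ψ (u, r) (1, 0)) :
    Tendsto (fun ε : ℝ => sourceIntegral t ε (m + 1) F) (𝓝[>] 0)
      (𝓝 (-(descConst m * Real.pi) • ψ (0, -t))) := by
  have hdB : ∀ (m : ℕ) {F : ℝ → ℝ → E}, (∀ u r, B < |u| ∨ B < |r| → F u r = 0) →
      ∀ u r, B < |u| ∨ B < |r| → desc m (F u) r = 0 := by
    intro m
    induction m with
    | zero => exact fun h => h
    | succ m ih => exact fun h => ih (fun u r h' => lower_support h _ u r h')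
  have hdc : Continuous fun q : ℝ × ℝ => desc m (F q.1) q.2 := (contDiff_desc (l := 0) m hF).continuous
  have h1 := (tendsto_sourceIntegral_one (t := t) (F := fun u => desc m (F u)) hdc
    (fun u r => desc_even m (hev u) r) (hdB m hB)).const_smul (descConst m)
  have h2 := (tendsto_sourceIntegral_sub t m hF hB).add h1
  rw [integral_limitIntegrand hψ hBψ hFψ, zero_add] at h2
  simp only [sub_add_cancel] at h2
  convert h2 using 2
  rw [smul_smul, smul_smul]
  congr 1
  ring

end SourceLimit

/-! ### The regularized potential in cylindrical coordinates -/

section Potential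

theorem complexLength_sq {N : ℕ} (z : Fin N → ℂ) : complexLength z ^ 2 = ∑ i, z i ^ 2 := by
  rw [complexLength, one_div]
  exact Complex.cpow_ofNat_inv_pow _ 2

/-- The real part of `√w` is `√((|w| + Re w) / 2)`. Squaring twice turns the condition into the
inequality for the exterior of the spheroid with semiaxes `√(ε² + t²)` and `ε`. -/
theorem lt_re_complexLength_iff {N : ℕ} {z : Fin N → ℂ} {ε t u r : ℝ} (hε : 0 < ε) (hr : 0 < r)
    (hz : ∑ i, z i ^ 2 = sqLength t u r) :
    ε < (complexLength z).re ↔ spheroidRadius t ε u < r := by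
  rw [complexLength, one_div, Complex.cpow_inv_two_re, hz, Real.lt_sqrt hε.le, spheroidRadius,
    Real.sqrt_lt' hr, sqLength_re]
  have h1 : ‖sqLength t u r‖ ^ 2 = (r ^ 2 + u ^ 2 - t ^ 2) ^ 2 + (2 * t * u) ^ 2 := by
    rw [Complex.sq_norm, Complex.normSq_apply, sqLength_re, sqLength_im]; ring
  have h0 := norm_nonneg (sqLength t u r)
  set L := ‖sqLength t u r‖
  have h2 : (ε ^ 2 + t ^ 2) * (1 - (u / ε) ^ 2) < r ^ 2
      ↔ ε ^ 2 * (ε ^ 2 - (r ^ 2 + u ^ 2 - t ^ 2)) < (t * u) ^ 2 := by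
    have : (t * u) ^ 2 - ε ^ 2 * (ε ^ 2 - (r ^ 2 + u ^ 2 - t ^ 2))
        = ε ^ 2 * (r ^ 2 - (ε ^ 2 + t ^ 2) * (1 - (u / ε) ^ 2)) := by
      field_simp; ring
    rw [← sub_pos, ← sub_pos (a := (t * u) ^ 2), this, mul_pos_iff_of_pos_left (by positivity)]
  rw [h2]
  set A := r ^ 2 + u ^ 2 - t ^ 2
  constructor
  · intro h
    by_contra hc
    push Not at hc
    have h3 : L ^ 2 ≤ (2 * ε ^ 2 - A) ^ 2 := by rw [h1]; nlinarith
    -- The sign needed to undo the second squaring; it comes from the negated inequality, whose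
    -- smaller side is a square.
    have h4 : 0 ≤ 2 * ε ^ 2 - A := by
      have : 0 ≤ ε ^ 2 - A := by
        by_contra h5
        push Not at h5
        nlinarith [sq_nonneg (t * u), sq_pos_of_pos hε]
      nlinarith [sq_nonneg ε]
    have := (sq_le_sq₀ h0 h4).1 h3
    linarith
  · intro h
    have h3 : (2 * ε ^ 2 - A) ^ 2 < L ^ 2 := by rw [h1]; nlinarith
    have := lt_of_pow_lt_pow_left₀ 2 h0 h3
    linarith

/-- In even dimension only integer powers of `γ²` occur, so the branch of the root matters for the
cutoff alone. -/
theorem holPotential_eq {N k : ℕ} (hN : N = 2 * k + 2) (z : Fin N → ℂ) :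
    holPotential z = ((sphereArea N : ℂ) * (-(2 * k)))⁻¹ * ((∑ i, z i ^ 2) ^ k)⁻¹ := by
  subst hN
  have h1 : (2 : ℤ) - ((2 * k + 2 : ℕ) : ℤ) = -((2 * k : ℕ) : ℤ) := by push_cast; ring
  rw [holPotential, h1, zpow_neg, zpow_natCast, pow_mul, complexLength_sq,
    div_eq_inv_mul]
  congr 3
  push_cast; ring

theorem measurable_complexLength {N : ℕ} : Measurable (complexLength : (Fin N → ℂ) → ℂ) := by
  unfold complexLength
  exact (Finset.measurable_sum _ fun i _ => (measurable_pi_apply i).pow_const 2).pow_const _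

theorem measurable_regPotential {N : ℕ} (ε : ℝ) :
    Measurable (regPotential ε : (Fin N → ℂ) → ℂ) := by
  refine Measurable.ite (measurableSet_lt measurable_const
    (Complex.measurable_re.comp measurable_complexLength)) ?_ measurable_const
  unfold holPotential
  exact Measurable.div_const (measurable_complexLength.pow_const _) _

theorem exists_norm_regPotential_le {N k : ℕ} (hN : N = 2 * k + 2) {ε : ℝ} (hε : 0 < ε) :
    ∃ C, ∀ z : Fin N → ℂ, ‖regPotential ε z‖ ≤ C := by
  refine ⟨‖((sphereArea N : ℂ) * (-(2 * k)))⁻¹‖ * (ε ^ (2 * k))⁻¹, fun z => ?_⟩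
  rw [regPotential]
  split_ifs with h
  · rw [holPotential_eq hN, norm_mul, norm_inv (_ ^ k), ← complexLength_sq, ← pow_mul, norm_pow]
    gcongr
    exact h.le.trans (Complex.re_le_norm _)
  · rw [norm_zero]; positivity

end Potential

/-! ### Polar and cylindrical coordinates -/

section Coordinates

/-- The measurable equivalence `(s, x) ↦ realPoint x s`. -/
noncomputable def realPointEquiv (n : ℕ) : ℝ × Euc n ≃ᵐ Euc (n + 1) :=
  ((MeasurableEquiv.refl ℝ).prodCongr (MeasurableEquiv.toLp 2 (Fin n → ℝ)).symm).trans
    ((MeasurableEquiv.piFinSuccAbove (fun _ : Fin (n + 1) => ℝ) 0).symm.trans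
      (MeasurableEquiv.toLp 2 (Fin (n + 1) → ℝ)))

theorem realPointEquiv_apply (n : ℕ) (q : ℝ × Euc n) : realPointEquiv n q = realPoint q.2 q.1 := by
  ext i
  refine Fin.cases ?_ (fun i => ?_) i <;>
    simp [realPointEquiv, realPoint, MeasurableEquiv.piFinSuccAbove, MeasurableEquiv.prodCongr]

theorem measurePreserving_realPointEquiv (n : ℕ) : MeasurePreserving (realPointEquiv n) := by
  have h1 : MeasurePreserving (Prod.map (id : ℝ → ℝ) (WithLp.ofLp : Euc n → Fin n → ℝ)) :=
    (MeasurePreserving.id (volume : Measure ℝ)).prod (PiLp.volume_preserving_ofLp (Fin n))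
  have h2 := (volume_preserving_piFinSuccAbove (fun _ : Fin (n + 1) => ℝ) 0).symm
  exact (PiLp.volume_preserving_toLp (Fin (n + 1))).comp (h2.comp h1)

variable {E : Type*} [NormedAddCommGroup E] [NormedSpace ℝ E]

theorem integral_eq_integral_polar {n : ℕ} {G : Euc (n + 1) → E} (hG : Integrable G) :
    ∫ w, G w = ∫ r in Ioi (0 : ℝ), r ^ n • ∫ θ : Metric.sphere (0 : Euc (n + 1)) 1, G (r • θ.1)
      ∂sphereMeasure (n + 1) := by
  have hmp := (volume : Measure (Euc (n + 1))).measurePreserving_homeomorphUnitSphereProd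
  have hem := (homeomorphUnitSphereProd (Euc (n + 1))).measurableEmbedding
  let G' : Metric.sphere (0 : Euc (n + 1)) 1 × Ioi (0 : ℝ) → E := fun q => G (q.2.1 • q.1.1)
  have hcomp : ∀ x, G' (homeomorphUnitSphereProd (Euc (n + 1)) x) = G x := fun x => by
    have := congrArg Subtype.val ((homeomorphUnitSphereProd (Euc (n + 1))).symm_apply_apply x)
    rw [homeomorphUnitSphereProd_symm_apply_coe] at this
    simp only [G', this]
  have hdim : Module.finrank ℝ (Euc (n + 1)) - 1 = n := by simp
  rw [hdim] at hmp
  have hint : Integrable G' ((volume : Measure (Euc (n + 1))).toSphere.prod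
      (Measure.volumeIoiPow n)) := by
    rw [← hmp.integrable_comp_emb hem]
    simp only [Function.comp_def, hcomp]
    rw [← Function.comp_def G, ← integrableOn_iff_comap_subtypeVal
      (measurableSet_singleton _).compl]
    exact hG.integrableOn
  calc ∫ w, G w = ∫ x : ({(0)}ᶜ : Set (Euc (n + 1))), G x.1 ∂(volume.comap Subtype.val) := by
        rw [integral_subtype_comap (measurableSet_singleton _).compl fun x => G x,
          restrict_compl_singleton]
    _ = ∫ q, G' q ∂((volume : Measure (Euc (n + 1))).toSphere.prod (Measure.volumeIoiPow n)) := by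
        rw [← hmp.integral_comp hem]; simp only [hcomp]
    _ = ∫ r : Ioi (0 : ℝ), ∫ θ : Metric.sphere (0 : Euc (n + 1)) 1, G (r.1 • θ.1)
          ∂sphereMeasure (n + 1) ∂Measure.volumeIoiPow n := integral_prod_symm _ hint
    _ = _ := by
        simp only [Measure.volumeIoiPow, ENNReal.ofReal]
        rw [integral_withDensity_eq_integral_smul,
          integral_subtype_comap measurableSet_Ioi fun a : ℝ => Real.toNNReal (a ^ n) •
            ∫ θ : Metric.sphere (0 : Euc (n + 1)) 1, G (a • θ.1) ∂sphereMeasure (n + 1),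
          setIntegral_congr_fun measurableSet_Ioi fun x hx => ?_]
        · simp only [NNReal.smul_def, Real.coe_toNNReal _ (pow_nonneg (le_of_lt (mem_Ioi.1 hx)) _)]
        · exact (measurable_subtype_coe.pow_const _).real_toNNReal

/-- Fubini splits off the coordinate of index `0`, and polar coordinates are used in the remaining
`n = m + 1` dimensions on almost every slice. -/
theorem integral_eq_integral_cylindrical {n m : ℕ} (hn : n = m + 1) {H : Euc (n + 1) → E}
    (hH : Integrable H) :
    ∫ X, H X = ∫ u : ℝ, ∫ r in Ioi (0 : ℝ), r ^ m • ∫ θ : Metric.sphere (0 : Euc n) 1,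
      H (u • EuclideanSpace.single 0 1 + r • emb n θ) ∂sphereMeasure n := by
  subst hn
  have hmp := measurePreserving_realPointEquiv (m + 1)
  have hem := (realPointEquiv (m + 1)).measurableEmbedding
  have hint := (hmp.integrable_comp_emb hem).2 hH
  simp only [Function.comp_def, realPointEquiv_apply] at hint
  rw [← hmp.integral_comp hem]
  simp only [realPointEquiv_apply]
  rw [Measure.volume_eq_prod, integral_prod _ hint]
  refine integral_congr_ae ?_
  filter_upwards [hint.prod_right_ae] with u hu
  rw [integral_eq_integral_polar (G := fun w => H (realPoint w u)) hu]
  simp only [realPoint_eq, map_smul]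
  simp only [add_comm]

end Coordinates

/-! ### The regularized source as a planar integral -/

section RegSource

variable {n : ℕ} {E : Type*} [NormedAddCommGroup E] [NormedSpace ℂ E]

theorem imPart_spacetimePoint (x : Euc n) (s t : ℝ) :
    imPart (spacetimePoint x s t) = t • EuclideanSpace.single 0 1 := by
  ext i
  refine Fin.cases ?_ (fun i => ?_) i <;> simp [imPart, spacetimePoint, Fin.succ_ne_zero]

theorem rePart_spacetimePoint (x : Euc n) (s t : ℝ) :
    rePart (spacetimePoint x s t) = realPoint x s := by
  ext i
  refine Fin.cases ?_ (fun i => ?_) i <;> simp [rePart, spacetimePoint, realPoint]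

theorem sum_sq_cpoint (θ : Metric.sphere (0 : Euc n) 1) (u r t : ℝ) :
    ∑ i, cpoint (u • EuclideanSpace.single 0 1 + r • emb n θ)
      (-(t • EuclideanSpace.single 0 1)) i ^ 2 = sqLength t u r := by
  have h1 : ∑ i, (θ.1 i) ^ 2 = 1 := by
    have := EuclideanSpace.real_norm_sq_eq θ.1
    rw [norm_eq_of_mem_sphere] at this
    linarith
  have h2 : ∑ i, ((θ.1 i : ℝ) : ℂ) ^ 2 = 1 := by exact_mod_cast h1
  rw [Fin.sum_univ_succ]
  simp [cpoint, emb, realPoint, Fin.succ_ne_zero, mul_pow, ← Finset.mul_sum, h2, sqLength]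
  ring

theorem norm_sq_smul_add_smul_emb (θ : Metric.sphere (0 : Euc n) 1) (u r : ℝ) :
    ‖u • EuclideanSpace.single 0 1 + r • emb n θ‖ ^ 2 = u ^ 2 + r ^ 2 := by
  have h1 : ∑ i, (θ.1 i) ^ 2 = 1 := by
    have := EuclideanSpace.real_norm_sq_eq θ.1
    rw [norm_eq_of_mem_sphere] at this
    linarith
  rw [EuclideanSpace.real_norm_sq_eq, Fin.sum_univ_succ]
  simp [emb, realPoint, Fin.succ_ne_zero, mul_pow, ← Finset.mul_sum, h1]

theorem sphMean_eq_zero_of_lt {h : Euc (n + 1) → E} {B : ℝ}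
    (hB : ∀ X, B < ‖X‖ → h X = 0) {u r : ℝ} (hur : B < |u| ∨ B < |r|) :
    sphMean h (u • EuclideanSpace.single 0 1) r = 0 := by
  have : ∀ θ : Metric.sphere (0 : Euc n) 1,
      h (u • EuclideanSpace.single 0 1 + r • emb n θ) = 0 := fun θ => by
    refine hB _ ?_
    have h2 := norm_sq_smul_add_smul_emb θ u r
    rcases hur with h1 | h1
    · exact h1.trans_le (abs_le_of_sq_le_sq' (by nlinarith [sq_nonneg r]) (norm_nonneg _) |> abs_le.2)
    · exact h1.trans_le (abs_le_of_sq_le_sq' (by nlinarith [sq_nonneg u]) (norm_nonneg _) |> abs_le.2)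
  simp [sphMean, this]

theorem contDiff_sphMean_axis {h : Euc (n + 1) → E} {l : ℕ} (hh : ContDiff ℝ (l : WithTop ℕ∞) h) :
    ContDiff ℝ (l : WithTop ℕ∞)
      fun q : ℝ × ℝ => sphMean h (q.1 • EuclideanSpace.single 0 1) q.2 := by
  have h3 : ContDiff ℝ (l : WithTop ℕ∞) fun q : ℝ × ℝ =>
      ((q.1 • EuclideanSpace.single 0 1, q.2) : Euc (n + 1) × ℝ) :=
    (contDiff_fst.smul contDiff_const).prodMk contDiff_snd
  exact (contDiff_sphMean hh).comp h3

/-- The potential is constant on horizontal spheres around the axis, so the sphere integral falls on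
the Laplacian alone. The Jacobian `r ^ (n - 1) = r ^ (2 (K + 1))` is the power of `r` built into
`sourceIntegrand`. -/
theorem regSource_eq {K : ℕ} (hn : n = 2 * K + 3) {ε t : ℝ} (hε : 0 < ε)
    {g : Euc (n + 1) → E} (hg : Continuous (Laplacian.laplacian g)) {B : ℝ}
    (hB : ∀ X, B < ‖X‖ → Laplacian.laplacian g X = 0) :
    regSource ε (-(t • EuclideanSpace.single 0 1)) g
      = ((sphereArea (n + 1) : ℂ) * (-(2 * (K + 1 : ℕ))))⁻¹ • sourceIntegral t ε (K + 1)
        fun u r => sphMean (Laplacian.laplacian g) (u • EuclideanSpace.single 0 1) r := by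
  have hN : n + 1 = 2 * (K + 1) + 2 := by omega
  set c : ℂ := ((sphereArea (n + 1) : ℂ) * (-(2 * (K + 1 : ℕ))))⁻¹ with hc
  set L := Laplacian.laplacian g with hL
  have hLint : Integrable L := hg.integrable_of_hasCompactSupport
    (HasCompactSupport.intro (isCompact_closedBall 0 B) fun X hX => hB X (by simpa using hX))
  obtain ⟨C, hC⟩ := exists_norm_regPotential_le hN hε
  have hmeas : Measurable fun X : Euc (n + 1) => regPotential ε
      (cpoint X (-(t • EuclideanSpace.single 0 1))) := by
    refine (measurable_regPotential ε).comp ?_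
    unfold cpoint
    fun_prop
  have hint : Integrable fun X : Euc (n + 1) => regPotential ε
      (cpoint X (-(t • EuclideanSpace.single 0 1))) • L X :=
    hLint.bdd_smul C hmeas.aestronglyMeasurable (ae_of_all _ fun X => hC _)
  have hF := (contDiff_sphMean_axis (l := 0) (by simpa using hg)).continuous
  rw [regSource, integral_eq_integral_cylindrical (m := 2 * K + 2) hn hint,
    sourceIntegral_eq hε (K + 1) hF fun u r => sphMean_eq_zero_of_lt hB, ← integral_smul]
  congr 1
  ext u
  rw [← integral_smul]
  rw [← integral_indicator measurableSet_Ioi, ← integral_indicator measurableSet_Ioi]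
  congr 1
  ext r
  by_cases hr : 0 < r
  · rw [indicator_of_mem (mem_Ioi.2 hr)]
    have hpot : ∀ θ : Metric.sphere (0 : Euc n) 1, regPotential ε
        (cpoint (u • EuclideanSpace.single 0 1 + r • emb n θ)
          (-(t • EuclideanSpace.single 0 1)))
        = if spheroidRadius t ε u < r then c * (sqLength t u r ^ (K + 1))⁻¹ else 0 := fun θ => by
      rw [regPotential, holPotential_eq hN, sum_sq_cpoint]
      simp only [lt_re_complexLength_iff hε hr (sum_sq_cpoint θ u r t), hc]
    simp only [hpot]
    rw [integral_smul]
    by_cases h : spheroidRadius t ε u < r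
    · rw [indicator_of_mem (mem_Ioi.2 h), if_pos h, sourceIntegrand, sphMean, mul_smul]
      rw [smul_comm (r ^ (2 * K + 2)), smul_comm (r ^ (2 * K + 2))]
      rfl
    · rw [indicator_of_notMem (fun h' => h (mem_Ioi.1 h')), if_neg h, zero_smul, smul_zero]
  · rw [indicator_of_notMem (fun h' => hr (mem_Ioi.1 h')), indicator_of_notMem fun h' =>
      hr ((spheroidRadius_nonneg t ε u).trans_lt (mem_Ioi.1 h'))]

theorem laplacian_eq {f : Euc (n + 1) → E} (hf : ContDiff ℝ 2 f) :
    Laplacian.laplacian f = spaceLaplacian f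
      + fun X => fderiv ℝ (fun Y => fderiv ℝ f Y (EuclideanSpace.single 0 1)) X
        (EuclideanSpace.single 0 1) := by
  ext X
  have hf' : ContDiff ℝ 1 (fderiv ℝ f) := hf.fderiv_right (by norm_num)
  rw [InnerProductSpace.laplacian_eq_iteratedFDeriv_orthonormalBasis f
    (EuclideanSpace.basisFun (Fin (n + 1)) ℝ), Pi.add_apply, spaceLaplacian_eq hf,
    fderiv_clm_apply ((hf'.differentiable (by norm_num)) X) (differentiableAt_const _)]
  simp only [iteratedFDeriv_two_apply, Fin.sum_univ_succ (n := n)]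
  simp [add_comm]

end RegSource

/-! ### The value of the source distribution on test functions -/

section ExtensionValue

variable {n K : ℕ} {E : Type*} [NormedAddCommGroup E] [NormedSpace ℂ E]

theorem holWave_zero_fun (X : Euc (n + 1)) (r : ℝ) : holWave K (fun _ => (0 : E)) X r = 0 := by
  have h : wave K (fun _ : Euc (n + 1) => (0 : E)) X = 0 := wave_zero X
  simp [holWave, h]

theorem holWave_axis_eq_zero {g : Euc (n + 1) → E} {B : ℝ} (hB : ∀ X, B < ‖X‖ → g X = 0) {u r : ℝ}
    (hur : B < |u| ∨ B < |r|) : holWave K g (u • EuclideanSpace.single 0 1) r = 0 := by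
  have hev : ∀ᶠ s in 𝓝 r, B < |u| ∨ B < |s| := by
    rcases hur with h | h
    · exact Eventually.of_forall fun _ => Or.inl h
    · exact (continuous_abs.continuousAt.eventually_const_lt h).mono fun _ => Or.inr
  have hB' : ∀ X, B < ‖X‖ → fderiv ℝ g X (EuclideanSpace.single 0 1) = 0 := fun X hX => by
    have : g =ᶠ[𝓝 X] fun _ => 0 :=
      (continuous_norm.continuousAt.eventually_const_lt hX).mono hB
    rw [this.fderiv_eq]; simp
  rw [← holWave_zero_fun (u • EuclideanSpace.single 0 1) r]
  refine holWave_congr ?_ ?_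
  · filter_upwards [hev] with s hs
    rw [sphMean_eq_zero_of_lt hB hs]; simp [sphMean]
  · filter_upwards [hev] with s hs
    rw [sphMean_eq_zero_of_lt hB' hs]; simp [sphMean]

theorem contDiff_spaceLaplacian {g : Euc (n + 1) → E} {l : ℕ}
    (hg : ContDiff ℝ ((l + 2 : ℕ) : WithTop ℕ∞) g) :
    ContDiff ℝ (l : WithTop ℕ∞) (spaceLaplacian g) := by
  unfold spaceLaplacian
  exact ContDiff.sum fun i _ =>
    contDiff_fderiv_apply (contDiff_fderiv_apply (l := l + 1) hg _) _

/-- With `w = wave K g`, odd in `r`, the function `ψ` is `∂_r w - i ∂_u w`. Applying `∂_r + i ∂_u`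
gives `∂_r² w + ∂_u² w`, and by `deriv_deriv_wave` this is `wave` of the full Laplacian of `g`. -/
theorem smul_desc_laplacian_eq [CompleteSpace E] (hn : n = 2 * K + 3) {g : Euc (n + 1) → E}
    (hg : ContDiff ℝ ((K + 3 : ℕ) : WithTop ℕ∞) g) {ψ : ℝ × ℝ → E}
    (hψ : ψ = fun q => holWave K g (q.1 • EuclideanSpace.single 0 1) (-q.2)) (u r : ℝ) :
    r • desc K (sphMean (Laplacian.laplacian g) (u • EuclideanSpace.single 0 1)) r
      = fderiv ℝ ψ (u, r) (0, 1) + Complex.I • fderiv ℝ ψ (u, r) (1, 0) := by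
  set e0 : Euc (n + 1) := EuclideanSpace.single 0 1 with he0
  have hg0 : ContDiff ℝ ((K + 2 : ℕ) : WithTop ℕ∞) fun Y => fderiv ℝ g Y e0 :=
    contDiff_fderiv_apply hg _
  have hg00 : ContDiff ℝ ((K + 1 : ℕ) : WithTop ℕ∞)
      fun X => fderiv ℝ (fun Y => fderiv ℝ g Y e0) X e0 := contDiff_fderiv_apply hg0 _
  have hsl : ContDiff ℝ (K : WithTop ℕ∞) (spaceLaplacian g) :=
    contDiff_spaceLaplacian (hg.of_le (by norm_cast; omega))
  have hcd := contDiff_holWave (l := 2) hg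
  have hdiff := (hcd.differentiable (by simp)) (u • e0, -r)
  let L : ℝ × ℝ →L[ℝ] Euc (n + 1) × ℝ := ((ContinuousLinearMap.fst ℝ ℝ ℝ).smulRight e0).prod
    (-(ContinuousLinearMap.snd ℝ ℝ ℝ))
  have hL : HasFDerivAt (fun q : ℝ × ℝ => (q.1 • e0, -q.2)) L (u, r) := L.hasFDerivAt
  have h1 : fderiv ℝ ψ (u, r) (1, 0) = holWave K (fun Y => fderiv ℝ g Y e0) (u • e0) (-r) := by
    rw [← fderiv_holWave (hg.of_le (by norm_cast; omega))]
    have h0 : fderiv ℝ ψ (u, r)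
        = (fderiv ℝ (fun q : Euc (n + 1) × ℝ => holWave K g q.1 q.2) (u • e0, -r)).comp L := by
      rw [hψ]
      have := hdiff.hasFDerivAt.comp (u, r) hL
      exact this.fderiv
    rw [h0]
    simp [L]
  have h2 : fderiv ℝ ψ (u, r) (0, 1) = -(wave K (spaceLaplacian g) (u • e0) (-r) + Complex.I •
      deriv (wave K (fun Y => fderiv ℝ g Y e0) (u • e0)) (-r)) := by
    have hψd : DifferentiableAt ℝ ψ (u, r) := by
      rw [hψ]
      exact (hdiff.hasFDerivAt.comp (u, r) hL).differentiableAt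
    refine fderiv_apply_eq_of_hasDerivAt hψd ?_
    have := hasDerivAt_holWave hn (hg.of_le (by norm_cast; omega)) (u • e0) (-r)
    have hin : HasDerivAt (fun s : ℝ => -(r + s)) (-1) 0 := ((hasDerivAt_id 0).const_add r).neg
    have h3 := HasDerivAt.scomp (0 : ℝ) (h := fun s : ℝ => -(r + s)) (by simpa using this) hin
    simpa [hψ, Function.comp_def, add_comm] using h3
  rw [h1, h2, laplacian_eq (hg.of_le (by norm_cast; omega))]
  have h3 := congrFun (wave_add (X := u • e0) hsl (hg00.of_le (by norm_cast; omega))) r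
  rw [wave] at h3
  have hslc := hsl.continuous
  rw [wave_neg_radius hslc, holWave, wave_neg_radius hg00.continuous]
  refine h3.trans ?_
  simp only [Pi.add_apply, smul_add, smul_neg, smul_smul, Complex.I_mul_I]
  module

theorem tendsto_regSource [CompleteSpace E] (hn : n = 2 * K + 3) {g : Euc (n + 1) → E}
    (hg : ContDiff ℝ ((K + 3 : ℕ) : WithTop ℕ∞) g) (hgs : HasCompactSupport g) (t : ℝ) :
    Tendsto (fun ε : ℝ => regSource ε (-(t • EuclideanSpace.single 0 1)) g) (𝓝[>] 0)
      (𝓝 ((descConst K * Real.pi / (2 * (K + 1) * sphereArea (n + 1))) • holWave K g 0 t)) := by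
  obtain ⟨B, hB⟩ := hgs.isCompact.isBounded.exists_norm_le
  have hgB : ∀ X, B < ‖X‖ → g X = 0 := fun X hX => by
    by_contra h
    exact absurd (hB X (subset_tsupport g h)) (not_le.2 hX)
  have hLB : ∀ X, B < ‖X‖ → Laplacian.laplacian g X = 0 := fun X hX => by
    have : g =ᶠ[𝓝 X] fun _ => 0 :=
      (continuous_norm.continuousAt.eventually_const_lt hX).mono hgB
    rw [(InnerProductSpace.laplacian_congr_nhds this).eq_of_nhds]
    simp
  have hL : ContDiff ℝ ((K + 1 : ℕ) : WithTop ℕ∞) (Laplacian.laplacian g) := by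
    rw [laplacian_eq (hg.of_le (by norm_cast; omega))]
    exact (contDiff_spaceLaplacian hg).add
      (contDiff_fderiv_apply (contDiff_fderiv_apply (l := K + 2) hg _) _)
  have hψ : ContDiff ℝ 1 fun q : ℝ × ℝ => holWave K g (q.1 • EuclideanSpace.single 0 1) (-q.2) := by
    have h3 : ContDiff ℝ 1 fun q : ℝ × ℝ =>
        ((q.1 • EuclideanSpace.single 0 1, -q.2) : Euc (n + 1) × ℝ) :=
      (contDiff_fst.smul contDiff_const).prodMk contDiff_snd.neg
    exact ((contDiff_holWave (l := 2) hg).of_le (by norm_num)).comp h3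
  have h := (tendsto_sourceIntegral (t := t)
    (contDiff_sphMean_axis (hL.of_le (by norm_cast; omega)))
    (fun u r => sphMean_neg_radius hL.continuous _ r)
    (fun u r => sphMean_eq_zero_of_lt hLB) hψ
    (fun q hq => holWave_axis_eq_zero hgB (by rwa [abs_neg]))
    (smul_desc_laplacian_eq hn hg rfl)).const_smul
      ((sphereArea (n + 1) : ℂ) * (-(2 * (K + 1 : ℕ))))⁻¹
  simp only [zero_smul, neg_neg] at h
  have h2 : ((sphereArea (n + 1) : ℂ) * (-(2 * (K + 1 : ℕ))))⁻¹ •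
      (-(descConst K * Real.pi)) • holWave K g 0 t
      = (descConst K * Real.pi / (2 * (K + 1) * sphereArea (n + 1))) • holWave K g 0 t := by
    rw [← Complex.coe_smul, smul_smul, ← Complex.coe_smul]
    congr 1
    push_cast
    rw [mul_neg _ (2 * ((K : ℂ) + 1)), inv_neg, neg_mul_neg, div_eq_inv_mul,
      mul_comm (sphereArea (n + 1) : ℂ)]
  rw [h2] at h
  refine h.congr' ?_
  filter_upwards [self_mem_nhdsWithin] with ε hε
  exact (regSource_eq hn hε hL.continuous hLB).symm

/-- The recursion for `descConst` is that of a quotient of Gamma functions, `2 Γ(K + 3/2) / (√π Γ(K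
+ 1))`. With the areas of the unit spheres in dimensions `n` and `n + 1` every factor cancels. -/
theorem descConst_mul_pi_mul_sphereMeasure (hn : n = 2 * K + 3) :
    descConst K * Real.pi / (2 * (K + 1) * sphereArea (n + 1)) * (sphereMeasure n).real univ = 1 := by
  subst hn
  have hdesc : ∀ K : ℕ, descConst K * Real.sqrt Real.pi * Real.Gamma (K + 1)
      = 2 * Real.Gamma (K + 3 / 2) := by
    intro K
    induction K with
    | zero =>
      have : Real.Gamma (3 / 2) = 1 / 2 * Real.Gamma (1 / 2) := by
        rw [← Real.Gamma_add_one (by norm_num)]; norm_num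
      rw [descConst, Nat.cast_zero, zero_add, zero_add, Real.Gamma_one, this,
        Real.Gamma_one_half_eq]
      ring
    | succ m ih =>
      have h1 : Real.Gamma ((m + 1 : ℕ) + 1) = (m + 1) * Real.Gamma (m + 1) := by
        push_cast; exact Real.Gamma_add_one (by positivity)
      have h2 : Real.Gamma ((m + 1 : ℕ) + 3 / 2) = (m + 3 / 2) * Real.Gamma (m + 3 / 2) := by
        rw [← Real.Gamma_add_one (by positivity)]; congr 1; push_cast; ring
      rw [h1, h2, descConst]
      generalize Real.Gamma (m + 3 / 2) = G at ih
      have h3 : (2 * (m : ℝ) + 2) ≠ 0 := by positivity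
      field_simp
      linear_combination ih
  have hS : (sphereMeasure (2 * K + 3)).real univ
      = 2 * Real.pi ^ (K + 1) * √Real.pi / Real.Gamma (K + 3 / 2) := by
    rw [sphereMeasure, Measure.toSphere_real_apply_univ, Measure.real, EuclideanSpace.volume_ball]
    have hG : Real.Gamma ((2 * K + 3 : ℕ) / 2 + 1) = (K + 3 / 2) * Real.Gamma (K + 3 / 2) := by
      rw [← Real.Gamma_add_one (by positivity)]; congr 1; push_cast; ring
    have hpos := Real.Gamma_pos_of_pos (by positivity : (0 : ℝ) < K + 3 / 2)
    simp only [Fintype.card_fin, finrank_euclideanSpace, hG]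
    rw [ENNReal.ofReal_one, one_pow, one_mul, ENNReal.toReal_ofReal (by positivity)]
    have h5 : √Real.pi ^ (2 * K + 3) = Real.pi ^ (K + 1) * √Real.pi := by
      have := Real.sq_sqrt Real.pi_pos.le
      calc √Real.pi ^ (2 * K + 3) = (√Real.pi ^ 2) ^ (K + 1) * √Real.pi := by ring
        _ = _ := by rw [this]
    rw [h5]
    push_cast
    field_simp
  have hA : sphereArea (2 * K + 3 + 1) = 2 * Real.pi ^ (K + 2) / ((K + 1) * Real.Gamma (K + 1)) := by
    have h6 : ((2 * K + 3 + 1 : ℕ) : ℝ) / 2 = (K + 2 : ℕ) := by push_cast; ring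
    rw [sphereArea, h6, Real.rpow_natCast]
    congr 1
    rw [← Real.Gamma_add_one (by positivity)]; congr 1; push_cast; ring
  have hpos := Real.Gamma_pos_of_pos (by positivity : (0 : ℝ) < K + 3 / 2)
  have hpos2 := Real.Gamma_pos_of_pos (by positivity : (0 : ℝ) < K + 1)
  have hd := hdesc K
  rw [hS, hA]
  have hpi := Real.pi_pos
  generalize Real.Gamma (K + 3 / 2) = G at hd hpos
  field_simp
  linear_combination Real.pi ^ (K + 2) * hd

end ExtensionValue

/-! ### Localization and uniqueness of the extension -/

section Extension

variable {n K : ℕ} {E : Type*} [NormedAddCommGroup E] [NormedSpace ℂ E]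

/-- Multiply the translate of `f` by the cutoff and apply `tendsto_regSource`. The result involves
only a neighbourhood of the sphere of radius `|t|` in the horizontal hyperplane, where the cutoff is
`1`, so the cutoff can be dropped. -/
theorem isExtensionValue_holWave [CompleteSpace E] (hn : n = 2 * K + 3) {f : Euc (n + 1) → E}
    (hf : ContDiff ℝ ((K + 3 : ℕ) : WithTop ℕ∞) f) (x : Euc n) (s t : ℝ) :
    IsExtensionValue f (spacetimePoint x s t)
      (((sphereMeasure n).real univ)⁻¹ • holWave K f (realPoint x s) t) := by
  intro χ hχ hχs hχ1
  rw [imPart_spacetimePoint] at hχ1 ⊢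
  rw [rePart_spacetimePoint]
  set X := realPoint x s
  set g : Euc (n + 1) → E := fun x' => χ x' • f (X + x') with hg
  have hgc : ContDiff ℝ ((K + 3 : ℕ) : WithTop ℕ∞) g :=
    (contDiff_infty.1 hχ _).smul (hf.comp (by fun_prop))
  have hlim := tendsto_regSource hn hgc hχs.smul_right t
  rw [eq_inv_of_mul_eq_one_left (descConst_mul_pi_mul_sphereMeasure hn)] at hlim
  have hloc : holWave K g 0 t = holWave K f X t := by
    obtain ⟨U, hUo, hU, hU1⟩ := mem_nhdsSet_iff_exists.1 hχ1
    have hnorm : ‖-(t • EuclideanSpace.single 0 1 : Euc (n + 1))‖ = |t| := by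
      simp [norm_smul]
    rw [hnorm] at hU
    -- A uniform margin around the ball is needed because derivatives in the radius enter: spheres
    -- of all radii near `t` must stay where the cutoff is `1`.
    obtain ⟨δ, hδ, hδU⟩ := (isCompact_closedBall (0 : Euc (n + 1)) |t|).exists_thickening_subset_open
      hUo hU
    rw [thickening_closedBall hδ (abs_nonneg t)] at hδU
    have hev : ∀ᶠ r in 𝓝 t, |r| < δ + |t| :=
      continuous_abs.continuousAt.eventually_lt_const (by linarith)
    have hmem : ∀ r, |r| < δ + |t| → ∀ θ : Metric.sphere (0 : Euc n) 1,
        (0 : Euc (n + 1)) + r • emb n θ ∈ U := fun r hr θ => by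
      refine hδU (mem_ball_zero_iff.2 ?_)
      have := norm_sq_smul_add_smul_emb θ 0 r
      rw [zero_smul] at this
      rw [show ‖(0 : Euc (n + 1)) + r • emb n θ‖ = |r| from
        (sq_eq_sq₀ (norm_nonneg _) (abs_nonneg _)).1 (by rw [this, sq_abs]; ring)]
      exact hr
    have hgU : ∀ Z ∈ U, g Z = f (X + Z) := fun Z hZ => by
      have : χ Z = 1 := hU1 hZ
      simp [hg, this]
    refine holWave_congr ?_ ?_
    · filter_upwards [hev] with r hr
      simp only [sphMean]
      congr 1
      ext θ
      rw [hgU _ (hmem r hr θ), zero_add]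
    · filter_upwards [hev] with r hr
      simp only [sphMean]
      congr 1
      ext θ
      have h1 : g =ᶠ[𝓝 (0 + r • emb n θ)] fun Z => f (X + Z) :=
        eventually_of_mem (hUo.mem_nhds (hmem r hr θ)) hgU
      rw [h1.fderiv_eq, fderiv_comp_add_left, zero_add]
  rwa [hloc] at hlim

/-- The definition quantifies over all cutoffs, so uniqueness needs that at least one exists; a
smooth bump function serves. -/
theorem IsExtensionValue.unique {f : Euc n → E} {z : Fin n → ℂ} {L L' : E}
    (h : IsExtensionValue f z L) (h' : IsExtensionValue f z L') : L = L' := by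
  let χ : ContDiffBump (0 : Euc n) :=
    ⟨‖-imPart z‖ + 1, ‖-imPart z‖ + 2, by positivity, by linarith⟩
  have hχ : ∀ᶠ x in 𝓝ˢ (Metric.closedBall (0 : Euc n) ‖-imPart z‖), χ x = 1 := by
    refine mem_nhdsSet_iff_exists.2 ⟨Metric.ball 0 (‖-imPart z‖ + 1), Metric.isOpen_ball,
      Metric.closedBall_subset_ball (by linarith), fun x hx => ?_⟩
    exact χ.one_of_mem_closedBall (Metric.ball_subset_closedBall hx)
  exact tendsto_nhds_unique (h χ χ.contDiff χ.hasCompactSupport hχ)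
    (h' χ χ.contDiff χ.hasCompactSupport hχ)

theorem IsExtensionValue.extension_eq {f : Euc n → E} {z : Fin n → ℂ} {L : E}
    (h : IsExtensionValue f z L) : extension f z = L := by
  have h1 : ∃ L, IsExtensionValue f z L := ⟨L, h⟩
  rw [extension, dif_pos h1]
  exact h1.choose_spec.unique h

end Extension

/-! ### The Clifford relations and the square of the Dirac operator -/

section Clifford

instance (N : ℕ) : FiniteDimensional ℂ (Cl N) := Module.Finite.of_basis (clBasis N)

instance (N : ℕ) : CompleteSpace (Cl N) := FiniteDimensional.complete ℂ (Cl N)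

theorem e_mul_e_add_swap {N : ℕ} (i j : Fin N) :
    (e i * e j + e j * e i : Cl N) = if i = j then 2 else 0 := by
  have h := CliffordAlgebra.ι_mul_ι_add_swap (Q := sumSq N) (Pi.single i 1) (Pi.single j 1)
  have h2 : QuadraticMap.polar (sumSq N) (Pi.single i 1) (Pi.single j 1)
      = if i = j then 2 else 0 := by
    simp only [QuadraticMap.polar, sumSq, QuadraticMap.weightedSumSquares_apply, Pi.one_apply,
      one_smul, Pi.add_apply, ← Finset.sum_sub_distrib]
    have : ∀ l : Fin N, ((Pi.single i 1 : Fin N → ℂ) l + (Pi.single j 1 : Fin N → ℂ) l) *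
        ((Pi.single i 1 : Fin N → ℂ) l + (Pi.single j 1 : Fin N → ℂ) l)
        - (Pi.single i 1 : Fin N → ℂ) l * (Pi.single i 1 : Fin N → ℂ) l
        - (Pi.single j 1 : Fin N → ℂ) l * (Pi.single j 1 : Fin N → ℂ) l
        = 2 * (Pi.single i 1 : Fin N → ℂ) l * (Pi.single j 1 : Fin N → ℂ) l := fun l => by ring
    simp only [this]
    by_cases hij : i = j
    · subst hij; simp [Pi.single_apply]
    · simp [Pi.single_apply, hij, Ne.symm hij]
  rw [h2] at h
  refine Eq.trans h ?_
  split_ifs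
  · exact map_ofNat (algebraMap ℂ (CliffordAlgebra (sumSq N))) 2
  · exact map_zero (algebraMap ℂ (CliffordAlgebra (sumSq N)))

/-- Multiplication from the left in the Clifford algebra as a continuous real linear map. -/
noncomputable def mulLeftCLM {N : ℕ} (c : Cl N) : Cl N →L[ℝ] Cl N :=
  (LinearMap.toContinuousLinearMap (LinearMap.mulLeft ℂ c)).restrictScalars ℝ

theorem mulLeftCLM_apply {N : ℕ} (c w : Cl N) : mulLeftCLM c w = c * w := rfl

variable {n : ℕ}

/-- The coefficients of the hyperbolic Dirac operator. -/
noncomputable def diracCoeff (a : Fin (n + 1)) : Cl (n + 1) :=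
  if a = 0 then -(Complex.I • e 0) else e a

/-- The directions of the derivatives in the hyperbolic Dirac operator. -/
noncomputable def diracDir (a : Fin (n + 1)) : Euc (n + 1) × ℝ :=
  if a = 0 then (0, 1) else (EuclideanSpace.single a 1, 0)

/-- The hyperbolic Dirac operator on functions of `(x, s)` and `t`. -/
noncomputable def dirac (V : Euc (n + 1) × ℝ → Cl (n + 1)) (q : Euc (n + 1) × ℝ) : Cl (n + 1) :=
  ∑ a : Fin (n + 1), diracCoeff a * fderiv ℝ V q (diracDir a)

theorem diracCoeff_mul_add_swap (a b : Fin (n + 1)) :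
    (diracCoeff a * diracCoeff b + diracCoeff b * diracCoeff a : Cl (n + 1))
      = if a = b then (if a = 0 then -2 else 2) else 0 := by
  have h := e_mul_e_add_swap a b
  have hI : ∀ w w' : Cl (n + 1), -(Complex.I • w) * w' = -(Complex.I • (w * w')) := fun w w' => by
    rw [neg_mul, smul_mul_assoc]
  have hI' : ∀ w w' : Cl (n + 1), w * -(Complex.I • w') = -(Complex.I • (w * w')) := fun w w' => by
    rw [mul_neg, mul_smul_comm]
  by_cases ha : a = 0 <;> by_cases hb : b = 0
  · subst ha hb
    simp only [diracCoeff, if_true, hI, hI', smul_neg, neg_neg, smul_smul, Complex.I_mul_I] at h ⊢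
    rw [← smul_add, h, neg_one_smul]
  · subst ha
    simp only [diracCoeff, if_true, if_neg hb, if_neg (Ne.symm hb), hI, hI'] at h ⊢
    rw [← neg_add, ← smul_add, h, smul_zero, neg_zero]
  · subst hb
    simp only [diracCoeff, if_true, if_neg ha, hI, hI'] at h ⊢
    rw [← neg_add, ← smul_add, h, smul_zero, neg_zero]
  · simp only [diracCoeff, if_neg ha, if_neg hb, h]

theorem contDiff_dirac {l : ℕ} {V : Euc (n + 1) × ℝ → Cl (n + 1)}
    (hV : ContDiff ℝ ((l + 1 : ℕ) : WithTop ℕ∞) V) : ContDiff ℝ (l : WithTop ℕ∞) (dirac V) := by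
  unfold dirac
  exact ContDiff.sum fun a _ => (mulLeftCLM (diracCoeff a)).contDiff.comp
    (contDiff_fderiv_apply hV _)

/-- The hyperbolic operator never differentiates in `s`, so in `dirac` the slot of index `0` is free
to hold the time derivative with coefficient `-i e_0`. -/
theorem hyperbolicDirac_eq_dirac {V : Euc (n + 1) × ℝ → Cl (n + 1)} (hV : Differentiable ℝ V)
    (x : Euc n) (s t : ℝ) :
    hyperbolicDirac (fun x' t' => V (realPoint x' s, t')) x t = dirac V (realPoint x s, t) := by
  have h1 : ∀ k : Fin n, lineDeriv ℝ (fun x' => V (realPoint x' s, t)) x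
      (EuclideanSpace.single k 1)
      = fderiv ℝ V (realPoint x s, t) (EuclideanSpace.single k.succ 1, 0) := fun k => by
    rw [← (hV _).lineDeriv_eq_fderiv]
    simp only [lineDeriv]
    congr 1
    ext r
    simp only [realPoint_eq, map_add, map_smul, emb_single, Prod.smul_mk, Prod.mk_add_mk, smul_zero,
      add_zero, add_right_comm]
  have h2 : deriv (fun t' => V (realPoint x s, t')) t = fderiv ℝ V (realPoint x s, t) (0, 1) :=
    (hasDerivAt_of_fderiv_snd (Φ := fun X r => V (X, r)) (hV _)).deriv
  rw [hyperbolicDirac, h2, dirac, Fin.sum_univ_succ]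
  simp only [h1, diracCoeff, diracDir, Fin.succ_ne_zero, if_true, if_false, neg_mul, smul_mul_assoc]
  abel

/-- Second derivatives are symmetric, so doubling the double sum and exchanging indices leaves the
anticommutators of the coefficients. These vanish off the diagonal, and `(-i e_0)² = -1` gives the
minus sign of the time derivative. -/
theorem dirac_dirac {V : Euc (n + 1) × ℝ → Cl (n + 1)} (hV : ContDiff ℝ 2 V)
    (q : Euc (n + 1) × ℝ) :
    dirac (dirac V) q = ∑ k : Fin n, fderiv ℝ (fun p => fderiv ℝ V p (EuclideanSpace.single k.succ 1, 0))
      q (EuclideanSpace.single k.succ 1, 0) - fderiv ℝ (fun p => fderiv ℝ V p (0, 1)) q (0, 1) := by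
  set S : Fin (n + 1) → Fin (n + 1) → Cl (n + 1) := fun a b =>
    fderiv ℝ (fun p => fderiv ℝ V p (diracDir b)) q (diracDir a) with hS
  have hsymm : ∀ a b, S a b = S b a := fun a b => fderiv_fderiv_apply_comm hV _ _ _
  have hd : ∀ b, DifferentiableAt ℝ (fun p => fderiv ℝ V p (diracDir b)) q := fun b =>
    (contDiff_fderiv_apply (l := 1) hV _).differentiable (by simp) q
  have h1 : dirac (dirac V) q = ∑ a, ∑ b, diracCoeff a * diracCoeff b * S a b := by
    rw [dirac]
    refine Finset.sum_congr rfl fun a _ => ?_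
    have : fderiv ℝ (dirac V) q = ∑ b, (mulLeftCLM (diracCoeff b)).comp
        (fderiv ℝ (fun p => fderiv ℝ V p (diracDir b)) q) := by
      refine HasFDerivAt.fderiv ?_
      exact HasFDerivAt.fun_sum fun b _ =>
        (mulLeftCLM (diracCoeff b)).hasFDerivAt.comp q (hd b).hasFDerivAt
    rw [this, sum_apply, Finset.mul_sum]
    refine Finset.sum_congr rfl fun b _ => ?_
    rw [ContinuousLinearMap.comp_apply, mulLeftCLM_apply, mul_assoc]
  have h2 : (2 : ℂ) • dirac (dirac V) q = ∑ a, (if a = (0 : Fin (n + 1)) then (-2 : Cl (n + 1)) else 2) * S a a := by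
    rw [two_smul, h1]
    nth_rewrite 2 [Finset.sum_comm]
    rw [← Finset.sum_add_distrib]
    refine Finset.sum_congr rfl fun a _ => ?_
    rw [← Finset.sum_add_distrib]
    calc ∑ b, (diracCoeff a * diracCoeff b * S a b + diracCoeff b * diracCoeff a * S b a)
        = ∑ b, (if a = b then (if a = 0 then -2 else 2) else 0) * S a b := by
          refine Finset.sum_congr rfl fun b _ => ?_
          rw [hsymm b a, ← add_mul, diracCoeff_mul_add_swap]
      _ = _ := by simp [ite_mul]
  have h3 : ∀ w : Cl (n + 1), 2 * w = (2 : ℂ) • w := fun w => by rw [two_mul, two_smul]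
  refine smul_right_injective (Cl (n + 1)) (two_ne_zero (α := ℂ)) ?_
  simp only
  rw [h2, Fin.sum_univ_succ, smul_sub, Finset.smul_sum]
  simp only [Fin.succ_ne_zero, if_true, if_false, hS, diracDir, neg_mul, h3]
  abel

end Clifford

/-! ### The extension as a solution of the wave equation with its initial data -/

section Solution

variable {n K : ℕ}

theorem ftilde_eq (hn : n = 2 * K + 3) {f : Euc (n + 1) → Cl (n + 1)}
    (hf : ContDiff ℝ ((K + 3 : ℕ) : WithTop ℕ∞) f) (x : Euc n) (s t : ℝ) :
    ftilde f x s t = ((sphereMeasure n).real univ)⁻¹ • holWave K f (realPoint x s) t :=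
  (isExtensionValue_holWave hn hf x s t).extension_eq

variable {E : Type*} [NormedAddCommGroup E] [NormedSpace ℂ E]

/-- The extension of `f` as a function of `(x, s)` and `t`. -/
noncomputable def solution (K : ℕ) (f : Euc (n + 1) → E) (q : Euc (n + 1) × ℝ) : E :=
  ((sphereMeasure n).real univ)⁻¹ • holWave K f q.1 q.2

theorem contDiff_solution {f : Euc (n + 1) → E} {l : ℕ}
    (hf : ContDiff ℝ ((K + (l + 1) : ℕ) : WithTop ℕ∞) f) :
    ContDiff ℝ (l : WithTop ℕ∞) (solution K f) :=
  (contDiff_holWave hf).const_smul _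

theorem fderiv_solution_fst {f : Euc (n + 1) → E}
    (hf : ContDiff ℝ ((K + 2 : ℕ) : WithTop ℕ∞) f) (v : Euc (n + 1)) (q : Euc (n + 1) × ℝ) :
    fderiv ℝ (solution K f) q (v, 0) = solution K (fun Y => fderiv ℝ f Y v) q := by
  unfold solution
  rw [fderiv_fun_const_smul ((contDiff_holWave (l := 1) hf).differentiable (by simp) q), smul_apply,
    fderiv_holWave hf]

theorem fderiv_solution_snd {f : Euc (n + 1) → E}
    (hf : ContDiff ℝ ((K + 2 : ℕ) : WithTop ℕ∞) f) (q : Euc (n + 1) × ℝ) :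
    fderiv ℝ (solution K f) q (0, 1)
      = ((sphereMeasure n).real univ)⁻¹ • deriv (holWave K f q.1) q.2 := by
  have hd := (contDiff_holWave (l := 1) hf).differentiable (by simp) q
  unfold solution
  rw [fderiv_fun_const_smul hd, smul_apply, (hasDerivAt_of_fderiv_snd hd).deriv]

/-- Horizontal derivatives pass through to `f` by `fderiv_solution_fst`, after which the claim is
`deriv_deriv_holWave`. -/
theorem solution_wave [CompleteSpace E] (hn : n = 2 * K + 3) {f : Euc (n + 1) → E}
    (hf : ContDiff ℝ ((K + 3 : ℕ) : WithTop ℕ∞) f) (q : Euc (n + 1) × ℝ) :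
    fderiv ℝ (fun p => fderiv ℝ (solution K f) p (0, 1)) q (0, 1)
      = ∑ k : Fin n, fderiv ℝ (fun p => fderiv ℝ (solution K f) p (EuclideanSpace.single k.succ 1, 0))
        q (EuclideanSpace.single k.succ 1, 0) := by
  have hf2 : ContDiff ℝ ((K + 2 : ℕ) : WithTop ℕ∞) f := hf.of_le (by norm_cast; omega)
  have h1 : ∀ k : Fin n, fderiv ℝ (fun p => fderiv ℝ (solution K f) p
      (EuclideanSpace.single k.succ 1, 0)) q (EuclideanSpace.single k.succ 1, 0)
      = ((sphereMeasure n).real univ)⁻¹ • holWave K (fun Y => fderiv ℝ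
        (fun Z => fderiv ℝ f Z (EuclideanSpace.single k.succ 1)) Y
          (EuclideanSpace.single k.succ 1)) q.1 q.2 := fun k => by
    simp only [fderiv_solution_fst hf2]
    exact fderiv_solution_fst (contDiff_fderiv_apply hf _) _ _
  simp only [h1]
  rw [← Finset.smul_sum, ← deriv_deriv_holWave hn hf]
  have hd : DifferentiableAt ℝ (fun p => fderiv ℝ (solution K f) p ((0 : Euc (n + 1)), (1 : ℝ))) q :=
    (contDiff_fderiv_apply (l := 1) (contDiff_solution (l := 2) hf) _).differentiable (by simp) q
  have hd' := (hasDerivAt_of_fderiv_snd (Φ := fun X r => fderiv ℝ (solution K f) (X, r) (0, 1))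
    (p := q.1) (r := q.2) hd).deriv
  refine hd'.symm.trans ?_
  simp only [fderiv_solution_snd hf2]
  rw [deriv_fun_const_smul]
  have h2 : ContDiff ℝ 2 (holWave K f q.1) :=
    (contDiff_holWave (l := 2) hf).comp (contDiff_const.prodMk contDiff_id)
  exact (h2.differentiable_deriv_two) q.2

theorem sphereMeasure_real_univ_ne_zero (hn : n = 2 * K + 3) : (sphereMeasure n).real univ ≠ 0 :=
  right_ne_zero_of_mul_eq_one (descConst_mul_pi_mul_sphereMeasure hn)

theorem solution_zero [CompleteSpace E] (hn : n = 2 * K + 3) {f : Euc (n + 1) → E}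
    (hf : ContDiff ℝ ((K + 1 : ℕ) : WithTop ℕ∞) f) (X : Euc (n + 1)) : solution K f (X, 0) = f X := by
  rw [solution, holWave_zero_radius hf, inv_smul_smul₀ (sphereMeasure_real_univ_ne_zero hn)]

/-- The horizontal terms agree with those of the elliptic operator at once. In the slot of index `0`
the velocity `i ∂_0 f` meets the coefficient `-i e_0`, and the product is `e_0 ∂_0 f`. -/
theorem dirac_solution_zero (hn : n = 2 * K + 3) {f : Euc (n + 1) → Cl (n + 1)}
    (hf : ContDiff ℝ ((K + 2 : ℕ) : WithTop ℕ∞) f) (X : Euc (n + 1)) :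
    dirac (solution K f) (X, 0) = ellipticDirac f X := by
  rw [dirac, ellipticDirac]
  refine Finset.sum_congr rfl fun a _ => ?_
  rw [((hf.differentiable (by simp)) X).lineDeriv_eq_fderiv]
  by_cases ha : a = 0
  · subst ha
    rw [diracCoeff, diracDir, if_pos rfl, if_pos rfl, fderiv_solution_snd hf,
      deriv_holWave_zero_radius hn hf, inv_smul_smul₀ (sphereMeasure_real_univ_ne_zero hn), neg_mul,
      smul_mul_assoc, mul_smul_comm, smul_smul, Complex.I_mul_I, neg_one_smul, neg_neg]
  · rw [diracCoeff, diracDir, if_neg ha, if_neg ha, fderiv_solution_fst hf,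
      solution_zero hn (contDiff_fderiv_apply hf _)]

theorem contDiff_realPoint {l : WithTop ℕ∞} :
    ContDiff ℝ l fun p : Euc n × ℝ × ℝ => (realPoint p.1 p.2.1, p.2.2) := by
  simp only [realPoint_eq]
  exact (((emb n).contDiff.comp contDiff_fst).add
    (contDiff_snd.fst.smul contDiff_const)).prodMk contDiff_snd.snd

end Solution

end HolPot

theorem theorem7 (n k : ℕ) (hn : 3 ≤ n) (hk : n = 2 * k + 1)
    (f j : HolPot.Euc (n + 1) → HolPot.Cl (n + 1))
    (hf : ContDiff ℝ ((k + 2 : ℕ) : WithTop ℕ∞) f)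
    (hj : ∀ X, HolPot.ellipticDirac f X = j X) :
    (∀ (x : HolPot.Euc n) (s t : ℝ),
      HolPot.IsExtensionValue f (HolPot.spacetimePoint x s t) (HolPot.ftilde f x s t)) ∧
    ContDiff ℝ 2 (fun p : HolPot.Euc n × ℝ × ℝ => HolPot.ftilde f p.1 p.2.1 p.2.2) ∧
    ContDiff ℝ 1 (fun p : HolPot.Euc n × ℝ × ℝ => HolPot.jtilde f p.1 p.2.1 p.2.2) ∧
    (∀ (x : HolPot.Euc n) (s t : ℝ),
      HolPot.hyperbolicDirac (fun x' t' => HolPot.jtilde f x' s t') x t = 0) ∧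
    (∀ (x : HolPot.Euc n) (s : ℝ), HolPot.ftilde f x s 0 = f (HolPot.realPoint x s)) ∧
    (∀ (x : HolPot.Euc n) (s : ℝ), HolPot.jtilde f x s 0 = j (HolPot.realPoint x s)) := by
  -- Here `n ≥ 3` is used. With `k = K + 1` the class `C^(k + 2)` is `C^(K + 3)`, and `holWave`
  -- loses `K + 1` derivatives, which leaves the two that are claimed.
  obtain ⟨K, rfl⟩ : ∃ K, k = K + 1 := ⟨k - 1, by omega⟩
  have hn' : n = 2 * K + 3 := by omega
  have hf3 : ContDiff ℝ ((K + 3 : ℕ) : WithTop ℕ∞) f := hf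
  have hf2 : ContDiff ℝ ((K + 2 : ℕ) : WithTop ℕ∞) f := hf.of_le (by norm_cast; omega)
  have hft : ∀ x s t, HolPot.ftilde f x s t = HolPot.solution K f (HolPot.realPoint x s, t) :=
    HolPot.ftilde_eq hn' hf3
  have hS : ContDiff ℝ 2 (HolPot.solution K f) := HolPot.contDiff_solution (l := 2) hf3
  have hD : ContDiff ℝ 1 (HolPot.dirac (HolPot.solution K f)) := HolPot.contDiff_dirac (l := 1) hS
  have hjt : ∀ x s t, HolPot.jtilde f x s t
      = HolPot.dirac (HolPot.solution K f) (HolPot.realPoint x s, t) := fun x s t => by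
    simp only [HolPot.jtilde, hft]
    exact HolPot.hyperbolicDirac_eq_dirac (hS.differentiable (by simp)) x s t
  refine ⟨fun x s t => ?_, ?_, ?_, fun x s t => ?_, fun x s => ?_, fun x s => ?_⟩
  · rw [hft]
    exact HolPot.isExtensionValue_holWave hn' hf3 x s t
  · simp only [hft]
    exact hS.comp HolPot.contDiff_realPoint
  · simp only [hjt]
    exact hD.comp HolPot.contDiff_realPoint
  · simp only [hjt]
    rw [HolPot.hyperbolicDirac_eq_dirac (hD.differentiable (by simp)), HolPot.dirac_dirac hS,
      HolPot.solution_wave hn' hf3, sub_self]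
  · rw [hft, HolPot.solution_zero hn' (hf3.of_le (by norm_cast; omega))]
  · rw [hjt, HolPot.dirac_solution_zero hn' hf2, hj]
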